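/- Let $L$ be an algebraically closed field. Put $K_0=L$, $K_{i+1}=K_i((t_{i+1}))^{\mathrm{alg}}$ and $K_\omega=\bigcup_i K_i$. For each $i$ let $\bar v_{i+1}$ be the unique extension to $K_{i+1}$ of the $t_{i+1}$-adic valuation, and let $\pi_{i+1}:P^N(K_{i+1})\to P^N(K_i)$ be the map that scales homogeneous coordinates so that they lie in the valuation ring and not all in its maximal ideal, and then takes residues. These maps induce the specialisation map $\Pi_\omega:P^N(K_\omega)\to P^N(L)$, applied componentwise to tuples; for a tuple $a$ of points of $P^N(L)$ let $\mathcal V_a=\Pi_\omega^{-1}(a)$. Let $V\subset P^N$ be a smooth irreducible projective variety over $L$. If $D\subset V^m$ and $F\subset D\times V^k$ are closed subvarieties over $L$, then $F$ is a finite cover of $D$ if it projects onto $D$ with finite fibres. If moreover $D$ and $F$ are irreducible and $D$ is smooth, then for $(a,b)\in F(L)$ the Zariski multiplicity $\mathrm{mult}_{ab}(F/D)$ is the number of $b'\in\mathcal V_b$ with $(a',b')\in F(K_\omega)$, where $a'\in\mathcal V_a\cap D(K_\omega)$ is generic in $D$ over $L$ (that is, $a'$ lies in no proper closed subset of $D$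 defined over $L$). Let $F_1\subset V^m$, $F_2\subset F_1\times V^k$ and $F_3\subset F_2\times V^l$ be smooth irreducible closed subvarieties over $L$ such that $F_2$ is a finite cover of $F_1$ and $F_3$ is a finite cover of $F_2$, and let $(a,b,c)\in F_3(L)$. Then the multiplicities below are well defined (such generic points $a'$ exist and the number, which is finite, does not depend on the choice of $a'$), and $$\mathrm{mult}_{abc}(F_3/F_1)=\mathrm{mult}_{ab}(F_2/F_1)\cdot\mathrm{mult}_{bc}(F_3/F_2).$$ Here $F_3/F_1$ is the cover $F_3\subset F_1\times V^{k+l}$ with base point $a$ and fibre point $(b,c)$, and $F_3/F_2$ has base point $(a,b)$ and fibre point $c$. -/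

import Mathlib

open scoped LinearAlgebra.Projectivization LaurentSeries

noncomputable section

namespace ZariskiGeometry

universe u v w

/-! ### Subvarieties of powers of projective space

A closed subvariety of `(P^N)^ι` over an algebraically closed field `k` is represented by its set of
`k`-points. The polynomial ring `MvPolynomial (ι × Fin (N + 1)) k` has one block of `N + 1`
homogeneous coordinates for each factor. -/

/-- The `K`-points of projective space `P^N`. -/
abbrev PSpace (K : Type u) [Field K] (N : ℕ) : Type u := ℙ K (Fin (N + 1) → K)

/-- `p` is homogeneous in each of the blocks of variables `(i, 0), …, (i, N)` separately. -/
def IsMultihomogeneous {k : Type u} [Field k] {ι : Type v} {N : ℕ}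
    (p : MvPolynomial (ι × Fin (N + 1)) k) : Prop :=
  ∃ d : ι → ℕ, ∀ e ∈ p.support, ∀ i, ∑ j, e (i, j) = d i

/-- `p(x) = 0`; for multihomogeneous `p` this does not depend on the chosen representatives. -/
def VanishesAt {k : Type u} [Field k] {K : Type w} [Field K] [Algebra k K] {ι : Type v} {N : ℕ}
    (p : MvPolynomial (ι × Fin (N + 1)) k) (x : ι → PSpace K N) : Prop :=
  MvPolynomial.aeval (fun q : ι × Fin (N + 1) => (x q.1).rep q.2) p = 0

/-- Zariski closed subsets of `(P^N)^ι (k)`. -/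
def IsClosedSet {k : Type u} [Field k] {ι : Type v} {N : ℕ} (F : Set (ι → PSpace k N)) : Prop :=
  ∃ S : Set (MvPolynomial (ι × Fin (N + 1)) k),
    (∀ p ∈ S, IsMultihomogeneous p) ∧ F = {x | ∀ p ∈ S, VanishesAt p x}

/-- Irreducible closed subsets (in particular nonempty). -/
def IsIrreducibleClosed {k : Type u} [Field k] {ι : Type v} {N : ℕ}
    (F : Set (ι → PSpace k N)) : Prop :=
  IsClosedSet F ∧ F.Nonempty ∧
    ∀ A B : Set (ι → PSpace k N), IsClosedSet A → IsClosedSet B → F ⊆ A ∪ B → F ⊆ A ∨ F ⊆ B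

/-- The part of `F` in the standard affine chart where the `c i`-th homogeneous coordinate of the
`i`-th component is nonzero for all `i`, each component being written with that coordinate equal
to `1`. -/
def affineChart {k : Type u} [Field k] {ι : Type v} {N : ℕ} (c : ι → Fin (N + 1))
    (F : Set (ι → PSpace k N)) : Set (ι × Fin (N + 1) → k) :=
  {v | (∀ i, v (i, c i) = 1) ∧
    ∃ x ∈ F, ∀ i, ∃ h : (fun j => v (i, j)) ≠ 0, Projectivization.mk k (fun j => v (i, j)) h = x i}

/-- The closed set `F` is smooth over `k`: its coordinate ring on each standard affine chart is a
smooth `k`-algebra. -/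
def IsSmoothVariety {k : Type u} [Field k] {ι : Type v} {N : ℕ}
    (F : Set (ι → PSpace k N)) : Prop :=
  ∀ c : ι → Fin (N + 1), Algebra.Smooth k
    (MvPolynomial (ι × Fin (N + 1)) k ⧸ MvPolynomial.vanishingIdeal k (affineChart c F))

/-- `F(K)`: the `K`-points of the closed subvariety with `k`-points `F`, that is, the common zeros
in `(P^N)^ι (K)` of all multihomogeneous polynomials over `k` vanishing on `F`. -/
def pointsOver {k : Type u} [Field k] (K : Type w) [Field K] [Algebra k K] {ι : Type v} {N : ℕ}
    (F : Set (ι → PSpace k N)) : Set (ι → PSpace K N) :=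
  {x | ∀ p : MvPolynomial (ι × Fin (N + 1)) k, IsMultihomogeneous p →
    (∀ y ∈ F, VanishesAt p y) → VanishesAt p x}

/-- `x ∈ F(K)` is generic in `F` over `k`: the smallest closed set defined over `k` containing `x`
is `F`. -/
def IsGenericPoint {k : Type u} [Field k] {K : Type w} [Field K] [Algebra k K] {ι : Type v} {N : ℕ}
    (F : Set (ι → PSpace k N)) (x : ι → PSpace K N) : Prop :=
  x ∈ pointsOver K F ∧
    ∀ p : MvPolynomial (ι × Fin (N + 1)) k, IsMultihomogeneous p →
      VanishesAt p x → ∀ y ∈ F, VanishesAt p y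

/-- The power `V^ι` of a subset `V` of `P^N(k)`. -/
def powerSet {k : Type u} [Field k] {N : ℕ} (V : Set (PSpace k N)) (ι : Type v) :
    Set (ι → PSpace k N) :=
  {x | ∀ i, x i ∈ V}

/-- The closed set `F ⊆ D × (P^N)^κ` is a finite cover of `D`: it projects onto `D`
and all its fibres over points of `D` are finite. -/
def IsFiniteCover {k : Type u} [Field k] {ι κ : Type v} {N : ℕ}
    (F : Set (ι ⊕ κ → PSpace k N)) (D : Set (ι → PSpace k N)) : Prop :=
  IsClosedSet F ∧ (fun x i => x (Sum.inl i)) '' F = D ∧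
    ∀ a ∈ D, {b : κ → PSpace k N | Sum.elim a b ∈ F}.Finite

/-- A subset of `((P^N)^ι × (P^N)^κ) × (P^N)^μ`, seen as a subset of
`(P^N)^ι × ((P^N)^κ × (P^N)^μ)`. -/
def reassoc {k : Type u} [Field k] {ι κ μ : Type v} {N : ℕ}
    (F : Set ((ι ⊕ κ) ⊕ μ → PSpace k N)) : Set (ι ⊕ (κ ⊕ μ) → PSpace k N) :=
  {x | (fun s => x (Equiv.sumAssoc ι κ μ s)) ∈ F}

/-! ### The universal extension `K_ω`

`K_0 = L`, `K_{n+1}` is the algebraic closure of the Laurent series field over `K_n`, and `K_ω` is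
the union (direct limit) of the tower. -/

/-- A field, bundled; used for the recursion defining the tower. -/
structure BundledField : Type (u + 1) where
  carrier : Type u
  [isField : Field carrier]

/-- The tower `K_0 = L`, `K_{n+1} = K_n((t))^alg`. -/
def tower (L : Type u) [Field L] : ℕ → BundledField.{u}
  | 0 => ⟨L⟩
  | n + 1 =>
    letI := (tower L n).isField
    ⟨AlgebraicClosure (tower L n).carrier⸨X⸩⟩

/-- The field `K_n`. -/
abbrev towerField (L : Type u) [Field L] (n : ℕ) : Type u := (tower L n).carrier

instance (L : Type u) [Field L] (n : ℕ) : Field (towerField L n) := (tower L n).isField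

/-- The inclusion of `k` in the algebraic closure of `k((t))`, as constant series. -/
def constEmbedding (k : Type u) [Field k] : k →+* AlgebraicClosure k⸨X⸩ :=
  (algebraMap k⸨X⸩ (AlgebraicClosure k⸨X⸩)).comp HahnSeries.C

/-- The inclusion `K_n → K_{n+1}`. -/
def towerStep (L : Type u) [Field L] (n : ℕ) : towerField L n →+* towerField L (n + 1) :=
  constEmbedding (towerField L n)

/-- The inclusion `K_m → K_n` for `m ≤ n`. -/
def towerMap (L : Type u) [Field L] (m n : ℕ) (h : m ≤ n) : towerField L m →+* towerField L n :=
  Nat.leRecOn (C := fun j => towerField L m →+* towerField L j) h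
    (fun {j} f => (towerStep L j).comp f) (RingHom.id _)

theorem towerMap_self (L : Type u) [Field L] (m : ℕ) :
    towerMap L m m le_rfl = RingHom.id _ :=
  Nat.leRecOn_self (C := fun j => towerField L m →+* towerField L j) _

theorem towerMap_succ (L : Type u) [Field L] {m n : ℕ} (h : m ≤ n) :
    towerMap L m (n + 1) (h.trans n.le_succ) = (towerStep L n).comp (towerMap L m n h) :=
  Nat.leRecOn_succ (C := fun j => towerField L m →+* towerField L j) h _

instance (L : Type u) [Field L] :
    DirectedSystem (towerField L) (fun i j h => (towerMap L i j h : towerField L i → towerField L j))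
    where
  map_self i x := by rw [towerMap_self]; rfl
  map_map k j i hij hjk x := by
    induction k, hjk using Nat.le_induction with
    | base => rw [towerMap_self]; rfl
    | succ n hn ih =>
      rw [towerMap_succ L hn, towerMap_succ L (hij.trans hn), RingHom.comp_apply,
        RingHom.comp_apply, ih]

/-- The field `K_ω`, the union of the tower. -/
abbrev Komega (L : Type u) [Field L] : Type u := DirectLimit (towerField L) (towerMap L)

/-- The inclusion `K_n → K_ω`. -/
def toKomega (L : Type u) [Field L] (n : ℕ) : towerField L n →+* Komega L where
  toFun x := ⟦⟨n, x⟩⟧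
  map_one' := (DirectLimit.one_def n).symm
  map_mul' x y := (DirectLimit.mul_def n x y).symm
  map_zero' := (DirectLimit.zero_def n).symm
  map_add' x y := (DirectLimit.add_def n x y).symm

/-- The inclusion `L = K_0 → K_ω`. -/
instance (L : Type u) [Field L] : Algebra L (Komega L) := (toKomega L 0).toAlgebra

/-! ### Specialisation -/

/-- The extension of the `t`-adic valuation of `k((t))` to its algebraic closure, given by
`v(α) = (1/d) ord N(α)`, where `d` and `N` are the degree and the norm of `k((t))(α)` over
`k((t))`; `v(0) = ∞`. -/
def seriesVal {k : Type u} [Field k] (α : AlgebraicClosure k⸨X⸩) : WithTop ℚ :=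
  open scoped Classical in
  if α = 0 then ⊤
  else (((HahnSeries.order
      (Algebra.norm k⸨X⸩ (IntermediateField.AdjoinSimple.gen k⸨X⸩ α)) : ℤ) : ℚ) /
    (Module.finrank k⸨X⸩ (IntermediateField.adjoin k⸨X⸩ {α}) : ℚ) : ℚ)

/-- The graph of the specialisation map `P^N(k((t))^alg) → P^N(k)`: choose homogeneous coordinates
`f` in the valuation ring, not all in the maximal ideal, and pass to their residues `g`. -/
def SpecialisesStep {k : Type u} [Field k] {N : ℕ}
    (x : PSpace (AlgebraicClosure k⸨X⸩) N) (y : PSpace k N) : Prop :=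
  ∃ (f : Fin (N + 1) → AlgebraicClosure k⸨X⸩) (hf : f ≠ 0) (g : Fin (N + 1) → k) (hg : g ≠ 0),
    x = Projectivization.mk _ f hf ∧ y = Projectivization.mk _ g hg ∧
      (∀ j, 0 ≤ seriesVal (f j)) ∧ ∀ j, 0 < seriesVal (f j - constEmbedding k (g j))

/-- The graph of the composite specialisation map `P^N(K_n) → P^N(K_{n-1}) → ⋯ → P^N(L)`. -/
def SpecialisesFrom (L : Type u) [Field L] {N : ℕ} :
    (n : ℕ) → PSpace (towerField L n) N → PSpace L N → Prop
  | 0, x, a => x = a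
  | n + 1, x, a =>
    ∃ y : PSpace (towerField L n) N,
      SpecialisesStep (k := towerField L n) x y ∧ SpecialisesFrom L n y a

/-- The graph of the specialisation map `Π_ω : P^N(K_ω) → P^N(L)`: a point of `P^N(K_ω)` has
coordinates in some `K_n`. -/
def Specialises {L : Type u} [Field L] {N : ℕ} (x : PSpace (Komega L) N) (a : PSpace L N) : Prop :=
  ∃ (n : ℕ) (f : Fin (N + 1) → towerField L n) (hf : f ≠ 0)
    (hf' : (fun j => toKomega L n (f j)) ≠ 0),
    x = Projectivization.mk _ (fun j => toKomega L n (f j)) hf' ∧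
      SpecialisesFrom L n (Projectivization.mk _ f hf) a

/-- The infinitesimal neighbourhood `𝒱_a` of a tuple `a` of `L`-points: the tuples of `K_ω`-points
specialising to `a` componentwise. -/
def infNhd {L : Type u} [Field L] {ι : Type v} {N : ℕ} (a : ι → PSpace L N) :
    Set (ι → PSpace (Komega L) N) :=
  {x | ∀ i, Specialises (x i) (a i)}

/-- `mult_{ab}(F/D) = n`: there are points `a' ∈ 𝒱_a ∩ D(K_ω)` generic in `D` over `L`, and for
every such `a'` exactly `n` points `b' ∈ 𝒱_b` satisfy `(a', b') ∈ F(K_ω)`. -/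
def HasZariskiMult {L : Type u} [Field L] {ι κ : Type v} {N : ℕ}
    (F : Set (ι ⊕ κ → PSpace L N)) (D : Set (ι → PSpace L N))
    (a : ι → PSpace L N) (b : κ → PSpace L N) (n : ℕ) : Prop :=
  (∃ a' ∈ infNhd a, IsGenericPoint D a') ∧
    ∀ a' ∈ infNhd a, IsGenericPoint D a' →
      {b' : κ → PSpace (Komega L) N |
        Sum.elim a' b' ∈ pointsOver (Komega L) F ∧ b' ∈ infNhd b}.encard = n

end ZariskiGeometry

end

noncomputable section

namespace ZariskiGeometry

open Polynomial
open scoped IntermediateField PowerSeries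

universe u v w

/-! The specialisation map comes from a place of the algebraically closed field `K_ω` with residue
field `L`. The product formula follows from two facts about a finite cover `F` of a smooth
irreducible `D` with `F` irreducible, both in `exists_encard_infNhd`: the number of points of `F`
near `(a, b)` over a generic `a'` near `a` does not depend on `a'`, and each point `(a', b')` so
found is again generic in `F`. Granted these, the points `(b', c')` over `a'` fibre over the `p`
points `b'`, and each `(a', b')`, being generic in `F₂` and near `(a, b)`, carries `q` points `c'`.

For the count, pass to coordinate rings `A → B` of affine charts around `a` and `(a, b)`. Generic
points near `a` are injective homomorphisms `φ : A → K_ω` whose residue is evaluation at `a`, and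
points over them are extensions of `φ` to `B` with residue evaluation `σ` at `(a, b)`. After
localising at `a`, the base `O` is normal because `D` is smooth
(`isIntegrallyClosed_localization_of_smooth`), and `B` becomes integral over `O` because the fibre
is finite (`exists_relation_of_finite_fibre`, a valuative argument).

Choose `f` in `B` separating the finitely many homomorphisms involved. By normality its minimal
polynomial over `O` stays irreducible over the fraction field, so extensions of `φ` correspond to
roots of its image under `φ`, all of one multiplicity (the inseparable degree). The number of roots
with residue `σ f`, times that multiplicity, is the multiplicity of `σ f` in the polynomial reduced
at `a` (`IsPlace.ncard_roots_mul`), which does not involve `φ`. This is `ncard_specialisingHoms`.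
Genericity persists because a nonzero ideal of an integral extension domain meets the base
nontrivially.

Generic points near `a` exist by Noether normalisation: the variables `t_i` give a generic
infinitesimal point of affine space, which is lifted along an integral extension. -/

/-! ### The `t`-adic valuation on the algebraic closure of `k((t))` -/

theorem coeff_le_one_of_coeff_zero {K L : Type*} [NontriviallyNormedField K] [IsUltrametricDist K] [CompleteSpace K]
    [Field L] [Algebra K L] [Algebra.IsAlgebraic K L] [IsAlgClosed L] (α : L)
    (h : ‖(minpoly K α).coeff 0‖ ≤ 1) (n : ℕ) : ‖(minpoly K α).coeff n‖ ≤ 1 := by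
  have hint : IsIntegral K α := Algebra.IsIntegral.isIntegral α
  have hm := minpoly.monic hint
  refine (spectralValue_le_one_iff hm).1 ?_ n
  change spectralNorm K L α ≤ 1
  set P := (minpoly K α).map (algebraMap K L) with hP
  have hs : P.Splits := IsAlgClosed.splits P
  have hPm : P.Monic := hm.map _
  have h0 := hs.coeff_zero_eq_prod_roots_of_monic hPm
  have hcard := hs.natDegree_eq_card_roots
  -- The spectral norm is read off the minimal polynomial, so conjugates share it; the constant
  -- coefficient, a signed product of conjugates, then has norm `‖α‖ ^ deg`.
  have hall : ∀ x ∈ P.roots, spectralNorm K L x = spectralNorm K L α := by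
    intro x hx
    have hx' : aeval x (minpoly K α) = 0 := by
      have := (mem_roots'.1 hx).2
      rwa [IsRoot, hP, eval_map_algebraMap] at this
    unfold spectralNorm
    rw [minpoly.eq_of_irreducible_of_monic (minpoly.irreducible hint) hx' hm]
  have key : ‖(minpoly K α).coeff 0‖ = spectralNorm K L α ^ P.natDegree := by
    rw [← spectralNorm_extends (L := L), ← coeff_map, ← hP, h0]
    have hprod : ∀ s : Multiset L, (∀ x ∈ s, spectralNorm K L x = spectralNorm K L α) →
        spectralMulAlgNorm K L s.prod = spectralNorm K L α ^ s.card := by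
      intro s
      induction s using Multiset.induction with
      | empty => intro _; simp
      | cons a s ih =>
        intro h
        rw [Multiset.prod_cons, map_mul, ih (fun x hx => h x (Multiset.mem_cons_of_mem hx)), spectralMulAlgNorm_def,
          h a (Multiset.mem_cons_self a s), Multiset.card_cons, pow_succ']
    have h1 : spectralMulAlgNorm K L ((-1) ^ P.natDegree) = 1 := by
      rw [map_pow]; simp [spectralMulAlgNorm_def, spectralNorm_one]
    rw [← spectralMulAlgNorm_def, map_mul, h1, one_mul, hprod _ hall, ← hcard]
  rw [key] at h
  have hpos : P.natDegree ≠ 0 := by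
    rw [hP, hm.natDegree_map]; exact (minpoly.natDegree_pos hint).ne'
  exact (pow_le_one_iff_of_nonneg (spectralNorm_nonneg _) hpos).1 h

theorem laurent_minpoly {k : Type*} [Field k] (α : AlgebraicClosure k⸨X⸩)
   (h : Valued.v ((minpoly k⸨X⸩ α).coeff 0) ≤ (1 : WithZero (Multiplicative ℤ))) (n : ℕ) :
    Valued.v ((minpoly k⸨X⸩ α).coeff n) ≤ (1 : WithZero (Multiplicative ℤ)) := by
  have : (Valued.v : Valuation k⸨X⸩ (WithZero (Multiplicative ℤ))).IsNontrivial := by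
    obtain ⟨x, hx⟩ := LaurentSeries.valuation_surjective k (WithZero.exp (1:ℤ))
    exact ⟨x, by rw [hx]; simp, by rw [hx]; exact ne_of_gt (by rw [← WithZero.exp_zero]; exact WithZero.exp_lt_exp.2 one_pos)⟩
  let : (Valued.v : Valuation k⸨X⸩ (WithZero (Multiplicative ℤ))).RankOne :=
    (Valuation.nonempty_rankOne_iff_mulArchimedean.2 inferInstance).some
  let := Valued.toNontriviallyNormedField (L := k⸨X⸩) (Γ₀ := (WithZero (Multiplicative ℤ)))
  have := coeff_le_one_of_coeff_zero (K := k⸨X⸩) α (Valued.toNormedField.norm_le_one_iff.2 h) n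
  exact Valued.toNormedField.norm_le_one_iff.1 this

theorem order_nonneg_iff {k : Type*} [Field k] {f : k⸨X⸩} (hf : f ≠ 0) :
    0 ≤ f.order ↔ Valued.v f ≤ (1 : WithZero (Multiplicative ℤ)) := by
  have h := LaurentSeries.valuation_le_iff_coeff_lt_eq_zero k (D := 0) (f := f)
  rw [neg_zero, WithZero.exp_zero] at h
  rw [h]
  refine ⟨fun h0 n hn => HahnSeries.coeff_eq_zero_of_lt_order (hn.trans_le h0), fun h0 => ?_⟩
  by_contra hlt
  exact HahnSeries.coeff_order_eq_zero.not.2 hf (h0 _ (not_le.1 hlt))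

theorem order_inv {k : Type*} [Field k] {f : k⸨X⸩} (hf : f ≠ 0) : f⁻¹.order = -f.order := by
  have := HahnSeries.order_mul hf (inv_ne_zero hf)
  rw [mul_inv_cancel₀ hf, HahnSeries.order_one] at this
  linarith

theorem seriesVal_eq {k : Type*} [Field k] {α : AlgebraicClosure k⸨X⸩} (hα : α ≠ 0)
    (E : IntermediateField k⸨X⸩ (AlgebraicClosure k⸨X⸩)) (hE : E = k⸨X⸩⟮α⟯) (x : E) (hx : (x : AlgebraicClosure k⸨X⸩) = α) :
    seriesVal α = (((HahnSeries.order (Algebra.norm k⸨X⸩ x) : ℤ) : ℚ) / (Module.finrank k⸨X⸩ E : ℚ) : ℚ) := by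
  subst hE
  have : x = IntermediateField.AdjoinSimple.gen k⸨X⸩ α := Subtype.ext (by simpa using hx)
  subst this
  simp [seriesVal, hα]

theorem finrank_adjoin_simple_pos {k : Type*} [Field k] (α : AlgebraicClosure k⸨X⸩) :
    0 < Module.finrank k⸨X⸩ k⸨X⸩⟮α⟯ := by
  have := IntermediateField.adjoin.finiteDimensional (Algebra.IsIntegral.isIntegral (R := k⸨X⸩) α)
  exact Module.finrank_pos

/-- Up to sign, the norm in `seriesVal` is the constant coefficient of the minimal polynomial. By
completeness its integrality forces that of all coefficients. Conversely, `k⟦X⟧` is integrally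
closed, so the minimal polynomial of an integral element has integral coefficients. -/
theorem seriesVal_nonneg_iff {k : Type*} [Field k] {α : AlgebraicClosure k⸨X⸩} (hα : α ≠ 0) :
    0 ≤ seriesVal α ↔ IsIntegral k⟦X⟧ α := by
  have hint : IsIntegral k⸨X⸩ α := Algebra.IsIntegral.isIntegral α
  rw [seriesVal_eq hα _ rfl (IntermediateField.AdjoinSimple.gen k⸨X⸩ α) rfl]
  have hpos : (0 : ℚ) < Module.finrank k⸨X⸩ k⸨X⸩⟮α⟯ := by exact_mod_cast finrank_adjoin_simple_pos α
  have h0 : (minpoly k⸨X⸩ α).coeff 0 ≠ 0 := minpoly.coeff_zero_ne_zero hint hα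
  have hn : Algebra.norm k⸨X⸩ (IntermediateField.AdjoinSimple.gen k⸨X⸩ α) =
      (-1) ^ (minpoly k⸨X⸩ α).natDegree * (minpoly k⸨X⸩ α).coeff 0 := by
    have := Algebra.PowerBasis.norm_gen_eq_coeff_zero_minpoly (IntermediateField.adjoin.powerBasis hint)
    rw [IntermediateField.adjoin.powerBasis_gen, IntermediateField.minpoly_gen] at this
    rw [this, IntermediateField.adjoin.powerBasis_dim]
  have hn0 : Algebra.norm k⸨X⸩ (IntermediateField.AdjoinSimple.gen k⸨X⸩ α) ≠ 0 := by
    rw [hn]; exact mul_ne_zero (pow_ne_zero _ (by simp)) h0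
  have h1 : (0 : WithTop ℚ) ≤ (((HahnSeries.order (Algebra.norm k⸨X⸩ (IntermediateField.AdjoinSimple.gen k⸨X⸩ α)) : ℤ) : ℚ) / (Module.finrank k⸨X⸩ k⸨X⸩⟮α⟯ : ℚ) : ℚ) ↔
     Valued.v ((minpoly k⸨X⸩ α).coeff 0) ≤ (1 : WithZero (Multiplicative ℤ)) := by
    rw [← WithTop.coe_zero, WithTop.coe_le_coe, le_div_iff₀ hpos, zero_mul, Int.cast_nonneg_iff, order_nonneg_iff hn0, hn, map_mul, map_pow, Valuation.map_neg, map_one,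
      one_pow, one_mul]
  rw [h1]
  constructor
  · intro h
    have hc : ∀ n, ∃ F : k⟦X⟧, (F : k⸨X⸩) = (minpoly k⸨X⸩ α).coeff n := fun n =>
      (LaurentSeries.val_le_one_iff_eq_coe k _).1 (laurent_minpoly α h n)
    have : minpoly k⸨X⸩ α ∈ Polynomial.lifts (algebraMap k⟦X⟧ k⸨X⸩) := by
      rw [Polynomial.lifts_iff_coeff_lifts]
      exact fun n => hc n
    obtain ⟨q, hq, -, hqm⟩ := Polynomial.lifts_and_degree_eq_and_monic this (minpoly.monic hint)
    refine ⟨q, hqm, ?_⟩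
    have := minpoly.aeval k⸨X⸩ α
    rw [← hq, aeval_map_algebraMap] at this
    exact this
  · intro h
    rw [minpoly.isIntegrallyClosed_eq_field_fractions' k⸨X⸩ h, coeff_map]
    exact (LaurentSeries.val_le_one_iff_eq_coe k _).2 ⟨_, rfl⟩

/-- The elements `α` and `α⁻¹` generate the same field, where the norm is multiplicative, so their
valuations are opposite. -/
theorem seriesVal_pos_iff {k : Type*} [Field k] {α : AlgebraicClosure k⸨X⸩} (hα : α ≠ 0) :
    0 < seriesVal α ↔ ¬ IsIntegral k⟦X⟧ α⁻¹ := by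
  have := IntermediateField.adjoin.finiteDimensional (Algebra.IsIntegral.isIntegral (R := k⸨X⸩) α)
  have hn : Algebra.norm k⸨X⸩ (IntermediateField.AdjoinSimple.gen k⸨X⸩ α) ≠ 0 :=
    Algebra.norm_ne_zero_iff.2 fun h => hα (by simpa using congrArg Subtype.val h)
  have hinv : Algebra.norm k⸨X⸩ (IntermediateField.AdjoinSimple.gen k⸨X⸩ α)⁻¹ =
      (Algebra.norm k⸨X⸩ (IntermediateField.AdjoinSimple.gen k⸨X⸩ α))⁻¹ :=
    eq_inv_of_mul_eq_one_left (by
      rw [← map_mul, inv_mul_cancel₀ (fun h => hn (by simp [h])), map_one])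
  rw [← seriesVal_nonneg_iff (inv_ne_zero hα), seriesVal_eq hα _ rfl (IntermediateField.AdjoinSimple.gen k⸨X⸩ α) rfl,
    seriesVal_eq (inv_ne_zero hα) k⸨X⸩⟮α⟯ ?_ (IntermediateField.AdjoinSimple.gen k⸨X⸩ α)⁻¹ (by simp)]
  · have hpos : (0 : ℚ) < Module.finrank k⸨X⸩ k⸨X⸩⟮α⟯ := by exact_mod_cast finrank_adjoin_simple_pos α
    rw [← WithTop.coe_zero, WithTop.coe_le_coe, WithTop.coe_lt_coe, le_div_iff₀ hpos, lt_div_iff₀ hpos,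
      hinv, zero_mul, order_inv hn]
    simp
  · apply le_antisymm <;> rw [IntermediateField.adjoin_simple_le_iff]
    · simpa using inv_mem (IntermediateField.mem_adjoin_simple_self k⸨X⸩ α⁻¹)
    · simpa using inv_mem (IntermediateField.mem_adjoin_simple_self k⸨X⸩ α)

/-! ### Places as relations, and the place `k((t))^alg → k` -/

/-- `S` is the graph of a place of `K` with residue field `k`: a ring homomorphism to `k` defined
on a valuation ring of `K`. -/
structure IsPlace {K : Type*} {k : Type*} [Field K] [Field k] (S : K → k → Prop) : Prop where
  one : S 1 1
  add : ∀ {x y a b}, S x a → S y b → S (x + y) (a + b)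
  neg : ∀ {x a}, S x a → S (-x) (-a)
  mul : ∀ {x y a b}, S x a → S y b → S (x * y) (a * b)
  unique : ∀ {x a b}, S x a → S x b → a = b
  total : ∀ x, (∃ a, S x a) ∨ S x⁻¹ 0

theorem seriesVal_zero {k : Type*} [Field k] : seriesVal (0 : AlgebraicClosure k⸨X⸩) = ⊤ := by
  simp [seriesVal]

theorem seriesVal_nonneg_iff' {k : Type*} [Field k] (α : AlgebraicClosure k⸨X⸩) :
    0 ≤ seriesVal α ↔ IsIntegral k⟦X⟧ α := by
  by_cases h : α = 0
  · subst h; simp [seriesVal_zero, isIntegral_zero]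
  · exact seriesVal_nonneg_iff h

theorem isIntegral_or_inv {k : Type*} [Field k] (α : AlgebraicClosure k⸨X⸩) :
    IsIntegral k⟦X⟧ α ∨ IsIntegral k⟦X⟧ α⁻¹ := by
  by_cases h : α = 0
  · subst h; left; exact isIntegral_zero
  by_contra! hc
  have h1 := (seriesVal_pos_iff h).2 hc.2
  exact hc.1 ((seriesVal_nonneg_iff h).1 h1.le)

/-- The valuation ring of the extension of the `t`-adic valuation to `k((t))^alg`. -/
def seriesRing (k : Type*) [Field k] : ValuationSubring (AlgebraicClosure k⸨X⸩) where
  __ := (integralClosure k⟦X⟧ (AlgebraicClosure k⸨X⸩)).toSubring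
  mem_or_inv_mem' := isIntegral_or_inv

theorem mem_seriesRing {k : Type*} [Field k] {α : AlgebraicClosure k⸨X⸩} :
    α ∈ seriesRing k ↔ IsIntegral k⟦X⟧ α := Iff.rfl

theorem mem_seriesRing_iff {k : Type*} [Field k] {α : AlgebraicClosure k⸨X⸩} :
    α ∈ seriesRing k ↔ 0 ≤ seriesVal α := (seriesVal_nonneg_iff' α).symm

theorem seriesVal_pos_iff_mem_nonunits {k : Type*} [Field k] {α : AlgebraicClosure k⸨X⸩} :
    0 < seriesVal α ↔ α ∈ (seriesRing k).nonunits := by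
  by_cases h : α = 0
  · subst h; simp [seriesVal_zero]
  · rw [seriesVal_pos_iff h, ← mem_seriesRing]
    have := (seriesRing k).inv_mem_nonunits_iff (x := α⁻¹)
    rw [inv_inv] at this
    simp [this, h]

theorem constEmbedding_mem {k : Type*} [Field k] (g : k) : constEmbedding k g ∈ seriesRing k := by
  rw [mem_seriesRing]
  have : constEmbedding k g = algebraMap k⟦X⟧ (AlgebraicClosure k⸨X⸩) (PowerSeries.C g) := by
    rw [IsScalarTower.algebraMap_apply k⟦X⟧ k⸨X⸩ (AlgebraicClosure k⸨X⸩)]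
    simp [constEmbedding]
  rw [this]
  exact isIntegral_algebraMap

theorem constEmbedding_mem_nonunits {k : Type*} [Field k] {g : k} :
    constEmbedding k g ∈ (seriesRing k).nonunits ↔ g = 0 := by
  constructor
  · intro h
    by_contra hg
    rw [← inv_inv (constEmbedding k g), (seriesRing k).inv_mem_nonunits_iff, ← map_inv₀] at h
    rcases h with h | h
    · exact hg (by simpa using h)
    · exact h (constEmbedding_mem _)
  · rintro rfl; simp

/-- Otherwise `X⁻¹` would be integral over the integrally closed ring `k⟦X⟧`, hence a power series.
-/
theorem X_mem_nonunits {k : Type*} [Field k] :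
    algebraMap k⸨X⸩ (AlgebraicClosure k⸨X⸩) ((PowerSeries.X : k⟦X⟧) : k⸨X⸩) ∈ (seriesRing k).nonunits := by
  by_contra h
  set t := algebraMap k⸨X⸩ (AlgebraicClosure k⸨X⸩) ((PowerSeries.X : k⟦X⟧) : k⸨X⸩) with ht
  have h0 : t ≠ 0 := by
    rw [ht]
    simp
  have h1 : t⁻¹ ∈ seriesRing k := by
    have := (seriesRing k).inv_mem_nonunits_iff (x := t⁻¹)
    rw [inv_inv] at this
    by_contra h2
    exact h (this.2 (Or.inr h2))
  rw [mem_seriesRing, ht, ← map_inv₀, isIntegral_algebraMap_iff (algebraMap k⸨X⸩ (AlgebraicClosure k⸨X⸩)).injective,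
    IsIntegrallyClosed.isIntegral_iff] at h1
  obtain ⟨F, hF⟩ := h1
  have h2 : (((F * PowerSeries.X : k⟦X⟧)) : k⸨X⸩) = ((1 : k⟦X⟧) : k⸨X⸩) := by
    rw [PowerSeries.coe_mul]
    change algebraMap _ _ F * _ = _
    rw [hF, inv_mul_cancel₀, PowerSeries.coe_one]
    intro h
    exact h0 (by rw [ht, h, map_zero])
  have h3 := HahnSeries.ofPowerSeries_injective h2
  have := congrArg (PowerSeries.coeff 0) h3
  simp at this

theorem exists_valuation_sub_lt_one {K k Γ : Type*} [Field K] [Field k] [LinearOrderedCommGroupWithZero Γ]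
    (v : Valuation K Γ) (i : k →+* K) (α : K) (s : Multiset k)
    (h : v (s.map fun g => α - i g).prod < 1) : ∃ g ∈ s, v (α - i g) < 1 := by
  induction s using Multiset.induction with
  | empty => simp at h
  | cons a s ih =>
    by_contra! hc
    rw [Multiset.map_cons, Multiset.prod_cons, map_mul] at h
    refine absurd h (not_lt.2 (one_le_mul (hc a (Multiset.mem_cons_self a s)) (not_lt.1 fun h' => ?_)))
    obtain ⟨g, hg, hg'⟩ := ih h'
    exact absurd hg' (not_lt.2 (hc g (Multiset.mem_cons_of_mem hg)))

/-- Reduce an integral equation of `α` modulo `X`. The reduced polynomial takes at `α` a value in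
the maximal ideal and splits over `k`, so one of the factors `α - g` lies in the maximal ideal. -/
theorem exists_residue {k : Type*} [Field k] [IsAlgClosed k] {α : AlgebraicClosure k⸨X⸩}
    (hα : α ∈ seriesRing k) : ∃ g : k, α - constEmbedding k g ∈ (seriesRing k).nonunits := by
  obtain ⟨P, hP, hPα⟩ := id hα
  set P₀ := P.map (PowerSeries.constantCoeff (R := k)) with hP₀
  have hm : P₀.Monic := hP.map _
  have hprod : (P₀.roots.map fun g => α - constEmbedding k g).prod = P₀.eval₂ (constEmbedding k) α := by
    conv_rhs => rw [(IsAlgClosed.splits P₀).eq_prod_roots_of_monic hm]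
    rw [← coe_eval₂RingHom, map_multiset_prod, Multiset.map_map]
    simp
  have hmem : P₀.eval₂ (constEmbedding k) α ∈ (seriesRing k).nonunits := by
    have h1 : P₀.eval₂ (constEmbedding k) α =
        -(P.eval₂ (algebraMap k⟦X⟧ (AlgebraicClosure k⸨X⸩)) α - P₀.eval₂ (constEmbedding k) α) := by
      rw [hPα, zero_sub, neg_neg]
    rw [h1]
    refine neg_mem ?_
    rw [eval₂_eq_sum_range, hP₀, eval₂_map, eval₂_eq_sum_range, ← Finset.sum_sub_distrib]
    refine sum_mem fun n _ => ?_
    rw [← sub_mul]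
    obtain ⟨d, hd⟩ := PowerSeries.X_dvd_iff.2 (show PowerSeries.constantCoeff
      (P.coeff n - PowerSeries.C (PowerSeries.constantCoeff (P.coeff n))) = 0 by simp)
    have h2 : algebraMap k⟦X⟧ (AlgebraicClosure k⸨X⸩) (P.coeff n) -
        ((constEmbedding k).comp (PowerSeries.constantCoeff (R := k))) (P.coeff n) =
        algebraMap k⸨X⸩ (AlgebraicClosure k⸨X⸩) ((PowerSeries.X : k⟦X⟧) : k⸨X⸩) *
          algebraMap k⟦X⟧ (AlgebraicClosure k⸨X⸩) d := by
      have := congrArg (algebraMap k⟦X⟧ (AlgebraicClosure k⸨X⸩)) hd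
      rw [map_sub, map_mul] at this
      rw [IsScalarTower.algebraMap_apply k⟦X⟧ k⸨X⸩ (AlgebraicClosure k⸨X⸩) PowerSeries.X] at this
      rw [IsScalarTower.algebraMap_apply k⟦X⟧ k⸨X⸩ (AlgebraicClosure k⸨X⸩) (PowerSeries.C _)] at this
      simpa [constEmbedding] using this
    rw [h2, mul_assoc, ValuationSubring.mem_nonunits_iff, map_mul]
    refine mul_lt_one_of_lt_of_le ((seriesRing k).mem_nonunits_iff.1 X_mem_nonunits) ?_
    rw [ValuationSubring.valuation_le_one_iff]
    exact mul_mem (mem_seriesRing.2 isIntegral_algebraMap) (pow_mem hα n)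
  rw [← hprod, ValuationSubring.mem_nonunits_iff] at hmem
  obtain ⟨g, -, hg⟩ := exists_valuation_sub_lt_one _ _ _ _ hmem
  exact ⟨g, (seriesRing k).mem_nonunits_iff.2 hg⟩

/-- The graph of the place `k((t))^alg → k`. -/
def SeriesPlace {k : Type*} [Field k] (α : AlgebraicClosure k⸨X⸩) (g : k) : Prop :=
  0 ≤ seriesVal α ∧ 0 < seriesVal (α - constEmbedding k g)

theorem isPlace_series {k : Type*} [Field k] [IsAlgClosed k] : IsPlace (SeriesPlace (k := k)) := by
  unfold SeriesPlace
  simp only [← mem_seriesRing_iff, seriesVal_pos_iff_mem_nonunits]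
  have hmul : ∀ {x y : AlgebraicClosure k⸨X⸩}, x ∈ (seriesRing k).nonunits → y ∈ seriesRing k →
      x * y ∈ (seriesRing k).nonunits := fun {x y} hx hy => by
    rw [ValuationSubring.mem_nonunits_iff, map_mul]
    exact mul_lt_one_of_lt_of_le ((seriesRing k).mem_nonunits_iff.1 hx)
      ((ValuationSubring.valuation_le_one_iff _ _).2 hy)
  refine ⟨⟨one_mem _, by simp⟩, fun ⟨h1, h2⟩ ⟨h3, h4⟩ => ⟨add_mem h1 h3, ?_⟩,
    fun ⟨h1, h2⟩ => ⟨neg_mem h1, ?_⟩, fun {x y a b} ⟨h1, h2⟩ ⟨h3, h4⟩ => ⟨mul_mem h1 h3, ?_⟩,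
    fun {x a b} ⟨h1, h2⟩ ⟨h3, h4⟩ => ?_, fun x => ?_⟩
  · convert add_mem h2 h4 using 1; rw [map_add]; ring
  · convert neg_mem h2 using 1; rw [map_neg]; ring
  · convert add_mem (hmul h2 h3) (hmul h4 (constEmbedding_mem a)) using 1; rw [map_mul]; ring
  · have := sub_mem h4 h2
    rw [← sub_eq_zero, ← constEmbedding_mem_nonunits]
    convert this using 1; rw [map_sub]; ring
  · by_cases hx : x ∈ seriesRing k
    · exact Or.inl ((exists_residue hx).imp fun g hg => ⟨hx, hg⟩)
    · have := (seriesRing k).inv_mem_nonunits_iff.2 (Or.inr hx)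
      exact Or.inr ⟨ValuationSubring.nonunits_subset this, by simpa using this⟩

theorem seriesPlace_constEmbedding {k : Type*} [Field k] (g : k) : SeriesPlace (constEmbedding k g) g := by
  rw [SeriesPlace, ← mem_seriesRing_iff]
  exact ⟨constEmbedding_mem g, by simp [seriesVal_zero]⟩

namespace IsPlace

variable {K k l : Type*} [Field K] [Field k] [Field l] {S : K → k → Prop} (hS : IsPlace S)
include hS

theorem zero : S 0 0 := by simpa using hS.add hS.one (hS.neg hS.one)

theorem sub {x y a b} (h : S x a) (h' : S y b) : S (x - y) (a - b) := by
  simpa [sub_eq_add_neg] using hS.add h (hS.neg h')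

theorem inv {x a} (h : S x a) (ha : a ≠ 0) : S x⁻¹ a⁻¹ := by
  have hx : x ≠ 0 := by rintro rfl; exact ha (hS.unique h hS.zero)
  rcases hS.total x⁻¹ with ⟨b, hb⟩ | h'
  · have := hS.mul h hb
    rw [mul_inv_cancel₀ hx] at this
    rwa [inv_eq_of_mul_eq_one_right (hS.unique this hS.one)]
  · rw [inv_inv] at h'
    exact absurd (hS.unique h h') ha

theorem ne_zero {x a} (h : S x a) (ha : a ≠ 0) : x ≠ 0 := by
  rintro rfl; exact ha (hS.unique h hS.zero)

theorem comp {T : k → l → Prop} (hT : IsPlace T) : IsPlace (fun x b => ∃ a, S x a ∧ T a b) where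
  one := ⟨1, hS.one, hT.one⟩
  add := fun ⟨a, h1, h2⟩ ⟨b, h3, h4⟩ => ⟨a + b, hS.add h1 h3, hT.add h2 h4⟩
  neg := fun ⟨a, h1, h2⟩ => ⟨-a, hS.neg h1, hT.neg h2⟩
  mul := fun ⟨a, h1, h2⟩ ⟨b, h3, h4⟩ => ⟨a * b, hS.mul h1 h3, hT.mul h2 h4⟩
  unique := fun ⟨a, h1, h2⟩ ⟨b, h3, h4⟩ => by
    obtain rfl := hS.unique h1 h3
    exact hT.unique h2 h4
  total x := by
    rcases hS.total x with ⟨a, ha⟩ | h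
    · rcases hT.total a with ⟨b, hb⟩ | h'
      · exact Or.inl ⟨b, a, ha, hb⟩
      -- When `a = 0` the inverse of `x` need not have a residue, but `x` itself has composite
      -- residue `0`.
      · by_cases ha0 : a = 0
        · subst ha0; exact Or.inl ⟨0, 0, ha, hT.zero⟩
        · exact Or.inr ⟨_, hS.inv ha ha0, h'⟩
    · exact Or.inr ⟨0, h, hT.zero⟩

end IsPlace

/-! ### The place `K_ω → L` -/

/-- The graph of the composite of the places `K_n → K_{n-1} → ⋯ → L`. -/
def towerPlace (L : Type u) [Field L] : (n : ℕ) → towerField L n → L → Prop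
  | 0, x, a => x = a
  | n + 1, x, a => ∃ y : towerField L n,
SeriesPlace (k := towerField L n) x y ∧ towerPlace L n y a

instance isAlgClosed_towerField (L : Type u) [Field L] [IsAlgClosed L] (n : ℕ) :
    IsAlgClosed (towerField L n) := by
  cases n with
  | zero => exact inferInstanceAs (IsAlgClosed L)
  | succ n => exact inferInstanceAs (IsAlgClosed (AlgebraicClosure (towerField L n)⸨X⸩))

theorem isPlace_tower (L : Type u) [Field L] [IsAlgClosed L] (n : ℕ) : IsPlace (towerPlace L n) := by
  induction n with
  | zero =>
    exact ⟨rfl, fun h h' => by rw [h, h']; rfl, fun h => by rw [h]; rfl, fun h h' => by rw [h, h']; rfl,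
      fun h h' => Eq.trans (Eq.symm h) h', fun x => Or.inl ⟨x, rfl⟩⟩
  | succ n ih => exact isPlace_series.comp ih

theorem towerPlace_step (L : Type u) [Field L] (n : ℕ) {x : towerField L n} {a : L}
    (h : towerPlace L n x a) : towerPlace L (n + 1) (towerStep L n x) a :=
  ⟨x, seriesPlace_constEmbedding x, h⟩

theorem towerPlace_map (L : Type u) [Field L] {m n : ℕ} (hmn : m ≤ n) {x : towerField L m} {a : L}
    (h : towerPlace L m x a) : towerPlace L n (towerMap L m n hmn x) a := by
  induction n, hmn using Nat.le_induction with
  | base => rwa [towerMap_self]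
  | succ n hn ih => rw [towerMap_succ L hn]; exact towerPlace_step L n ih

theorem toKomega_towerMap (L : Type u) [Field L] {m n : ℕ} (hmn : m ≤ n) (x : towerField L m) :
    toKomega L n (towerMap L m n hmn x) = toKomega L m x :=
  (DirectLimit.eq_of_le (f := towerMap L) ⟨m, x⟩ n hmn).symm

/-- The graph of the place `K_ω → L`. -/
def omegaPlace (L : Type u) [Field L] (x : Komega L) (a : L) : Prop :=
  ∃ (n : ℕ) (f : towerField L n), toKomega L n f = x ∧ towerPlace L n f a

theorem exists_toKomega_eq (L : Type u) [Field L] {τ : Type*} [Finite τ] (x : τ → Komega L) :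
    ∃ n : ℕ, ∀ m, n ≤ m → ∃ f : τ → towerField L m, ∀ t, toKomega L m (f t) = x t := by
  have h : ∀ t, ∃ (n : ℕ) (f : towerField L n), toKomega L n f = x t := fun t => by
    obtain ⟨n, f, hf⟩ := DirectLimit.exists_eq_mk (towerMap L) (x t)
    exact ⟨n, f, hf.symm⟩
  choose n f hf using h
  obtain ⟨N, hN⟩ := (Set.finite_range n).bddAbove
  refine ⟨N, fun m hm => ⟨fun t => towerMap L (n t) m ((hN ⟨t, rfl⟩).trans hm) (f t), fun t => ?_⟩⟩
  rw [toKomega_towerMap, hf]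

/-- A residue does not depend on the level at which it is computed: an element without a residue at
level `n` has an inverse with residue `0`, which persists at higher levels and excludes a residue
there. -/
theorem omegaPlace_toKomega (L : Type u) [Field L] [IsAlgClosed L] {n : ℕ} {f : towerField L n} {a : L} :
    omegaPlace L (toKomega L n f) a ↔ towerPlace L n f a := by
  refine ⟨fun ⟨m, g, hg, hga⟩ => ?_, fun h => ⟨n, f, rfl, h⟩⟩
  have h1 : towerMap L n (max m n) (le_max_right _ _) f = towerMap L m (max m n) (le_max_left _ _) g := by
    apply (toKomega L (max m n)).injective
    rw [toKomega_towerMap, toKomega_towerMap, hg]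
  have h2 := towerPlace_map L (le_max_left m n) hga
  rw [← h1] at h2
  have hS := isPlace_tower L
  rcases (hS n).total f with ⟨b, hb⟩ | h
  · rwa [(hS _).unique h2 (towerPlace_map L (le_max_right m n) hb)]
  · have h3 := towerPlace_map L (le_max_right m n) h
    rw [map_inv₀] at h3
    have h4 := (hS _).mul h2 h3
    by_cases hf : f = 0
    · subst hf
      rw [map_zero] at h2
      rw [(hS _).unique h2 (hS _).zero]
      exact (hS n).zero
    · rw [mul_inv_cancel₀ (by simpa using hf), mul_zero] at h4
      exact absurd ((hS _).unique (hS _).one h4) one_ne_zero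

theorem isPlace_omega (L : Type u) [Field L] [IsAlgClosed L] : IsPlace (omegaPlace L) := by
  have hS := isPlace_tower L
  have h2 : ∀ x y : Komega L, ∃ (n : ℕ) (f g : towerField L n), toKomega L n f = x ∧ toKomega L n g = y :=
    fun x y => by
      obtain ⟨n, hn⟩ := exists_toKomega_eq L ![x, y]
      obtain ⟨f, hf⟩ := hn n le_rfl
      exact ⟨n, f 0, f 1, hf 0, hf 1⟩
  refine ⟨⟨0, 1, map_one _, rfl⟩, fun {x y a b} => ?_, fun {x a} => ?_, fun {x y a b} => ?_,
    fun {x a b} => ?_, fun x => ?_⟩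
  · obtain ⟨n, f, g, rfl, rfl⟩ := h2 x y
    rw [← map_add]; simp only [omegaPlace_toKomega]; exact (hS n).add
  · obtain ⟨n, f, g, rfl, -⟩ := h2 x x
    rw [← map_neg]; simp only [omegaPlace_toKomega]; exact (hS n).neg
  · obtain ⟨n, f, g, rfl, rfl⟩ := h2 x y
    rw [← map_mul]; simp only [omegaPlace_toKomega]; exact (hS n).mul
  · obtain ⟨n, f, g, rfl, -⟩ := h2 x x
    simp only [omegaPlace_toKomega]; exact (hS n).unique
  · obtain ⟨n, f, g, rfl, -⟩ := h2 x x
    rw [← map_inv₀]; simp only [omegaPlace_toKomega]; exact (hS n).total f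

theorem omegaPlace_algebraMap (L : Type u) [Field L] (a : L) : omegaPlace L (algebraMap L (Komega L) a) a :=
  ⟨0, a, rfl, rfl⟩

/-- The coefficients of a polynomial lie in one level `K_n`, which is already algebraically closed.
-/
instance isAlgClosed_Komega (L : Type u) [Field L] [IsAlgClosed L] : IsAlgClosed (Komega L) := by
  refine IsAlgClosed.of_exists_root _ fun p hp hirr => ?_
  obtain ⟨n, hn⟩ := exists_toKomega_eq L (fun i : Fin (p.natDegree + 1) => p.coeff i)
  obtain ⟨f, hf⟩ := hn n le_rfl
  have : p ∈ Polynomial.lifts (toKomega L n) := by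
    rw [Polynomial.lifts_iff_coeff_lifts]
    intro i
    by_cases hi : i < p.natDegree + 1
    · exact ⟨f ⟨i, hi⟩, hf ⟨i, hi⟩⟩
    · exact ⟨0, by rw [map_zero, coeff_eq_zero_of_natDegree_lt (by lia)]⟩
  obtain ⟨q, hq, hqd⟩ := Polynomial.exists_degree_eq_of_mem_lifts this
  obtain ⟨x, hx⟩ := IsAlgClosed.exists_root q (by rw [hqd]; exact hirr.degree_pos.ne')
  exact ⟨toKomega L n x, by rw [← hq]; simpa [eval_map, eval₂_hom] using hx⟩

/-! ### Specialisation of projective points along a place -/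

/-- The graph of the map of projective spaces induced by a place. -/
def PlaceSpecialises {K k : Type*} [Field K] [Field k] (S : K → k → Prop) {N : ℕ} (x : PSpace K N)
    (y : PSpace k N) : Prop :=
  ∃ (f : Fin (N + 1) → K) (hf : f ≠ 0) (g : Fin (N + 1) → k) (hg : g ≠ 0),
    x = Projectivization.mk _ f hf ∧ y = Projectivization.mk _ g hg ∧ ∀ j, S (f j) (g j)

theorem placeSpecialises_comp {K k l : Type*} [Field K] [Field k] [Field l] {S : K → k → Prop} {T : k → l → Prop}
    (hS : IsPlace S) (hT : IsPlace T) {N : ℕ} (x : PSpace K N) (z : PSpace l N) :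
    PlaceSpecialises (fun x b => ∃ a, S x a ∧ T a b) x z ↔
      ∃ y, PlaceSpecialises S x y ∧ PlaceSpecialises T y z := by
  constructor
  · rintro ⟨f, hf, g, hg, rfl, rfl, h⟩
    choose e he1 he2 using h
    have he : e ≠ 0 := by
      obtain ⟨j, hj⟩ := Function.ne_iff.1 hg
      exact Function.ne_iff.2 ⟨j, hT.ne_zero (he2 j) hj⟩
    exact ⟨Projectivization.mk _ e he, ⟨f, hf, e, he, rfl, rfl, he1⟩, ⟨e, he, g, hg, rfl, rfl, he2⟩⟩
  · rintro ⟨y, ⟨f, hf, e, he, rfl, rfl, h1⟩, ⟨e', he', g, hg, hee', rfl, h2⟩⟩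
    obtain ⟨c, hc⟩ := (Projectivization.mk_eq_mk_iff _ _ _ he he').1 hee'
    obtain ⟨j, hj⟩ := Function.ne_iff.1 hg
    have hej' : e' j ≠ 0 := hT.ne_zero (h2 j) hj
    have hce : ∀ i, e i = (c : k) * e' i := fun i => (congrFun hc i).symm
    have hej : e j ≠ 0 := by rw [hce]; exact mul_ne_zero c.ne_zero hej'
    have hfj : f j ≠ 0 := hS.ne_zero (h1 j) hej
    -- The two representatives `e` and `e'` of the middle point differ by a scalar. Dividing
    -- everything by the `j`-th coordinate, chosen so that it is nonzero at all three stages, makes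
    -- them agree.
    refine ⟨(f j)⁻¹ • f, smul_ne_zero (inv_ne_zero hfj) hf, (g j)⁻¹ • g, smul_ne_zero (inv_ne_zero hj) hg,
      ?_, ?_, fun i => ⟨(e j)⁻¹ * e i, hS.mul (hS.inv (h1 j) hej) (h1 i), ?_⟩⟩
    · exact (Projectivization.mk_eq_mk_iff' _ _ _ _ _).2 ⟨f j, by rw [smul_smul, mul_inv_cancel₀ hfj, one_smul]⟩
    · exact (Projectivization.mk_eq_mk_iff' _ _ _ _ _).2 ⟨g j, by rw [smul_smul, mul_inv_cancel₀ hj, one_smul]⟩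
    · have : (e j)⁻¹ * e i = (e' j)⁻¹ * e' i := by
        rw [hce, hce, mul_inv]; field_simp
      rw [this]
      exact hT.mul (hT.inv (h2 j) hj) (h2 i)

theorem specialisesFrom_iff (L : Type u) [Field L] [IsAlgClosed L] {N : ℕ} (n : ℕ)
    (x : PSpace (towerField L n) N) (a : PSpace L N) :
    SpecialisesFrom L n x a ↔ PlaceSpecialises (towerPlace L n) x a := by
  induction n with
  | zero =>
    constructor
    · rintro rfl
      induction x using Projectivization.ind with | h f hf => exact ⟨f, hf, f, hf, rfl, rfl, fun _ => rfl⟩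
    · rintro ⟨f, hf, g, hg, rfl, rfl, h⟩
      obtain rfl : f = g := funext h
      rfl
  | succ n ih =>
    refine Iff.trans ?_ (placeSpecialises_comp (isPlace_series (k := towerField L n)) (isPlace_tower L n) x a).symm
    refine exists_congr fun y => and_congr ?_ (ih y)
    constructor
    · rintro ⟨f, hf, g, hg, h1, h2, h3, h4⟩
      exact ⟨f, hf, g, hg, h1, h2, fun j => ⟨h3 j, h4 j⟩⟩
    · rintro ⟨f, hf, g, hg, h1, h2, h3⟩
      exact ⟨f, hf, g, hg, h1, h2, fun j => (h3 j).1, fun j => (h3 j).2⟩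

theorem specialises_iff {L : Type u} [Field L] [IsAlgClosed L] {N : ℕ} (x : PSpace (Komega L) N) (a : PSpace L N) :
    Specialises x a ↔ PlaceSpecialises (omegaPlace L) x a := by
  constructor
  · rintro ⟨n, f, hf, hf', rfl, h⟩
    obtain ⟨f₁, hf₁, g, hg, h1, rfl, h2⟩ := (specialisesFrom_iff L n _ a).1 h
    have hf₁' : (fun j => toKomega L n (f₁ j)) ≠ 0 := fun h => hf₁ (funext fun j => by
      simpa using congrFun h j)
    refine ⟨_, hf₁', g, hg, ?_, rfl, fun j => (omegaPlace_toKomega L).2 (h2 j)⟩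
    obtain ⟨c, hc⟩ := (Projectivization.mk_eq_mk_iff' _ _ _ hf hf₁).1 h1
    refine (Projectivization.mk_eq_mk_iff' _ _ _ _ _).2 ⟨toKomega L n c, funext fun j => ?_⟩
    rw [← hc]; simp
  · rintro ⟨f, hf, g, hg, rfl, rfl, h⟩
    obtain ⟨n, hn⟩ := exists_toKomega_eq L f
    obtain ⟨f', hf'⟩ := hn n le_rfl
    obtain rfl : (fun j => toKomega L n (f' j)) = f := funext hf'
    have h0 : f' ≠ 0 := by rintro rfl; exact hf (funext fun j => map_zero _)
    exact ⟨n, f', h0, hf, rfl, (specialisesFrom_iff L n _ _).2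
      ⟨f', h0, g, hg, rfl, rfl, fun j => (omegaPlace_toKomega L).1 (h j)⟩⟩

/-! ### Algebraically independent infinitesimals -/

/-- The first variable goes to the newest series variable, and the remaining ones to constants from
the previous level. Polynomials over `K_d` embed in `K_d⟦X⟧`, so no algebraic relation appears. -/
theorem exists_injective_tower (L : Type u) [Field L] [IsAlgClosed L] (d : ℕ) :
    ∃ φ : MvPolynomial (Fin d) L →+* towerField L d, Function.Injective φ ∧
      (∀ a, φ (MvPolynomial.C a) = towerMap L 0 d d.zero_le a) ∧ ∀ i, towerPlace L d (φ (MvPolynomial.X i)) 0 := by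
  induction d with
  | zero =>
    refine ⟨(MvPolynomial.isEmptyRingEquiv L (Fin 0)).toRingHom, (MvPolynomial.isEmptyRingEquiv L (Fin 0)).injective, fun a => ?_, fun i => i.elim0⟩
    rw [towerMap_self]
    exact ((MvPolynomial.isEmptyRingEquiv L (Fin 0)).symm_apply_eq.1
      (MvPolynomial.isEmptyRingEquiv_symm_apply L (Fin 0) a)).symm
  | succ d ih =>
    obtain ⟨φ, hφ, hC, hX⟩ := ih
    let ψ : Polynomial (towerField L d) →+* AlgebraicClosure (towerField L d)⸨X⸩ :=
      (algebraMap (towerField L d)⸨X⸩ _).comp ((algebraMap (towerField L d)⟦X⟧ (towerField L d)⸨X⸩).comp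
        (Polynomial.coeToPowerSeries.ringHom))
    have hψ : Function.Injective ψ := (algebraMap (towerField L d)⸨X⸩ _).injective.comp
      ((IsFractionRing.injective (towerField L d)⟦X⟧ _).comp (Polynomial.coe_injective _))
    have hψC : ∀ c, ψ (Polynomial.C c) = constEmbedding (towerField L d) c := fun c => by
      simp [ψ, constEmbedding]
    refine ⟨(ψ.comp (Polynomial.mapRingHom φ)).comp (MvPolynomial.finSuccEquiv L d).toRingHom,
      (hψ.comp (Polynomial.map_injective φ hφ)).comp (MvPolynomial.finSuccEquiv L d).injective, fun a => ?_, fun i => ?_⟩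
    · have h1 : MvPolynomial.finSuccEquiv L d (MvPolynomial.C a) = Polynomial.C (MvPolynomial.C a) := by
        simp [MvPolynomial.finSuccEquiv_apply]
      have h2 : towerMap L 0 (d + 1) (d + 1).zero_le a = constEmbedding (towerField L d) (towerMap L 0 d d.zero_le a) := by
        rw [towerMap_succ L d.zero_le]; rfl
      rw [h2, ← hC, ← hψC]
      change ψ (Polynomial.map φ (MvPolynomial.finSuccEquiv L d (MvPolynomial.C a))) = _
      rw [h1, Polynomial.map_C]
    · change ∃ y, SeriesPlace (ψ (Polynomial.map φ (MvPolynomial.finSuccEquiv L d (MvPolynomial.X i)))) y ∧ _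
      refine Fin.cases ?_ (fun i => ?_) i
      · refine ⟨0, ?_, (isPlace_tower L d).zero⟩
        rw [MvPolynomial.finSuccEquiv_X_zero, Polynomial.map_X, SeriesPlace, map_zero, sub_zero]
        have h : 0 < seriesVal (ψ Polynomial.X) := by
          rw [seriesVal_pos_iff_mem_nonunits]
          have := X_mem_nonunits (k := towerField L d)
          convert this using 1
          simp [ψ]
        exact ⟨h.le, h⟩
      · refine ⟨_, ?_, hX i⟩
        rw [MvPolynomial.finSuccEquiv_X_succ, Polynomial.map_C, hψC]
        exact seriesPlace_constEmbedding _

theorem exists_injective_omega (L : Type u) [Field L] [IsAlgClosed L] (d : ℕ) :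
    ∃ φ : MvPolynomial (Fin d) L →ₐ[L] Komega L, Function.Injective φ ∧
      ∀ i, omegaPlace L (φ (MvPolynomial.X i)) 0 := by
  obtain ⟨φ, hφ, hC, hX⟩ := exists_injective_tower L d
  refine ⟨{ (toKomega L d).comp φ with commutes' := fun a => ?_ }, (toKomega L d).injective.comp hφ,
    fun i => ⟨d, _, rfl, hX i⟩⟩
  change toKomega L d (φ (MvPolynomial.C a)) = toKomega L 0 a
  exact (congrArg (toKomega L d) (hC a)).trans (toKomega_towerMap L d.zero_le (a : towerField L 0))

/-! ### Normality of smooth algebras -/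

-- Integral closure commutes with smooth base change, and `S ⊗ F`, a domain finite over the field `F
-- = Frac P`, is the fraction field of `S`. So the integral closure of `S` there is `S ⊗ P = S`.
open scoped TensorProduct in
theorem isIntegrallyClosed_of_etale (P S : Type*) [CommRing P] [IsDomain P] [IsIntegrallyClosed P] [CommRing S]
    [IsDomain S] [Algebra P S] [Algebra.Etale P S] : IsIntegrallyClosed S := by
  have hinj : Function.Injective (algebraMap P S) := by
    have : Module.Flat P S := inferInstance
    exact FaithfulSMul.algebraMap_injective P S
  have hle : Algebra.algebraMapSubmonoid S (nonZeroDivisors P) ≤ nonZeroDivisors S := by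
    rintro _ ⟨r, hr, rfl⟩
    exact mem_nonZeroDivisors_of_ne_zero (by simpa using nonZeroDivisors.ne_zero hr)
  let F := FractionRing P
  let T := S ⊗[P] F
  have : IsLocalization (Algebra.algebraMapSubmonoid S (nonZeroDivisors P)) T := inferInstance
  have : IsDomain T := IsLocalization.isDomain_of_le_nonZeroDivisors T hle
  have e : T ≃* F ⊗[P] S := (Algebra.TensorProduct.comm P S F).toMulEquiv
  have : IsDomain (F ⊗[P] S) := e.symm.isDomain
  have : Module.Finite F (F ⊗[P] S) := Algebra.FormallyUnramified.finite_of_free F (F ⊗[P] S)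
  have hT : IsField T := e.isField (isField_of_isIntegral_of_isField' (Field.toIsField F))
  let : Field T := hT.toField
  have hST : Function.Injective (algebraMap S T) := IsLocalization.injective T hle
  have : FaithfulSMul S T := (faithfulSMul_iff_algebraMap_injective S T).2 hST
  have : IsFractionRing S T := IsFractionRing.of_field S T fun z => by
    obtain ⟨⟨x, y⟩, h⟩ := IsLocalization.surj (Algebra.algebraMapSubmonoid S (nonZeroDivisors P)) z
    have hy : algebraMap S T y ≠ 0 := by
      rw [Ne, map_eq_zero_iff _ hST]; exact nonZeroDivisors.ne_zero (hle y.2)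
    exact ⟨x, y, by rw [← h]; field_simp⟩
  rw [isIntegrallyClosed_iff T]
  intro x hx
  -- An integral element comes from a sum of tensors `s ⊗ f` with `f` integral over `P`. Normality
  -- of `P` puts each such `f` in `P`, so it can be moved across the tensor sign.
  obtain ⟨y, hy⟩ := (TensorProduct.toIntegralClosure_bijective_of_smooth (R := P) (S := S) (B := F)).2 ⟨x, hx⟩
  have hxy : x = Algebra.TensorProduct.map (.id S S) (integralClosure P F).val y := (congrArg Subtype.val hy).symm
  subst hxy
  clear hx hy
  induction y with
  | zero => exact ⟨0, by simp⟩
  | add a b ha hb =>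
    obtain ⟨a', ha'⟩ := ha
    obtain ⟨b', hb'⟩ := hb
    exact ⟨a' + b', by rw [map_add, map_add, ha', hb']⟩
  | tmul s f =>
    obtain ⟨p, hp⟩ := IsIntegrallyClosed.isIntegral_iff.1 f.2
    refine ⟨s * algebraMap P S p, ?_⟩
    rw [Algebra.TensorProduct.map_tmul]
    change (s * algebraMap P S p) ⊗ₜ[P] (1 : F) = s ⊗ₜ[P] (f : F)
    rw [← hp, mul_comm, ← Algebra.smul_def, TensorProduct.smul_tmul, Algebra.smul_def, mul_one]

/-- Near each prime a smooth algebra is étale over a polynomial ring, which is normal; normality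
passes up the étale map and then to the localisation. -/
theorem isIntegrallyClosed_localization_of_smooth (k A : Type*) [Field k] [CommRing A] [IsDomain A] [Algebra k A]
    [Algebra.Smooth k A] (p : Ideal A) [p.IsPrime] : IsIntegrallyClosed (Localization.AtPrime p) := by
  obtain ⟨f, hfp, n, _, _, _⟩ := Algebra.IsSmoothAt.exists_isStandardEtale_mvPolynomial (R := k) (p := p)
  have hf : f ≠ 0 := by rintro rfl; exact hfp p.zero_mem
  have : IsDomain (Localization.Away f) := IsLocalization.isDomain_localization (powers_le_nonZeroDivisors_of_noZeroDivisors hf)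
  have := isIntegrallyClosed_of_etale (MvPolynomial (Fin n) k) (Localization.Away f)
  have hle : Submonoid.powers f ≤ p.primeCompl := Submonoid.powers_le.2 hfp
  let : Algebra (Localization.Away f) (Localization.AtPrime p) :=
    IsLocalization.localizationAlgebraOfSubmonoidLe _ _ (Submonoid.powers f) p.primeCompl hle
  have := IsLocalization.localization_isScalarTower_of_submonoid_le (Localization.Away f) (Localization.AtPrime p) (Submonoid.powers f) p.primeCompl hle
  have := IsLocalization.isLocalization_of_submonoid_le (Localization.Away f) (Localization.AtPrime p) (Submonoid.powers f) p.primeCompl hle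
  exact isIntegrallyClosed_of_isLocalization (Localization.AtPrime p)
    (p.primeCompl.map (algebraMap A (Localization.Away f))) (by
      rintro _ ⟨s, hs, rfl⟩
      have hs0 : s ≠ 0 := by rintro rfl; exact hs p.zero_mem
      refine mem_nonZeroDivisors_of_ne_zero ?_
      rwa [Ne, map_eq_zero_iff _ (IsLocalization.injective _ (powers_le_nonZeroDivisors_of_noZeroDivisors hf))])

/-! ### Roots of monic polynomials under a place -/

namespace IsPlace

variable {K k : Type*} [Field K] [Field k] {S : K → k → Prop} (hS : IsPlace S)
include hS

theorem sum {ι : Type*} {s : Finset ι} {x : ι → K} {a : ι → k} (h : ∀ i ∈ s, S (x i) (a i)) :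
    S (∑ i ∈ s, x i) (∑ i ∈ s, a i) := by
  classical
  induction s using Finset.induction_on with
  | empty => simpa using hS.zero
  | insert i s hi ih =>
    rw [Finset.sum_insert hi, Finset.sum_insert hi]
    exact hS.add (h i (by simp)) (ih fun j hj => h j (by simp [hj]))

theorem pow {x : K} {a : k} (h : S x a) (n : ℕ) : S (x ^ n) (a ^ n) := by
  induction n with
  | zero => simpa using hS.one
  | succ n ih => rw [pow_succ, pow_succ]; exact hS.mul ih h

theorem eval₂ {O : Type*} [CommSemiring O] {φ : O →+* K} {ρ : O →+* k} (h : ∀ u, S (φ u) (ρ u)) {x : K} {a : k}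
    (hx : S x a) (P : O[X]) : S (P.eval₂ φ x) (P.eval₂ ρ a) := by
  rw [eval₂_eq_sum, eval₂_eq_sum]
  exact hS.sum fun i _ => hS.mul (h _) (hS.pow hx i)

theorem mvEval₂ {O τ : Type*} [CommSemiring O] {φ : O →+* K} {ρ : O →+* k} (h : ∀ u, S (φ u) (ρ u)) {x : τ → K}
    {a : τ → k} (hx : ∀ t, S (x t) (a t)) (P : MvPolynomial τ O) : S (P.eval₂ φ x) (P.eval₂ ρ a) := by
  induction P using MvPolynomial.induction_on with
  | C c => simpa using h c
  | add p q hp hq => rw [MvPolynomial.eval₂_add, MvPolynomial.eval₂_add]; exact hS.add hp hq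
  | mul_X p t hp =>
    rw [MvPolynomial.eval₂_mul, MvPolynomial.eval₂_mul, MvPolynomial.eval₂_X, MvPolynomial.eval₂_X]
    exact hS.mul hp (hx t)

/-- Elements integral over the valuation ring of a place have a residue. -/
theorem exists_of_monic {O : Type*} [CommRing O] {φ : O →+* K} {ρ : O →+* k} (h : ∀ u, S (φ u) (ρ u))
    {x : K} {Q : O[X]} (hQ : Q.Monic) (hx : Q.eval₂ φ x = 0) : ∃ a, S x a := by
  rcases hS.total x with h' | h'
  · exact h'
  by_cases hx0 : x = 0
  · exact ⟨0, hx0 ▸ hS.zero⟩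
  -- If `x` had a pole, then `x⁻¹` would have residue `0`; the reversed polynomial vanishes at
  -- `x⁻¹`, while its residue there is its constant term, the leading coefficient `1` of `Q`.
  have h1 : Q.reverse.eval₂ φ x⁻¹ = 0 := by
    let := invertibleOfNonzero hx0
    rwa [← eval₂_reverse_eq_zero_iff, invOf_eq_inv] at hx
  have h2 := hS.eval₂ h h' Q.reverse
  rw [h1, eval₂_at_zero, coeff_zero_reverse, hQ.leadingCoeff, map_one] at h2
  exact absurd (hS.unique h2 hS.zero) one_ne_zero

theorem prod_X_sub_C (s : Multiset K) (f : K → k) (hf : ∀ r ∈ s, S r (f r)) (n : ℕ) :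
    S ((s.map fun r => X - C r).prod.coeff n) ((s.map fun r => X - C (f r)).prod.coeff n) := by
  induction s using Multiset.induction generalizing n with
  | empty =>
    simp only [Multiset.map_zero, Multiset.prod_zero, coeff_one]
    split_ifs
    exacts [hS.one, hS.zero]
  | cons r s ih =>
    have ih := fun n => ih (fun r hr => hf r (Multiset.mem_cons_of_mem hr)) n
    have hr := hf r (Multiset.mem_cons_self r s)
    simp only [Multiset.map_cons, Multiset.prod_cons, sub_mul, coeff_sub, coeff_C_mul]
    refine hS.sub ?_ (hS.mul hr (ih n))
    cases n with
    | zero => simpa using hS.zero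
    | succ n => rw [coeff_X_mul, coeff_X_mul]; exact ih n

/-- If all roots of a monic polynomial have the same multiplicity `q`, then the number of roots with
residue `β` is determined by the reduction of the polynomial. -/
theorem ncard_roots_mul [IsAlgClosed K] {O : Type*} [CommRing O] {φ : O →+* K} {ρ : O →+* k}
    (h : ∀ u, S (φ u) (ρ u)) {Q : O[X]} (hQ : Q.Monic) {q : ℕ}
    (hq : ∀ r, (Q.map φ).IsRoot r → (Q.map φ).rootMultiplicity r = q) (β : k) :
    {r | (Q.map φ).IsRoot r ∧ S r β}.ncard * q = (Q.map ρ).rootMultiplicity β := by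
  classical
  have hm : (Q.map φ).Monic := hQ.map _
  have hroot : ∀ r ∈ (Q.map φ).roots, ∃ a, S r a := fun r hr => by
    refine hS.exists_of_monic h hQ ?_
    rw [← eval_map]; exact isRoot_of_mem_roots hr
  choose! f hf using hroot
  -- The coefficients of `Q` are symmetric functions of its roots, so reducing `Q` replaces each
  -- root by its residue, multiplicities included.
  have hprod : Q.map ρ = ((Q.map φ).roots.map fun r => X - C (f r)).prod := by
    ext n
    have h1 := hS.prod_X_sub_C _ f hf n
    rw [← (IsAlgClosed.splits (Q.map φ)).eq_prod_roots_of_monic hm, coeff_map] at h1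
    rw [coeff_map]
    exact hS.unique (h _) h1
  have hset : {r | (Q.map φ).IsRoot r ∧ S r β} = (((Q.map φ).roots.toFinset.filter fun r => f r = β : Finset K) : Set K) := by
    ext r
    simp only [Set.mem_ofPred_eq, Finset.coe_filter, Multiset.mem_toFinset, mem_roots hm.ne_zero]
    refine and_congr_right fun hr => ?_
    have hr' := hf r ((mem_roots hm.ne_zero).2 hr)
    exact ⟨fun h' => hS.unique hr' h', fun h' => h' ▸ hr'⟩
  rw [hset, Set.ncard_coe_finset, ← count_roots, hprod,
    ← Function.comp_def (fun b => X - C b) f, ← Multiset.map_map, roots_multiset_prod_X_sub_C, Multiset.count_map, Multiset.filter_congr fun x _ => eq_comm (a := β) (b := f x), ← Multiset.toFinset_sum_count_eq, Finset.card_eq_sum_ones,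
    Finset.sum_mul, one_mul, Multiset.toFinset_filter]
  refine Finset.sum_congr rfl fun r hr => ?_
  rw [Finset.mem_filter, Multiset.mem_toFinset] at hr
  rw [Multiset.count_filter_of_pos (p := fun x => f x = β) hr.2, count_roots, hq r (isRoot_of_mem_roots hr.1)]

end IsPlace

/-- With `p` the exponential characteristic, `P` is a separable polynomial evaluated at `X ^ p ^ m`,
and every root has multiplicity `p ^ m`. The value does not depend on the embedding `i`, which
allows two different `φ` to be compared. -/
theorem exists_rootMultiplicity_eq {K : Type*} [Field K] {P : K[X]} (hP : Irreducible P) (Ω : Type*) [Field Ω] :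
    ∃ q : ℕ, q ≠ 0 ∧ ∀ (i : K →+* Ω) (r : Ω), (P.map i).IsRoot r → (P.map i).rootMultiplicity r = q := by
  obtain ⟨p, hp⟩ := ExpChar.exists K
  obtain ⟨g, hg, m, hgm⟩ := hP.hasSeparableContraction p
  have hp0 : p ^ m ≠ 0 := pow_ne_zero _ (expChar_pos K p).ne'
  refine ⟨p ^ m, hp0, fun i r hr => ?_⟩
  have : ExpChar Ω p := expChar_of_injective_ringHom i.injective p
  rw [← hgm, map_expand] at hr ⊢
  rw [rootMultiplicity_expand_pow]
  have hr' : (g.map i).IsRoot (r ^ p ^ m) := by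
    rwa [IsRoot, expand_eval] at hr
  have hsep : (g.map i).Separable := hg.map
  have h1 := rootMultiplicity_le_one_of_separable hsep (r ^ p ^ m)
  have h2 := (rootMultiplicity_pos hsep.ne_zero).2 hr'
  rw [show (g.map i).rootMultiplicity (r ^ p ^ m) = 1 by omega, mul_one]

/-! ### Extending homomorphisms along an integral extension of a normal domain -/

section Lift

variable {O B : Type*} [CommRing O] [IsDomain O] [CommRing B] [IsDomain B] [Algebra O B]
  [Algebra.IsIntegral O B]

theorem isAlgebraic_fractionRing [Algebra (FractionRing O) (FractionRing B)]
    [IsScalarTower O (FractionRing O) (FractionRing B)] :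
    Algebra.IsAlgebraic (FractionRing O) (FractionRing B) := by
  refine ⟨fun z => ?_⟩
  obtain ⟨x, y, -, rfl⟩ := IsFractionRing.div_surjective (A := B) z
  have h : ∀ b : B, IsAlgebraic (FractionRing O) (algebraMap B (FractionRing B) b) := fun b =>
    (((Algebra.IsIntegral.isIntegral (R := O) b).map (IsScalarTower.toAlgHom O B (FractionRing B))).tower_top).isAlgebraic
  rw [div_eq_mul_inv]
  exact (h x).mul (h y).inv

/-- Since `O` is normal, the minimal polynomial over `O` is also the one over the fraction field.
Each of its roots is therefore the image of `f` under an embedding of `Frac B`, which restricts to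
`B`. -/
theorem exists_ringHom_of_root [FaithfulSMul O B] [IsIntegrallyClosed O] {Ω : Type*} [Field Ω] [IsAlgClosed Ω]
    (φ : O →+* Ω) (hφ : Function.Injective φ) (f : B) (r : Ω)
    (hr : (minpoly O f).eval₂ φ r = 0) : ∃ ψ : B →+* Ω, ψ.comp (algebraMap O B) = φ ∧ ψ f = r := by
  let K := FractionRing O
  let M := FractionRing B
  let : Algebra K M := FractionRing.liftAlgebra O M
  have : IsScalarTower O K M := inferInstance
  have : Algebra.IsAlgebraic K M := isAlgebraic_fractionRing
  let Φ : K →+* Ω := IsFractionRing.lift hφ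
  let := Φ.toAlgebra
  have hΦ : Φ.comp (algebraMap O K) = φ := RingHom.ext fun u => IsFractionRing.lift_algebraMap hφ u
  have hf := Algebra.IsIntegral.isIntegral (R := O) f
  have h1 := minpoly.isIntegrallyClosed_eq_field_fractions K M hf
  have h2 : r ∈ (minpoly K (algebraMap B M f)).rootSet Ω := by
    rw [mem_rootSet, h1]
    refine ⟨((minpoly.monic hf).map _).ne_zero, ?_⟩
    rwa [aeval_def, eval₂_map, RingHom.algebraMap_toAlgebra, hΦ]
  rw [← Algebra.IsAlgebraic.range_eval_eq_rootSet_minpoly] at h2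
  obtain ⟨ψ, hψ⟩ := h2
  refine ⟨(ψ : M →+* Ω).comp (algebraMap B M), RingHom.ext fun u => ?_, hψ⟩
  change ψ (algebraMap B M (algebraMap O B u)) = φ u
  rw [← IsScalarTower.algebraMap_apply, IsScalarTower.algebraMap_apply O K M, ψ.commutes, ← hΦ]
  rfl

theorem irreducible_minpoly_map [FaithfulSMul O B] [IsIntegrallyClosed O] (f : B) :
    Irreducible ((minpoly O f).map (algebraMap O (FractionRing O))) := by
  let K := FractionRing O
  let M := FractionRing B
  let : Algebra K M := FractionRing.liftAlgebra O M
  have : IsScalarTower O K M := inferInstance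
  have : Algebra.IsAlgebraic K M := isAlgebraic_fractionRing
  rw [← minpoly.isIntegrallyClosed_eq_field_fractions K M (Algebra.IsIntegral.isIntegral (R := O) f)]
  exact minpoly.irreducible (Algebra.IsIntegral.isIntegral (R := K) _)

end Lift

/-! ### Separating finitely many homomorphisms by one element -/

section Separate

variable {O B : Type*} [CommRing O] [CommRing B] [Algebra O B]

theorem ringHom_ext_of_adjoin {k : Type*} [CommRing k] {τ : Type*} {y : τ → B}
    (hy : Algebra.adjoin O (Set.range y) = ⊤) {ψ₁ ψ₂ : B →+* k}
    (h : ψ₁.comp (algebraMap O B) = ψ₂.comp (algebraMap O B)) (h' : ∀ t, ψ₁ (y t) = ψ₂ (y t)) : ψ₁ = ψ₂ := by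
  ext b
  have hb : b ∈ Algebra.adjoin O (Set.range y) := hy ▸ Algebra.mem_top
  induction hb using Algebra.adjoin_induction with
  | mem x hx => obtain ⟨t, rfl⟩ := hx; exact h' t
  | algebraMap r => exact RingHom.congr_fun h r
  | add x y _ _ hx hy => rw [map_add, map_add, hx, hy]
  | mul x y _ _ hx hy => rw [map_mul, map_mul, hx, hy]

theorem finite_extensions [Algebra.IsIntegral O B] {k : Type*} [Field k] {τ : Type*} [Finite τ] {y : τ → B}
    (hy : Algebra.adjoin O (Set.range y) = ⊤) (φ : O →+* k) :
    {ψ : B →+* k | ψ.comp (algebraMap O B) = φ}.Finite := by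
  have h : ∀ t, ∃ Q : O[X], Q.Monic ∧ Q.eval₂ (algebraMap O B) (y t) = 0 := fun t =>
    Algebra.IsIntegral.isIntegral (R := O) (y t)
  choose Q hQ hQy using h
  refine Set.Finite.of_finite_image (f := fun ψ t => ψ (y t)) ?_ ?_
  · refine (Set.Finite.pi' (t := fun t => {r | ((Q t).map φ).IsRoot r}) fun t =>
      finite_setOfPred_isRoot ((hQ t).map φ).ne_zero).subset ?_
    rintro _ ⟨ψ, hψ, rfl⟩ t
    have h1 : ψ ((Q t).eval₂ (algebraMap O B) (y t)) = 0 := by rw [hQy, map_zero]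
    rw [hom_eval₂, show ψ.comp (algebraMap O B) = φ from hψ] at h1
    change ((Q t).map φ).eval _ = 0
    rwa [eval_map]
  · intro ψ₁ h₁ ψ₂ h₂ h
    exact ringHom_ext_of_adjoin hy (Eq.trans h₁ (Eq.symm h₂)) fun t => congrFun h t

variable {L : Type*} [Field L] [Algebra L O] [Algebra L B] [IsScalarTower L O B]

/-- Two distinct extensions of `φ` differ on some generator, so the polynomial with coefficients `ψ₁
(y i) - ψ₂ (y i)` is nonzero. A value `c` that fails to separate them gives a root of it, since both
extensions agree on constants from `L`. -/
theorem finite_not_injOn {k : Type*} [Field k] {n : ℕ} {y : Fin n → B}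
    (hy : Algebra.adjoin O (Set.range y) = ⊤) (φ : O →+* k) {E : Set (B →+* k)} (hE : E.Finite)
    (hEφ : ∀ ψ ∈ E, ψ.comp (algebraMap O B) = φ) :
    {c : L | ¬ Set.InjOn (fun ψ : B →+* k => ψ (∑ i : Fin n, algebraMap L B c ^ (i : ℕ) * y i)) E}.Finite := by
  have key : ∀ ψ₁ ∈ E, ∀ ψ₂ ∈ E, ψ₁ ≠ ψ₂ → {c : L | ψ₁ (∑ i : Fin n, algebraMap L B c ^ (i : ℕ) * y i) =
      ψ₂ (∑ i : Fin n, algebraMap L B c ^ (i : ℕ) * y i)}.Finite := by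
    intro ψ₁ h₁ ψ₂ h₂ hne
    let R : k[X] := ∑ i : Fin n, C (ψ₁ (y i) - ψ₂ (y i)) * X ^ (i : ℕ)
    have hR : R ≠ 0 := by
      intro h
      refine hne (ringHom_ext_of_adjoin hy ((hEφ _ h₁).trans (hEφ _ h₂).symm) fun j => ?_)
      have := congrArg (fun P : k[X] => P.coeff j) h
      simp only [R, finsetSum_coeff, coeff_C_mul, coeff_X_pow, coeff_zero] at this
      rw [Finset.sum_eq_single j (fun i _ hij => by
        rw [if_neg (fun h => hij (Fin.ext h.symm)), mul_zero]) (by simp), if_pos rfl, mul_one, sub_eq_zero] at this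
      exact this
    refine Set.Finite.subset ((finite_setOfPred_isRoot hR).preimage
      ((φ.comp (algebraMap L O)).injective.injOn)) fun c hc => ?_
    have hc' : ∀ ψ ∈ E, ψ (algebraMap L B c) = φ (algebraMap L O c) := fun ψ hψ => by
      rw [IsScalarTower.algebraMap_apply L O B, ← hEφ ψ hψ]; rfl
    have hc : ψ₁ (∑ i : Fin n, algebraMap L B c ^ (i : ℕ) * y i) = ψ₂ (∑ i : Fin n, algebraMap L B c ^ (i : ℕ) * y i) := hc
    simp only [map_sum, map_mul, map_pow, hc' ψ₁ h₁, hc' ψ₂ h₂] at hc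
    change R.eval (φ (algebraMap L O c)) = 0
    rw [← sub_eq_zero, ← Finset.sum_sub_distrib] at hc
    rw [← hc, eval_finsetSum]
    refine Finset.sum_congr rfl fun i _ => ?_
    rw [eval_mul, eval_C, eval_pow, eval_X]; ring
  refine ((hE.prod hE).biUnion (t := fun p => {c : L | p.1 ≠ p.2 ∧
      p.1 (∑ i : Fin n, algebraMap L B c ^ (i : ℕ) * y i) = p.2 (∑ i : Fin n, algebraMap L B c ^ (i : ℕ) * y i)}) ?_).subset ?_
  · rintro ⟨ψ₁, ψ₂⟩ ⟨h₁, h₂⟩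
    by_cases hne : ψ₁ = ψ₂
    · simp [hne]
    · exact (key ψ₁ h₁ ψ₂ h₂ hne).subset fun c hc => hc.2
  · intro c hc
    simp only [Set.InjOn, Set.mem_ofPred_eq, not_forall] at hc
    obtain ⟨ψ₁, h₁, ψ₂, h₂, h, hne⟩ := hc
    exact Set.mem_biUnion (Set.mk_mem_prod h₁ h₂) ⟨hne, h⟩

end Separate

/-! ### Counting extensions with prescribed residue -/

section Count

variable {L O B : Type*} [Field L] [IsAlgClosed L] [CommRing O] [IsDomain O] [IsIntegrallyClosed O] [CommRing B]
  [IsDomain B] [Algebra O B] [Algebra.IsIntegral O B] [FaithfulSMul O B]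
  [Algebra L O] [Algebra L B] [IsScalarTower L O B]

/-- The extensions of `φ : O → Ω` to `B` whose composite with the place `S` is `σ`. -/
def specialisingHoms {Ω : Type*} [Field Ω] (S : Ω → L → Prop) (φ : O →+* Ω) (σ : B →+* L) : Set (B →+* Ω) :=
  {ψ | ψ.comp (algebraMap O B) = φ ∧ ∀ b, S (ψ b) (σ b)}

/-- Each count, multiplied by the common root multiplicity `q`, equals the multiplicity of `σ f` in
the reduced minimal polynomial of a separating element `f`, and this knows nothing of `φ₁` or `φ₂`.
-/
theorem ncard_specialisingHoms {Ω : Type*} [Field Ω] [IsAlgClosed Ω] {S : Ω → L → Prop} (hS : IsPlace S)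
    {τ : Type*} [Finite τ] {y : τ → B} (hy : Algebra.adjoin O (Set.range y) = ⊤) (σ : B →+* L)
    {φ₁ φ₂ : O →+* Ω} (hφ₁ : Function.Injective φ₁) (hφ₂ : Function.Injective φ₂)
    (h₁ : ∀ u, S (φ₁ u) (σ (algebraMap O B u))) (h₂ : ∀ u, S (φ₂ u) (σ (algebraMap O B u))) :
    (specialisingHoms S φ₁ σ).Finite ∧ (specialisingHoms S φ₁ σ).Nonempty ∧
      (specialisingHoms S φ₁ σ).ncard = (specialisingHoms S φ₂ σ).ncard := by
  obtain ⟨n, ⟨e⟩⟩ := Finite.exists_equiv_fin τ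
  replace hy : Algebra.adjoin O (Set.range (y ∘ e.symm)) = ⊤ := by
    rwa [EquivLike.range_comp]
  set ρ := σ.comp (algebraMap O B) with hρ
  have f₁ := finite_extensions hy φ₁
  have f₂ := finite_extensions hy φ₂
  have f₃ := finite_extensions hy ρ
  have : Infinite L := IsAlgClosed.instInfinite
  -- One `c` separates the extensions of `φ₁`, of `φ₂`, and of their common residue `ρ`. The first
  -- two make evaluation at `f` injective; the third makes the residue of `f` determine the whole
  -- residue homomorphism.
  obtain ⟨c, hc⟩ := (((finite_not_injOn (L := L) hy φ₁ f₁ fun _ h => h).union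
    (finite_not_injOn (L := L) hy φ₂ f₂ fun _ h => h)).union
    (finite_not_injOn (L := L) hy ρ f₃ fun _ h => h)).exists_notMem
  simp only [Set.mem_union, Set.mem_ofPred_eq, not_or, not_not] at hc
  obtain ⟨⟨i₁, i₂⟩, i₃⟩ := hc
  set f : B := ∑ i : Fin n, algebraMap L B c ^ (i : ℕ) * (y ∘ e.symm) i
  have hf := Algebra.IsIntegral.isIntegral (R := O) f
  obtain ⟨q, hq0, hq⟩ := exists_rootMultiplicity_eq (irreducible_minpoly_map (O := O) f) Ω
  have main : ∀ φ : O →+* Ω, Function.Injective φ → (∀ u, S (φ u) (σ (algebraMap O B u))) →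
      Set.InjOn (fun ψ : B →+* Ω => ψ f) {ψ | ψ.comp (algebraMap O B) = φ} →
      (specialisingHoms S φ σ).ncard * q = ((minpoly O f).map ρ).rootMultiplicity (σ f) := by
    intro φ hφ h hinj
    have hmap : (minpoly O f).map φ = ((minpoly O f).map (algebraMap O (FractionRing O))).map (IsFractionRing.lift hφ) := by
      rw [Polynomial.map_map]
      congr 1
      exact RingHom.ext fun u => (IsFractionRing.lift_algebraMap hφ u).symm
    rw [← hS.ncard_roots_mul (φ := φ) (ρ := ρ) h (minpoly.monic hf) (q := q) (fun r hr => by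
      rw [hmap] at hr ⊢; exact hq _ r hr) (σ f)]
    congr 1
    refine Set.ncard_congr (fun ψ _ => ψ f) ?_ ?_ ?_
    · rintro ψ ⟨hψ, hψS⟩
      refine ⟨?_, hψS f⟩
      rw [IsRoot, eval_map, ← hψ, ← hom_eval₂, ← aeval_def, minpoly.aeval, map_zero]
    · rintro ψ₁ ψ₂ h₁ h₂ h
      exact hinj h₁.1 h₂.1 h
    · rintro r ⟨hr, hrS⟩
      rw [IsRoot, eval_map] at hr
      obtain ⟨ψ, hψ, rfl⟩ := exists_ringHom_of_root φ hφ f r hr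
      -- Integrality over `O` gives every value of `ψ` a residue, so `ψ` has a residue homomorphism
      -- `σ'`. It agrees with `σ` on `O` and at `f`, hence everywhere.
      have hb : ∀ b, ∃ a, S (ψ b) a := fun b => by
        refine hS.exists_of_monic (φ := φ) (ρ := ρ) h
          (minpoly.monic (Algebra.IsIntegral.isIntegral (R := O) b)) ?_
        rw [← hψ, ← hom_eval₂, ← aeval_def, minpoly.aeval, map_zero]
      choose g hg using hb
      let σ' : B →+* L :=
        { toFun := g
          map_one' := hS.unique (hg 1) (by rw [map_one]; exact hS.one)
          map_zero' := hS.unique (hg 0) (by rw [map_zero]; exact hS.zero)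
          map_add' := fun a b => hS.unique (hg (a + b)) (by rw [map_add]; exact hS.add (hg a) (hg b))
          map_mul' := fun a b => hS.unique (hg (a * b)) (by rw [map_mul]; exact hS.mul (hg a) (hg b)) }
      have hσ' : σ'.comp (algebraMap O B) = ρ := RingHom.ext fun u =>
        hS.unique (hg (algebraMap O B u)) (by
          rw [show ψ (algebraMap O B u) = φ u from RingHom.congr_fun hψ u]; exact h u)
      have : σ' = σ := i₃ hσ' hρ.symm (hS.unique (hg f) hrS)
      exact ⟨ψ, ⟨hψ, fun b => this ▸ hg b⟩, rfl⟩
  have e₁ := main φ₁ hφ₁ h₁ i₁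
  have e₂ := main φ₂ hφ₂ h₂ i₂
  have hfin : (specialisingHoms S φ₁ σ).Finite := f₁.subset fun ψ h => h.1
  refine ⟨hfin, ?_, Nat.eq_of_mul_eq_mul_right (Nat.pos_of_ne_zero hq0) (e₁.trans e₂.symm)⟩
  -- A zero count would mean that `σ f` is not a root of the reduced minimal polynomial, but
  -- applying `σ` to the equation of `f` shows that it is.
  refine Set.nonempty_of_ncard_ne_zero fun h0 => ?_
  rw [h0, zero_mul, eq_comm, rootMultiplicity_eq_zero_iff] at e₁
  refine ((minpoly.monic hf).map ρ).ne_zero (e₁ ?_)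
  rw [IsRoot, eval_map, hρ, ← hom_eval₂, ← aeval_def, minpoly.aeval, map_zero]

end Count

/-! ### Multihomogeneous polynomials and affine charts -/

section Homogeneous

variable {k : Type u} [Field k] {K : Type u} [Field K] [Algebra k K] {ι : Type} {N : ℕ}

/-- The multidegree of the coordinate `(i, j)`. -/
def multiWeight (ι : Type) (N : ℕ) (q : ι × Fin (N + 1)) : ι → ℕ :=
  open scoped Classical in Pi.single q.1 1

theorem weight_multiWeight [Fintype ι] (e : ι × Fin (N + 1) →₀ ℕ) (i : ι) :
    Finsupp.weight (multiWeight ι N) e i = ∑ j, e (i, j) := by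
  classical
  rw [Finsupp.weight_apply, Finsupp.sum_fintype _ _ (fun _ => by simp), Fintype.sum_prod_type, Finset.sum_apply,
    Finset.sum_eq_single i]
  · simp [multiWeight]
  · intro b _ hb
    simp [multiWeight, Pi.single_eq_of_ne hb.symm]
  · simp

theorem isMultihomogeneous_iff [Fintype ι] {p : MvPolynomial (ι × Fin (N + 1)) k} :
    IsMultihomogeneous p ↔ ∃ d, p.IsWeightedHomogeneous (multiWeight ι N) d := by
  refine exists_congr fun d => ?_
  simp only [MvPolynomial.IsWeightedHomogeneous, MvPolynomial.mem_support_iff, funext_iff, weight_multiWeight]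

theorem IsMultihomogeneous.mul [Fintype ι] {p q : MvPolynomial (ι × Fin (N + 1)) k} (hp : IsMultihomogeneous p)
    (hq : IsMultihomogeneous q) : IsMultihomogeneous (p * q) := by
  rw [isMultihomogeneous_iff] at *
  obtain ⟨d, hd⟩ := hp
  obtain ⟨e, he⟩ := hq
  exact ⟨d + e, hd.mul he⟩

theorem aeval_smul_blocks [Fintype ι] {p : MvPolynomial (ι × Fin (N + 1)) k} {d : ι → ℕ}
    (hd : ∀ e ∈ p.support, ∀ i, ∑ j, e (i, j) = d i) (c : ι → K) (v : ι × Fin (N + 1) → K) :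
    MvPolynomial.aeval (fun q => c q.1 * v q) p = (∏ i, c i ^ d i) * MvPolynomial.aeval v p := by
  rw [MvPolynomial.aeval_def, MvPolynomial.aeval_def, MvPolynomial.eval₂_eq', MvPolynomial.eval₂_eq', Finset.mul_sum]
  refine Finset.sum_congr rfl fun e he => ?_
  have : ∏ q : ι × Fin (N + 1), (c q.1 * v q) ^ e q = (∏ i, c i ^ d i) * ∏ q, v q ^ e q := by
    simp only [mul_pow, Finset.prod_mul_distrib]
    congr 1
    rw [Fintype.prod_prod_type]
    refine Finset.prod_congr rfl fun i _ => ?_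
    rw [← hd e he i, ← Finset.prod_pow_eq_pow_sum]
  rw [this]; ring

/-- `v` lists homogeneous coordinates of the components of `x`. -/
def IsRep (v : ι × Fin (N + 1) → K) (x : ι → PSpace K N) : Prop :=
  ∀ i, ∃ h : (fun j => v (i, j)) ≠ 0, Projectivization.mk K (fun j => v (i, j)) h = x i

theorem isRep_rep (x : ι → PSpace K N) : IsRep (fun q => (x q.1).rep q.2) x := fun i =>
  ⟨(x i).rep_nonzero, (x i).mk_rep⟩

theorem IsRep.exists_smul {v w : ι × Fin (N + 1) → K} {x : ι → PSpace K N} (hv : IsRep v x) (hw : IsRep w x) :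
    ∃ c : ι → K, (∀ i, c i ≠ 0) ∧ ∀ q, v q = c q.1 * w q := by
  have h : ∀ i, ∃ c : Kˣ, ∀ j, v (i, j) = c * w (i, j) := fun i => by
    obtain ⟨h1, h2⟩ := hv i
    obtain ⟨h3, h4⟩ := hw i
    obtain ⟨c, hc⟩ := (Projectivization.mk_eq_mk_iff _ _ _ h1 h3).1 (h2.trans h4.symm)
    exact ⟨c, fun j => (congrFun hc j).symm⟩
  choose c hc using h
  exact ⟨fun i => c i, fun i => (c i).ne_zero, fun q => hc q.1 q.2⟩

theorem vanishesAt_iff [Fintype ι] {p : MvPolynomial (ι × Fin (N + 1)) k} (hp : IsMultihomogeneous p)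
    {v : ι × Fin (N + 1) → K} {x : ι → PSpace K N} (hv : IsRep v x) :
    VanishesAt p x ↔ MvPolynomial.aeval v p = 0 := by
  obtain ⟨d, hd⟩ := hp
  obtain ⟨c, hc, hcv⟩ := hv.exists_smul (isRep_rep x)
  obtain rfl : v = fun q => c q.1 * (x q.1).rep q.2 := funext hcv
  rw [aeval_smul_blocks hd, mul_eq_zero, or_iff_right (Finset.prod_ne_zero_iff.2 fun i _ => pow_ne_zero _ (hc i))]
  rfl

theorem IsRep.smul {v : ι × Fin (N + 1) → K} {x : ι → PSpace K N} (hv : IsRep v x) {c : ι → K} (hc : ∀ i, c i ≠ 0) :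
    IsRep (fun q => c q.1 * v q) x := fun i => by
  obtain ⟨h, h'⟩ := hv i
  have h0 : (fun j => c i * v (i, j)) ≠ 0 := smul_ne_zero (hc i) h
  exact ⟨h0, by rw [← h']; exact (Projectivization.mk_eq_mk_iff' _ _ _ _ _).2 ⟨c i, rfl⟩⟩

/-- The value of the `i`-th of a family of linear forms. -/
def formVal (l : ι → Fin (N + 1) → k) (v : ι × Fin (N + 1) → K) (i : ι) : K :=
  ∑ j, algebraMap k K (l i j) * v (i, j)

/-- The linear forms `l` take the value `1` at `v`. -/
def Normalised (l : ι → Fin (N + 1) → k) (v : ι × Fin (N + 1) → K) : Prop := ∀ i, formVal l v i = 1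

theorem formVal_smul (l : ι → Fin (N + 1) → k) (c : ι → K) (v : ι × Fin (N + 1) → K) (i : ι) :
    formVal l (fun q => c q.1 * v q) i = c i * formVal l v i := by
  rw [formVal, formVal, Finset.mul_sum]
  exact Finset.sum_congr rfl fun j _ => by ring

theorem IsRep.exists_normalised {l : ι → Fin (N + 1) → k} {v : ι × Fin (N + 1) → K} {x : ι → PSpace K N}
    (hv : IsRep v x) (hl : ∀ i, formVal l v i ≠ 0) :
    IsRep (fun q => (formVal l v q.1)⁻¹ * v q) x ∧ Normalised l (fun q => (formVal l v q.1)⁻¹ * v q) :=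
  ⟨hv.smul fun i => inv_ne_zero (hl i), fun i => by
    rw [formVal_smul l (fun i => (formVal l v i)⁻¹), inv_mul_cancel₀ (hl i)]⟩

theorem Normalised.eq_of_isRep {l : ι → Fin (N + 1) → k} {v w : ι × Fin (N + 1) → K} {x : ι → PSpace K N}
    (hv : Normalised l v) (hw : Normalised l w) (h : IsRep v x) (h' : IsRep w x) : v = w := by
  obtain ⟨c, -, hc⟩ := h.exists_smul h'
  obtain rfl : v = fun q => c q.1 * w q := funext hc
  funext q
  have := hv q.1
  rw [formVal_smul, hw q.1, mul_one] at this
  rw [this, one_mul]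

theorem Normalised.exists_isRep {l : ι → Fin (N + 1) → k} {v : ι × Fin (N + 1) → K} (hv : Normalised l v) :
    ∃ x, IsRep v x := by
  have h : ∀ i, (fun j => v (i, j)) ≠ 0 := fun i h => by
    have := hv i
    rw [formVal, Finset.sum_eq_zero fun j _ => by rw [show v (i, j) = 0 from congrFun h j, mul_zero]] at this
    exact zero_ne_one this
  exact ⟨fun i => Projectivization.mk K _ (h i), fun i => ⟨h i, rfl⟩⟩

/-- The `i`-th linear form as a polynomial. -/
def formPoly (l : ι → Fin (N + 1) → k) (i : ι) : MvPolynomial (ι × Fin (N + 1)) k :=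
  ∑ j, MvPolynomial.C (l i j) * MvPolynomial.X (i, j)

theorem aeval_formPoly (l : ι → Fin (N + 1) → k) (i : ι) (v : ι × Fin (N + 1) → K) :
    MvPolynomial.aeval v (formPoly l i) = formVal l v i := by
  simp [formPoly, formVal]

theorem isWeightedHomogeneous_formPoly [DecidableEq ι] (l : ι → Fin (N + 1) → k) (i : ι) :
    (formPoly l i).IsWeightedHomogeneous (multiWeight ι N) (Pi.single i 1) := by
  refine MvPolynomial.IsWeightedHomogeneous.sum _ _ _ fun j _ => ?_
  have h := (MvPolynomial.isWeightedHomogeneous_C (multiWeight ι N) (l i j)).mul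
    (MvPolynomial.isWeightedHomogeneous_X k (multiWeight ι N) (i, j))
  rw [zero_add] at h
  convert h using 1
  simp only [multiWeight]
  congr!

theorem isWeightedHomogeneous_prod_formPoly [Fintype ι] (l : ι → Fin (N + 1) → k) (d : ι → ℕ) :
    (∏ i, formPoly l i ^ d i).IsWeightedHomogeneous (multiWeight ι N) d := by
  classical
  have h := MvPolynomial.IsWeightedHomogeneous.prod Finset.univ (fun i => formPoly l i ^ d i)
    (w := multiWeight ι N) (fun i => d i • Pi.single i 1)
    fun i _ => (isWeightedHomogeneous_formPoly l i).pow (d i)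
  convert h using 1
  funext i
  simp [Finset.sum_apply, Pi.single_apply]

theorem aeval_prod_formPoly [Fintype ι] {l : ι → Fin (N + 1) → k} {v : ι × Fin (N + 1) → K} (hv : Normalised l v) (d : ι → ℕ) :
    MvPolynomial.aeval v (∏ i, formPoly l i ^ d i) = 1 := by
  rw [map_prod]
  refine Finset.prod_eq_one fun i _ => ?_
  rw [map_pow, aeval_formPoly, hv i, one_pow]

/-- Powers of the forms `l i`, equal to `1` on the chart, fill up missing degrees. Allowing every
large multidegree `d` lets the two summands of a sum be brought to the same degree. -/
theorem exists_homogenisation_of_degree [Fintype ι] (l : ι → Fin (N + 1) → k) (q : MvPolynomial (ι × Fin (N + 1)) k) :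
    ∃ D : ι → ℕ, ∀ d, D ≤ d → ∃ p : MvPolynomial (ι × Fin (N + 1)) k,
      p.IsWeightedHomogeneous (multiWeight ι N) d ∧ ∀ (K : Type u) [Field K] [Algebra k K] (v : ι × Fin (N + 1) → K),
        Normalised l v → MvPolynomial.aeval v p = MvPolynomial.aeval v q := by
  classical
  induction q using MvPolynomial.induction_on with
  | C c =>
    refine ⟨0, fun d _ => ⟨MvPolynomial.C c * ∏ i, formPoly l i ^ d i, ?_, fun K _ _ v hv => ?_⟩⟩
    · have := (MvPolynomial.isWeightedHomogeneous_C (multiWeight ι N) c).mul (isWeightedHomogeneous_prod_formPoly l d)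
      rwa [zero_add] at this
    · rw [map_mul, aeval_prod_formPoly hv, mul_one]
  | add q₁ q₂ h₁ h₂ =>
    obtain ⟨D₁, h₁⟩ := h₁
    obtain ⟨D₂, h₂⟩ := h₂
    refine ⟨D₁ ⊔ D₂, fun d hd => ?_⟩
    obtain ⟨p₁, hp₁, e₁⟩ := h₁ d (le_sup_left.trans hd)
    obtain ⟨p₂, hp₂, e₂⟩ := h₂ d (le_sup_right.trans hd)
    exact ⟨p₁ + p₂, hp₁.add hp₂, fun K _ _ v hv => by rw [map_add, map_add, e₁ K v hv, e₂ K v hv]⟩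
  | mul_X q t h =>
    obtain ⟨D, h⟩ := h
    refine ⟨D + multiWeight ι N t, fun d hd => ?_⟩
    obtain ⟨p, hp, e⟩ := h (d - multiWeight ι N t) (le_tsub_of_add_le_right hd)
    refine ⟨p * MvPolynomial.X t, ?_, fun K _ _ v hv => by rw [map_mul, map_mul, e K v hv]⟩
    have := hp.mul (MvPolynomial.isWeightedHomogeneous_X k (multiWeight ι N) t)
    rwa [tsub_add_cancel_of_le (le_trans le_add_self hd)] at this

/-- The extra factor, the product of all the forms, makes the polynomial vanish off the chart, so
vanishing on the chart of `F` becomes vanishing on all of `F`. -/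
theorem exists_homogenisation [Fintype ι] (l : ι → Fin (N + 1) → k) (q : MvPolynomial (ι × Fin (N + 1)) k) :
    ∃ p : MvPolynomial (ι × Fin (N + 1)) k, IsMultihomogeneous p ∧
      (∀ (K : Type u) [Field K] [Algebra k K] (v : ι × Fin (N + 1) → K),
        Normalised l v → MvPolynomial.aeval v p = MvPolynomial.aeval v q) ∧
      ∀ (K : Type u) [Field K] [Algebra k K] (v : ι × Fin (N + 1) → K) (i : ι),
        formVal l v i = 0 → MvPolynomial.aeval v p = 0 := by
  obtain ⟨D, h⟩ := exists_homogenisation_of_degree l q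
  obtain ⟨p, hp, e⟩ := h D le_rfl
  refine ⟨p * ∏ i, formPoly l i ^ 1, (isMultihomogeneous_iff.2 ⟨_, hp⟩).mul
    (isMultihomogeneous_iff.2 ⟨_, isWeightedHomogeneous_prod_formPoly l fun _ => 1⟩),
    fun K _ _ v hv => by rw [map_mul, aeval_prod_formPoly hv, mul_one, e K v hv], fun K _ _ v i hi => ?_⟩
  rw [map_mul, map_prod, Finset.prod_eq_zero (Finset.mem_univ i), mul_zero]
  rw [map_pow, aeval_formPoly, hi, pow_one]

/-- The affine chart of `F` on which the linear forms `l` are normalised to `1`. -/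
def formChart (l : ι → Fin (N + 1) → k) (F : Set (ι → PSpace k N)) : Set (ι × Fin (N + 1) → k) :=
  {v | Normalised l v ∧ ∃ x ∈ F, IsRep v x}

theorem formChart_single [DecidableEq (Fin (N + 1))] (c : ι → Fin (N + 1)) (F : Set (ι → PSpace k N)) :
    formChart (fun i => Pi.single (c i) 1) F = affineChart c F := by
  ext v
  refine and_congr (forall_congr' fun i => ?_) Iff.rfl
  rw [formVal, Finset.sum_eq_single (c i)]
  · simp
  · intro j _ hj; simp [Pi.single_eq_of_ne hj]
  · simp

theorem aeval_eq_zero_of_mem_vanishingIdeal [Fintype ι] {l : ι → Fin (N + 1) → k} {F : Set (ι → PSpace k N)}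
    {q : MvPolynomial (ι × Fin (N + 1)) k} (hq : q ∈ MvPolynomial.vanishingIdeal k (formChart l F))
    {x : ι → PSpace K N} (hx : x ∈ pointsOver K F) {v : ι × Fin (N + 1) → K} (hv : IsRep v x) (hl : Normalised l v) :
    MvPolynomial.aeval v q = 0 := by
  obtain ⟨p, hp, h1, h0⟩ := exists_homogenisation l q
  rw [← h1 K v hl, ← vanishesAt_iff hp hv]
  refine hx p hp fun y hy => ?_
  have hr := isRep_rep y
  by_cases h : ∀ i, formVal l (fun q => (y q.1).rep q.2) i ≠ 0
  · obtain ⟨hr', hn⟩ := hr.exists_normalised h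
    rw [vanishesAt_iff hp hr', h1 k _ hn]
    exact hq _ ⟨hn, y, hy, hr'⟩
  · push Not at h
    obtain ⟨i, hi⟩ := h
    rw [vanishesAt_iff hp hr]
    exact h0 k _ i hi

theorem mem_vanishingIdeal_of_isGenericPoint [Fintype ι] {l : ι → Fin (N + 1) → k} {F : Set (ι → PSpace k N)}
    {q : MvPolynomial (ι × Fin (N + 1)) k} {x : ι → PSpace K N} (hx : IsGenericPoint F x)
    {v : ι × Fin (N + 1) → K} (hv : IsRep v x) (hl : Normalised l v)
    (hq : MvPolynomial.aeval v q = 0) : q ∈ MvPolynomial.vanishingIdeal k (formChart l F) := by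
  obtain ⟨p, hp, h1, h0⟩ := exists_homogenisation l q
  rw [← h1 K v hl, ← vanishesAt_iff hp hv] at hq
  rintro w ⟨hw, y, hy, hwy⟩
  rw [← h1 k w hw, ← vanishesAt_iff hp hwy]
  exact hx.2 p hp hq y hy

theorem isClosedSet_zeros {p : MvPolynomial (ι × Fin (N + 1)) k} (hp : IsMultihomogeneous p) :
    IsClosedSet {x : ι → PSpace k N | VanishesAt p x} :=
  ⟨{p}, by simpa using hp, by simp⟩

theorem IsIrreducibleClosed.vanishes_or [Fintype ι] {F : Set (ι → PSpace k N)} (hF : IsIrreducibleClosed F)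
    {p q : MvPolynomial (ι × Fin (N + 1)) k} (hp : IsMultihomogeneous p) (hq : IsMultihomogeneous q)
    (h : ∀ x ∈ F, VanishesAt p x ∨ VanishesAt q x) : (∀ x ∈ F, VanishesAt p x) ∨ ∀ x ∈ F, VanishesAt q x :=
  hF.2.2 _ _ (isClosedSet_zeros hp) (isClosedSet_zeros hq) h

theorem isPrime_vanishingIdeal [Fintype ι] {l : ι → Fin (N + 1) → k} {F : Set (ι → PSpace k N)} (hF : IsIrreducibleClosed F)
    (hne : (formChart l F).Nonempty) : (MvPolynomial.vanishingIdeal k (formChart l F)).IsPrime := by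
  refine ⟨fun h => ?_, fun {q₁ q₂} h => ?_⟩
  · obtain ⟨v, hv⟩ := hne
    have : (1 : MvPolynomial (ι × Fin (N + 1)) k) ∈ MvPolynomial.vanishingIdeal k (formChart l F) := by rw [h]; trivial
    simpa using this v hv
  · obtain ⟨p₁, hp₁, e₁, z₁⟩ := exists_homogenisation l q₁
    obtain ⟨p₂, hp₂, e₂, z₂⟩ := exists_homogenisation l q₂
    have key : ∀ (p q : MvPolynomial (ι × Fin (N + 1)) k), IsMultihomogeneous p →
        (∀ (K : Type u) [Field K] [Algebra k K] (v : ι × Fin (N + 1) → K),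
          Normalised l v → MvPolynomial.aeval v p = MvPolynomial.aeval v q) → (∀ x ∈ F, VanishesAt p x) →
        q ∈ MvPolynomial.vanishingIdeal k (formChart l F) := by
      rintro p q hp e h v ⟨hv, x, hx, hvx⟩
      rw [← e k v hv, ← vanishesAt_iff hp hvx]
      exact h x hx
    refine (hF.vanishes_or hp₁ hp₂ fun x hx => ?_).imp (key p₁ q₁ hp₁ e₁) (key p₂ q₂ hp₂ e₂)
    have hr := isRep_rep x
    by_cases hl : ∀ i, formVal l (fun q => (x q.1).rep q.2) i ≠ 0
    · obtain ⟨hr', hn⟩ := hr.exists_normalised hl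
      rw [vanishesAt_iff hp₁ hr', vanishesAt_iff hp₂ hr', e₁ k _ hn, e₂ k _ hn, ← mul_eq_zero, ← map_mul]
      exact h _ ⟨hn, x, hx, hr'⟩
    · push Not at hl
      obtain ⟨i, hi⟩ := hl
      left
      rw [vanishesAt_iff hp₁ hr]
      exact z₁ k _ i hi

/-- The variety `F` is covered by the zeros of `p` and those of the product of the forms; the second
set does not contain `F` because the chart is nonempty, so irreducibility leaves the first. -/
theorem vanishes_of_mem_vanishingIdeal [Fintype ι] {l : ι → Fin (N + 1) → k} {F : Set (ι → PSpace k N)}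
    (hF : IsIrreducibleClosed F) (hne : (formChart l F).Nonempty) {p : MvPolynomial (ι × Fin (N + 1)) k}
    (hp : IsMultihomogeneous p) (h : p ∈ MvPolynomial.vanishingIdeal k (formChart l F)) : ∀ x ∈ F, VanishesAt p x := by
  have hq : IsMultihomogeneous (∏ i, formPoly l i ^ 1 : MvPolynomial (ι × Fin (N + 1)) k) :=
    isMultihomogeneous_iff.2 ⟨_, isWeightedHomogeneous_prod_formPoly l fun _ => 1⟩
  refine (hF.vanishes_or hp hq fun x hx => ?_).resolve_right fun h' => ?_
  · have hr := isRep_rep x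
    by_cases hl : ∀ i, formVal l (fun q => (x q.1).rep q.2) i ≠ 0
    · obtain ⟨hr', hn⟩ := hr.exists_normalised hl
      exact Or.inl ((vanishesAt_iff hp hr').2 (h _ ⟨hn, x, hx, hr'⟩))
    · push Not at hl
      obtain ⟨i, hi⟩ := hl
      refine Or.inr ((vanishesAt_iff hq hr).2 ?_)
      rw [map_prod, Finset.prod_eq_zero (Finset.mem_univ i)]
      rw [map_pow, aeval_formPoly, hi, pow_one]
  · obtain ⟨v, hv, x, hx, hvx⟩ := hne
    have := (vanishesAt_iff hq hvx).1 (h' x hx)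
    rw [aeval_prod_formPoly hv] at this
    exact one_ne_zero this

theorem pointsOver_self {F : Set (ι → PSpace k N)} (hF : IsClosedSet F) : pointsOver k F = F := by
  refine Set.Subset.antisymm (fun x hx => ?_) fun x hx p _ h => h x hx
  obtain ⟨T, hT, rfl⟩ := hF
  exact fun p hp => hx p (hT p hp) fun y hy => hy p hp

end Homogeneous

/-! ### Valuative integrality and counting after localisation -/

theorem isPlace_valuationSubring {K : Type*} [Field K] (V : ValuationSubring K) :
    IsPlace (fun (x : K) (a : IsLocalRing.ResidueField V) => ∃ h : x ∈ V, IsLocalRing.residue V ⟨x, h⟩ = a) where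
  one := ⟨one_mem _, map_one _⟩
  add := by rintro x y _ _ ⟨h, rfl⟩ ⟨h', rfl⟩; exact ⟨add_mem h h', map_add (IsLocalRing.residue V) ⟨x, h⟩ ⟨y, h'⟩⟩
  neg := by rintro x _ ⟨h, rfl⟩; exact ⟨neg_mem h, map_neg (IsLocalRing.residue V) ⟨x, h⟩⟩
  mul := by rintro x y _ _ ⟨h, rfl⟩ ⟨h', rfl⟩; exact ⟨mul_mem h h', map_mul (IsLocalRing.residue V) ⟨x, h⟩ ⟨y, h'⟩⟩
  unique := by rintro x _ _ ⟨h, rfl⟩ ⟨h', rfl⟩; rfl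
  total x := by
    by_cases h : x ∈ V
    · exact Or.inl ⟨_, h, rfl⟩
    · have h' := V.inv_mem_nonunits_iff.2 (Or.inr h)
      refine Or.inr ⟨ValuationSubring.nonunits_subset h', ?_⟩
      rw [IsLocalRing.residue_eq_zero_iff]
      exact ValuationSubring.coe_mem_nonunits_iff.1 h'

/-- If `x` satisfies no polynomial over `A` whose leading coefficient is `1` modulo `m`, then there is a
place with pole `x` that is finite on `A` and vanishes on `m`. -/
theorem exists_place_of_not_integral {A : Type*} [CommRing A] {Ω : Type u} [Field Ω] [Algebra A Ω] (m : Ideal A) (hm : m ≠ ⊤)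
    {x : Ω} (hx : ∀ P : A[X], P.leadingCoeff - 1 ∈ m → aeval x P ≠ 0) :
    ∃ (k : Type u) (_ : Field k) (S : Ω → k → Prop) (ρ : A →+* k), IsPlace S ∧ (∀ u, S (algebraMap A Ω u) (ρ u)) ∧
      (∀ u ∈ m, ρ u = 0) ∧ ¬ ∃ a, S x a := by
  have hx0 : x ≠ 0 := by
    rintro rfl
    refine hx X ?_ (by simp)
    nontriviality A
    simp
  let := invertibleOfNonzero (inv_ne_zero hx0)
  let B := Algebra.adjoin A {x⁻¹}
  let xinv : B := ⟨x⁻¹, Algebra.subset_adjoin rfl⟩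
  -- If `m` and `x⁻¹` generated the unit ideal of `A[x⁻¹]`, multiplying by a power of `x` would give
  -- a forbidden relation for `x`. As they do not, some valuation ring contains `A[x⁻¹]` with both
  -- in its maximal ideal.
  have hI : m.map (algebraMap A B) ⊔ Ideal.span {xinv} ≠ ⊤ := fun h => by
    obtain ⟨P, hP, h0⟩ := Algebra.exists_aeval_invOf_eq_zero_of_idealMap_adjoin_sup_span_eq_top x⁻¹ m hm h
    rw [invOf_eq_inv, inv_inv] at h0
    exact hx P hP h0
  obtain ⟨V, hV, hVI⟩ := Ideal.image_subset_nonunits_valuationSubring (A := B.toSubring) _ hI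
  have hA : ∀ u, algebraMap A Ω u ∈ V := fun u => hV (B.algebraMap_mem u)
  let f : A →+* V := (algebraMap A Ω).codRestrict V.toSubring hA
  refine ⟨IsLocalRing.ResidueField V, inferInstance, _, (IsLocalRing.residue V).comp f, isPlace_valuationSubring V,
    fun u => ⟨hA u, rfl⟩, fun u hu => ?_, ?_⟩
  · rw [RingHom.comp_apply, IsLocalRing.residue_eq_zero_iff, ← ValuationSubring.coe_mem_nonunits_iff]
    exact hVI ⟨algebraMap A B u, Ideal.mem_sup_left (Ideal.mem_map_of_mem _ hu), rfl⟩
  · rintro ⟨a, h, -⟩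
    have : x⁻¹ ∈ V.nonunits := hVI ⟨xinv, Ideal.mem_sup_right (Ideal.mem_span_singleton_self _), rfl⟩
    rcases V.inv_mem_nonunits_iff.1 this with h' | h'
    · exact hx0 h'
    · exact h' h

/-- The coordinate `f t₀` is one of least valuation. This is the properness of projective space:
dividing by it makes the whole tuple finite. -/
theorem IsPlace.exists_ratios {K k : Type*} [Field K] [Field k] {S : K → k → Prop} (hS : IsPlace S) {τ : Type*} [Finite τ]
    {f : τ → K} (hf : f ≠ 0) : ∃ t₀, f t₀ ≠ 0 ∧ ∀ t, ∃ a, S ((f t₀)⁻¹ * f t) a := by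
  classical
  have := Fintype.ofFinite τ
  have key : ∀ s : Finset τ, s.Nonempty → (∀ t ∈ s, f t ≠ 0) → ∃ t₀ ∈ s, ∀ t ∈ s, ∃ a, S ((f t₀)⁻¹ * f t) a := by
    intro s hs
    induction hs using Finset.Nonempty.cons_induction with
    | singleton a =>
      intro h
      refine ⟨a, by simp, fun t ht => ⟨1, ?_⟩⟩
      obtain rfl := Finset.mem_singleton.1 ht
      rw [inv_mul_cancel₀ (h _ (by simp))]
      exact hS.one
    | cons a s ha hs ih =>
      intro h
      obtain ⟨t₀, ht₀, h₀⟩ := ih fun t ht => h t (by simp [ht])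
      have h1 := h t₀ (by simp [ht₀])
      have h2 := h a (by simp)
      rcases hS.total ((f t₀)⁻¹ * f a) with h' | h'
      · refine ⟨t₀, by simp [ht₀], fun t ht => ?_⟩
        rcases Finset.mem_cons.1 ht with rfl | ht
        · exact h'
        · exact h₀ t ht
      · refine ⟨a, by simp, fun t ht => ?_⟩
        rcases Finset.mem_cons.1 ht with rfl | ht
        · exact ⟨1, by rw [inv_mul_cancel₀ h2]; exact hS.one⟩
        · obtain ⟨b, hb⟩ := h₀ t ht
          refine ⟨0 * b, ?_⟩
          convert hS.mul h' hb using 1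
          field_simp
  obtain ⟨j, hj⟩ := Function.ne_iff.1 hf
  obtain ⟨t₀, h1, h2⟩ := key (Finset.univ.filter fun t => f t ≠ 0) ⟨j, by simpa using hj⟩ (by simp)
  refine ⟨t₀, by simpa using h1, fun t => ?_⟩
  by_cases ht : f t = 0
  · exact ⟨0, by rw [ht, mul_zero]; exact hS.zero⟩
  · exact h2 t (by simpa using ht)

section Local

variable {L A B : Type*} [Field L] [IsAlgClosed L] [CommRing A] [IsDomain A] [CommRing B] [IsDomain B]
  [Algebra A B] [FaithfulSMul A B] [Algebra L A] [Algebra L B] [IsScalarTower L A B]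

/-- The count of specialising homomorphisms when `A` is normal at the kernel of `σ` and `B` is integral over `A`
near that kernel. -/
theorem exists_ncard_specialisingHoms {Ω : Type*} [Field Ω] [IsAlgClosed Ω] {S : Ω → L → Prop} (hS : IsPlace S)
    {τ : Type*} [Finite τ] {y : τ → B} (hy : Algebra.adjoin A (Set.range y) = ⊤) (σ : B →+* L)
    (hnormal : ∀ (p : Ideal A) [p.IsPrime], IsIntegrallyClosed (Localization.AtPrime p))
    (hint : ∀ t, ∃ P : A[X], σ (algebraMap A B P.leadingCoeff) ≠ 0 ∧ aeval (y t) P = 0) :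
    ∃ n : ℕ, ∀ φ : A →+* Ω, Function.Injective φ → (∀ u, S (φ u) (σ (algebraMap A B u))) →
      (specialisingHoms S φ σ).encard = n ∧
      ∀ ψ : B →+* Ω, ψ.comp (algebraMap A B) = φ → Function.Injective ψ := by
  let m := RingHom.ker (σ.comp (algebraMap A B))
  have : m.IsPrime := RingHom.ker_isPrime _
  let M := Algebra.algebraMapSubmonoid B m.primeCompl
  let O := Localization.AtPrime m
  let B' := Localization M
  have hσm : ∀ s : m.primeCompl, σ (algebraMap A B s) ≠ 0 := fun s hs => s.2 hs
  have hM : M ≤ nonZeroDivisors B := by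
    rintro _ ⟨s, hs, rfl⟩
    refine mem_nonZeroDivisors_of_ne_zero fun h => hσm ⟨s, hs⟩ ?_
    rw [h, map_zero]
  have : IsDomain B' := IsLocalization.isDomain_localization hM
  have : IsDomain O := inferInstance
  have : IsIntegrallyClosed O := hnormal m
  have hinjB : Function.Injective (algebraMap B B') := IsLocalization.injective B' hM
  have hOB : Function.Injective (algebraMap O B') :=
    localizationAlgebra_injective (M := m.primeCompl) O B' (FaithfulSMul.algebraMap_injective A B)
  have : FaithfulSMul O B' := (faithfulSMul_iff_algebraMap_injective O B').2 hOB
  have htow' : IsScalarTower A O B' := inferInstance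
  have htow : ∀ u : A, algebraMap O B' (algebraMap A O u) = algebraMap B B' (algebraMap A B u) := fun u => by
    rw [← IsScalarTower.algebraMap_apply A O B', ← IsScalarTower.algebraMap_apply A B B']
  have : IsScalarTower L O B' := IsScalarTower.of_algebraMap_eq fun c => by
    rw [IsScalarTower.algebraMap_apply L B B', IsScalarTower.algebraMap_apply L A O, htow,
      ← IsScalarTower.algebraMap_apply L A B]
  have hadj : Algebra.adjoin O (Set.range fun t => algebraMap B B' (y t)) = ⊤ := by
    have hb : ∀ b : B, algebraMap B B' b ∈ Algebra.adjoin O (Set.range fun t => algebraMap B B' (y t)) := fun b => by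
      have hb : b ∈ Algebra.adjoin A (Set.range y) := hy ▸ Algebra.mem_top
      induction hb using Algebra.adjoin_induction with
      | mem x hx => obtain ⟨t, rfl⟩ := hx; exact Algebra.subset_adjoin ⟨t, rfl⟩
      | algebraMap r => rw [← htow]; exact Subalgebra.algebraMap_mem _ _
      | add x y _ _ hx hy => rw [map_add]; exact add_mem hx hy
      | mul x y _ _ hx hy => rw [map_mul]; exact mul_mem hx hy
    refine Algebra.eq_top_iff.2 fun z => ?_
    obtain ⟨b, ⟨_, s, hs, rfl⟩, rfl⟩ := IsLocalization.exists_mk'_eq M z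
    have : IsLocalization.mk' B' b (⟨algebraMap A B s, s, hs, rfl⟩ : M) =
        algebraMap O B' (IsLocalization.mk' O 1 (⟨s, hs⟩ : m.primeCompl)) * algebraMap B B' b := by
      rw [IsLocalization.mk'_eq_iff_eq_mul, mul_right_comm]
      rw [← htow, ← map_mul, IsLocalization.mk'_spec, map_one, map_one, one_mul]
    rw [this]
    exact mul_mem (Subalgebra.algebraMap_mem _ _) (hb b)
  -- The leading coefficients do not vanish under `σ`, so they are units of `O` and the relations
  -- can be made monic.
  have hintB : Algebra.IsIntegral O B' := by
    have h : ∀ t, algebraMap B B' (y t) ∈ integralClosure O B' := fun t => by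
      obtain ⟨P, hP, h0⟩ := hint t
      have hu : IsUnit (algebraMap A O P.leadingCoeff) := IsLocalization.map_units O (⟨_, hP⟩ : m.primeCompl)
      have h1 := isIntegral_leadingCoeff_smul (P.map (algebraMap A O)) (algebraMap B B' (y t)) (by
        rw [aeval_map_algebraMap, aeval_algebraMap_apply, h0, map_zero])
      rw [leadingCoeff_map_of_leadingCoeff_ne_zero _ hu.ne_zero] at h1
      have h2 := h1.smul (↑hu.unit⁻¹ : O)
      rwa [smul_smul, IsUnit.val_inv_mul, one_smul] at h2
    have h' : (⊤ : Subalgebra O B') ≤ integralClosure O B' := hadj ▸ Algebra.adjoin_le (by rintro _ ⟨t, rfl⟩; exact h t)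
    exact ⟨fun z => h' (Algebra.mem_top (x := z))⟩
  have hunit : ∀ s : M, IsUnit (σ s) := by
    rintro ⟨_, s, hs, rfl⟩
    exact (hσm ⟨s, hs⟩).isUnit
  let σ' : B' →+* L := IsLocalization.lift hunit
  have hσ' : ∀ b, σ' (algebraMap B B' b) = σ b := fun b => IsLocalization.lift_eq _ _
  have main : ∀ φ : A →+* Ω, Function.Injective φ → (∀ u, S (φ u) (σ (algebraMap A B u))) →
      ∃ φ' : O →+* Ω, Function.Injective φ' ∧ (∀ u, S (φ' u) (σ' (algebraMap O B' u))) ∧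
        (∀ ψ : B →+* Ω, ψ.comp (algebraMap A B) = φ → ∃ ψ' : B' →+* Ω, ψ'.comp (algebraMap O B') = φ' ∧
          ψ'.comp (algebraMap B B') = ψ) ∧
        (specialisingHoms S φ σ).encard = (specialisingHoms S φ' σ').encard := by
    intro φ hφ h
    have hφu : ∀ s : m.primeCompl, IsUnit (φ s) := fun s => by
      refine IsUnit.mk0 _ fun h0 => hσm s ?_
      rw [(map_eq_zero_iff φ hφ).1 h0, map_zero, map_zero]
    let φ' : O →+* Ω := IsLocalization.lift hφu
    have hφ' : φ'.comp (algebraMap A O) = φ := IsLocalization.lift_comp _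
    have hS' : ∀ {a s : Ω} {α ζ : L}, S a α → S s ζ → ζ ≠ 0 → ∀ {z : Ω} {ω : L}, z * s = a → ω * ζ = α → S z ω := by
      intro a s α ζ ha hs hζ z ω hz hω
      have hs0 : s ≠ 0 := fun h0 => hζ (hS.unique hs (h0 ▸ hS.zero))
      rw [← eq_mul_inv_iff_mul_eq₀ hs0] at hz
      rw [← eq_mul_inv_iff_mul_eq₀ hζ] at hω
      rw [hz, hω]
      exact hS.mul ha (hS.inv hs hζ)
    have hlift : ∀ ψ : B →+* Ω, ψ.comp (algebraMap A B) = φ → ∃ ψ' : B' →+* Ω, ψ'.comp (algebraMap O B') = φ' ∧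
          ψ'.comp (algebraMap B B') = ψ := by
      intro ψ hψ
      have hψu : ∀ s : M, IsUnit (ψ s) := by
        rintro ⟨_, s, hs, rfl⟩
        have := hφu ⟨s, hs⟩
        rwa [← hψ] at this
      refine ⟨IsLocalization.lift hψu, ?_, IsLocalization.lift_comp _⟩
      refine IsLocalization.ringHom_ext m.primeCompl (RingHom.ext fun u => ?_)
      rw [hφ', RingHom.comp_apply, RingHom.comp_apply, htow, IsLocalization.lift_eq, ← hψ]
      rfl
    refine ⟨φ', ?_, ?_, hlift, ?_⟩
    · exact (IsLocalization.lift_injective_iff hφu).2 fun x y => by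
        rw [hφ.eq_iff, (IsLocalization.injective O m.primeCompl_le_nonZeroDivisors).eq_iff]
    · intro u
      obtain ⟨x, s, rfl⟩ := IsLocalization.exists_mk'_eq m.primeCompl u
      refine hS' (h x) (h s) (hσm s) ?_ ?_
      · rw [← hφ', RingHom.comp_apply, RingHom.comp_apply, ← map_mul, IsLocalization.mk'_spec]
      · rw [← hσ', ← hσ', ← htow, ← htow, ← map_mul, ← map_mul, IsLocalization.mk'_spec]
    · have himg : specialisingHoms S φ σ = (fun ψ' : B' →+* Ω => ψ'.comp (algebraMap B B')) '' specialisingHoms S φ' σ' := by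
        ext ψ
        constructor
        · rintro ⟨h1, h2⟩
          obtain ⟨ψ', h3, h4⟩ := hlift ψ h1
          refine ⟨ψ', ⟨h3, fun z => ?_⟩, h4⟩
          obtain ⟨b, s, rfl⟩ := IsLocalization.exists_mk'_eq M z
          refine hS' (h2 b) (h2 s) (hunit s).ne_zero ?_ ?_
          · rw [← h4, RingHom.comp_apply, RingHom.comp_apply, ← map_mul, IsLocalization.mk'_spec]
          · rw [← hσ', ← hσ', ← map_mul, IsLocalization.mk'_spec]
        · rintro ⟨ψ', ⟨h1, h2⟩, rfl⟩
          refine ⟨RingHom.ext fun u => ?_, fun b => ?_⟩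
          · rw [← hφ', ← h1]
            simp only [RingHom.comp_apply, htow]
          · rw [← hσ']; exact h2 _
      rw [himg]
      exact Set.InjOn.encard_image fun ψ₁ _ ψ₂ _ h => IsLocalization.ringHom_ext M h
  -- Any admissible `φ₀` serves as the reference for the count; if there is none, the claim is
  -- vacuous and `0` will do.
  by_cases hex : ∃ φ₀ : A →+* Ω, Function.Injective φ₀ ∧ ∀ u, S (φ₀ u) (σ (algebraMap A B u))
  · obtain ⟨φ₀, hφ₀, h₀⟩ := hex
    obtain ⟨φ₀', i₀, s₀, -, -⟩ := main φ₀ hφ₀ h₀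
    refine ⟨(specialisingHoms S φ₀' σ').ncard, fun φ hφ h => ?_⟩
    obtain ⟨φ', i, s, l, e⟩ := main φ hφ h
    obtain ⟨hfin, -, hc⟩ := ncard_specialisingHoms hS hadj σ' i i₀ s s₀
    refine ⟨by rw [e, ← hc, hfin.cast_ncard_eq], fun ψ hψ => ?_⟩
    obtain ⟨ψ', h1, rfl⟩ := l ψ hψ
    refine Function.Injective.comp (g := ψ') ?_ hinjB
    rw [RingHom.injective_iff_ker_eq_bot]
    -- The kernel of `ψ'` is an ideal of an integral extension domain that meets `O` only in `0`,
    -- hence is `0`.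
    refine Ideal.eq_bot_of_comap_eq_bot (R := O) ?_
    rw [RingHom.comap_ker, h1, ← RingHom.injective_iff_ker_eq_bot]
    exact i
  · push Not at hex
    exact ⟨0, fun φ hφ h => by obtain ⟨u, hu⟩ := hex φ hφ; exact absurd (h u) hu⟩

end Local

/-! ### Points of charts and homomorphisms -/

section Blocks

variable {K : Type u} [Field K] {ι κ : Type} {N : ℕ}

/-- The coordinates of a point of `(P^N)^ι × (P^N)^κ`, from those of its two components. -/
def blockElim (v : ι × Fin (N + 1) → K) (w : κ × Fin (N + 1) → K) (q : (ι ⊕ κ) × Fin (N + 1)) : K :=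
  Sum.elim (fun i => v (i, q.2)) (fun i => w (i, q.2)) q.1

theorem isRep_blockElim {v : ι × Fin (N + 1) → K} {w : κ × Fin (N + 1) → K} {x : ι → PSpace K N} {y : κ → PSpace K N} :
    IsRep (blockElim v w) (Sum.elim x y) ↔ IsRep v x ∧ IsRep w y := by
  rw [IsRep, Sum.forall]; rfl

theorem normalised_blockElim {k : Type u} [Field k] [Algebra k K] {l : ι → Fin (N + 1) → k} {h : κ → Fin (N + 1) → k}
    {v : ι × Fin (N + 1) → K} {w : κ × Fin (N + 1) → K} :
    Normalised (Sum.elim l h) (blockElim v w) ↔ Normalised l v ∧ Normalised h w := by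
  rw [Normalised, Sum.forall]; rfl

theorem normalised_single {k : Type u} [Field k] [Algebra k K] {c : ι → Fin (N + 1)} {v : ι × Fin (N + 1) → K} :
    Normalised (fun i => Pi.single (c i) (1 : k)) v ↔ ∀ i, v (i, c i) = 1 := by
  refine forall_congr' fun i => ?_
  rw [formVal, Finset.sum_eq_single (c i)]
  · simp
  · intro j _ hj; simp [Pi.single_eq_of_ne hj]
  · simp

theorem exists_normalised_single {k : Type u} [Field k] [Algebra k K] (x : ι → PSpace K N) :
    ∃ (c : ι → Fin (N + 1)) (v : ι × Fin (N + 1) → K), IsRep v x ∧ Normalised (fun i => Pi.single (c i) (1 : k)) v := by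
  have h := fun i => Function.ne_iff.1 (x i).rep_nonzero
  choose c hc using h
  obtain ⟨h1, h2⟩ := (isRep_rep x).exists_normalised (k := k) (l := fun i => Pi.single (c i) 1) (by
    intro i
    rw [formVal, Finset.sum_eq_single (c i)]
    · simpa using hc i
    · intro j _ hj; simp [Pi.single_eq_of_ne hj]
    · simp)
  exact ⟨c, _, h1, h2⟩

end Blocks

/-! ### Rationality of points in finite fibres -/

section Fibre

variable {L : Type u} [Field L] [IsAlgClosed L] {K : Type u} [Field K] [Algebra L K] {ι κ : Type} [Fintype ι] [Fintype κ] {N : ℕ}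

/-- Points of a finite fibre over a rational point are rational. -/
theorem exists_rational_of_finite_fibre {F : Set (ι ⊕ κ → PSpace L N)} (hF : IsClosedSet F) {a : ι → PSpace L N}
    (hfin : {b : κ → PSpace L N | Sum.elim a b ∈ F}.Finite) {α : ι × Fin (N + 1) → L} (hα : IsRep α a)
    {w : κ × Fin (N + 1) → K} (hw : ∀ i, ∃ j, w (i, j) = 1)
    (hz : ∀ p : MvPolynomial ((ι ⊕ κ) × Fin (N + 1)) L, IsMultihomogeneous p → (∀ y ∈ F, VanishesAt p y) →
      MvPolynomial.aeval (blockElim (fun q => algebraMap L K (α q)) w) p = 0) :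
    ∃ w₀ : κ × Fin (N + 1) → L, (w = fun q => algebraMap L K (w₀ q)) ∧ ∃ b, IsRep w₀ b ∧ Sum.elim a b ∈ F := by
  choose c hc using hw
  let sub : MvPolynomial ((ι ⊕ κ) × Fin (N + 1)) L →ₐ[L] MvPolynomial (κ × Fin (N + 1)) L :=
    MvPolynomial.aeval (blockElim (fun q => MvPolynomial.C (α q)) MvPolynomial.X)
  have hsub : ∀ {E : Type u} [Field E] [Algebra L E] (z : κ × Fin (N + 1) → E) (p : MvPolynomial ((ι ⊕ κ) × Fin (N + 1)) L),
      MvPolynomial.aeval z (sub p) = MvPolynomial.aeval (blockElim (fun q => algebraMap L E (α q)) z) p := by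
    intro E _ _ z p
    rw [MvPolynomial.comp_aeval_apply]
    congr 2
    funext ⟨q, j⟩
    rcases q with i | i <;> simp [blockElim]
  -- The equations of the fibre over `a` in the affine chart given by `c`. Its zeros over `L` are
  -- finitely many because they inject into the given fibre.
  let I : Ideal (MvPolynomial (κ × Fin (N + 1)) L) :=
    Ideal.span (sub '' {p | IsMultihomogeneous p ∧ ∀ y ∈ F, VanishesAt p y} ∪
      Set.range fun i => MvPolynomial.X (i, c i) - 1)
  have hI : ∀ {E : Type u} [Field E] [Algebra L E] {z : κ × Fin (N + 1) → E}, (∀ i, z (i, c i) = 1) →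
      (∀ p : MvPolynomial ((ι ⊕ κ) × Fin (N + 1)) L, IsMultihomogeneous p → (∀ y ∈ F, VanishesAt p y) →
        MvPolynomial.aeval (blockElim (fun q => algebraMap L E (α q)) z) p = 0) →
      ∀ p ∈ I, MvPolynomial.aeval z p = 0 := by
    intro E _ _ z h1 h2 p hp
    suffices h : I ≤ RingHom.ker (MvPolynomial.aeval (R := L) z) from h hp
    refine Ideal.span_le.2 ?_
    rintro _ (⟨p, ⟨hp, hv⟩, rfl⟩ | ⟨i, rfl⟩)
    · exact (hsub z p).trans (h2 p hp hv)
    · simp [h1]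
  have hZ : ∀ z ∈ MvPolynomial.zeroLocus L I, Normalised (fun i => Pi.single (c i) (1 : L)) z ∧
      ∃ b, IsRep z b ∧ Sum.elim a b ∈ F := by
    intro z hz
    have hn : Normalised (fun i => Pi.single (c i) (1 : L)) z := normalised_single.2 fun i => by
      have := hz _ (Ideal.subset_span (Or.inr ⟨i, rfl⟩))
      simpa [sub_eq_zero] using this
    obtain ⟨b, hb⟩ := hn.exists_isRep
    refine ⟨hn, b, hb, ?_⟩
    rw [← pointsOver_self hF]
    intro p hp hv
    have := hz _ (Ideal.subset_span (Or.inl ⟨p, ⟨hp, hv⟩, rfl⟩))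
    rw [hsub] at this
    exact (vanishesAt_iff hp (isRep_blockElim.2 ⟨hα, hb⟩)).2 this
  have hZfin : (MvPolynomial.zeroLocus L I).Finite := by
    choose! hn f hf hfF using hZ
    refine Set.Finite.of_finite_image (f := f) (hfin.subset ?_) ?_
    · rintro _ ⟨z, hz, rfl⟩; exact hfF z hz
    · intro z hz z' hz' h
      exact (hn z hz).eq_of_isRep (hn z' hz') (hf z hz) (h ▸ hf z' hz')
  have hwI : ∀ p ∈ I, MvPolynomial.aeval w p = 0 := hI hc hz
  obtain ⟨z, hzZ, hzw⟩ : ∃ z ∈ MvPolynomial.zeroLocus L I, w = fun q => algebraMap L K (z q) := by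
    by_contra! hcon
    have h : ∀ z : κ × Fin (N + 1) → L, ∃ t, z ∈ MvPolynomial.zeroLocus L I → w t ≠ algebraMap L K (z t) := fun z => by
      by_cases hz : z ∈ MvPolynomial.zeroLocus L I
      · obtain ⟨t, ht⟩ := Function.ne_iff.1 (hcon z hz)
        exact ⟨t, fun _ => ht⟩
      -- Without variables the elements of `I` are constants that vanish at `w`, so they are zero
      -- and the unique point `z` is in the zero locus.
      · by_cases hne : Nonempty (κ × Fin (N + 1))
        · exact ⟨hne.some, fun h => absurd h hz⟩
        · exact absurd (MvPolynomial.mem_zeroLocus_iff.2 fun p hp => by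
            have h1 := hwI p hp
            have : IsEmpty (κ × Fin (N + 1)) := not_nonempty_iff.1 hne
            rw [MvPolynomial.eq_C_of_isEmpty p] at h1 ⊢
            simpa using h1) hz
    choose t ht using h
    -- If `w` differed from every zero `z`, at the coordinate `t z` say, this product would be
    -- nonzero at `w`. It vanishes on the zero locus, so by the Nullstellensatz some power lies in
    -- `I`, which vanishes at `w`.
    let Q : MvPolynomial (κ × Fin (N + 1)) L := ∏ z ∈ hZfin.toFinset, (MvPolynomial.X (t z) - MvPolynomial.C (z (t z)))
    have hQ : Q ∈ MvPolynomial.vanishingIdeal L (MvPolynomial.zeroLocus L I) := fun z hz => by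
      rw [map_prod]
      exact Finset.prod_eq_zero (hZfin.mem_toFinset.2 hz) (by simp)
    rw [MvPolynomial.vanishingIdeal_zeroLocus_eq_radical] at hQ
    obtain ⟨n, hn⟩ := hQ
    have h0 := hwI _ hn
    rw [map_pow, map_prod] at h0
    obtain ⟨z, hz, h0⟩ := Finset.prod_eq_zero_iff.1 (eq_zero_of_pow_eq_zero h0)
    refine ht z (hZfin.mem_toFinset.1 hz) ?_
    simpa [sub_eq_zero] using h0
  exact ⟨z, hzw, (hZ z hzZ).2⟩

end Fibre

/-! ### Coordinate rings of charts and their homomorphisms -/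

section Chart

variable {k : Type u} [Field k] {K : Type u} [Field K] [Algebra k K] {ι : Type} {N : ℕ}

/-- The coordinate ring of an affine chart. -/
abbrev chartRing (l : ι → Fin (N + 1) → k) (F : Set (ι → PSpace k N)) : Type u :=
  MvPolynomial (ι × Fin (N + 1)) k ⧸ MvPolynomial.vanishingIdeal k (formChart l F)

/-- The coordinate functions on an affine chart. -/
def chartCoord (l : ι → Fin (N + 1) → k) (F : Set (ι → PSpace k N)) (t : ι × Fin (N + 1)) : chartRing l F :=
  Ideal.Quotient.mk _ (MvPolynomial.X t)

variable {l : ι → Fin (N + 1) → k} {F : Set (ι → PSpace k N)}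

theorem algHom_chartRing_mk (ψ : chartRing l F →ₐ[k] K) (p : MvPolynomial (ι × Fin (N + 1)) k) :
    ψ (Ideal.Quotient.mk _ p) = MvPolynomial.aeval (fun t => ψ (chartCoord l F t)) p := by
  have : ψ.comp (Ideal.Quotient.mkₐ k _) = MvPolynomial.aeval (fun t => ψ (chartCoord l F t)) :=
    MvPolynomial.algHom_ext fun t => by rw [MvPolynomial.aeval_X]; rfl
  exact DFunLike.congr_fun this p

theorem adjoin_range_chartCoord : Algebra.adjoin k (Set.range (chartCoord l F)) = ⊤ := by
  have h : Set.range (chartCoord l F) = Ideal.Quotient.mkₐ k (MvPolynomial.vanishingIdeal k (formChart l F)) ''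
      Set.range MvPolynomial.X := by
    rw [← Set.range_comp]; rfl
  rw [h, Algebra.adjoin_image, MvPolynomial.adjoin_range_X, Algebra.map_top, AlgHom.range_eq_top]
  exact Ideal.Quotient.mkₐ_surjective k _

theorem normalised_of_algHom (ψ : chartRing l F →ₐ[k] K) : Normalised l (fun t => ψ (chartCoord l F t)) := fun i => by
  rw [← aeval_formPoly, ← algHom_chartRing_mk, ← map_one ψ]
  congr 1
  rw [← map_one (Ideal.Quotient.mk _), Ideal.Quotient.mk_eq_mk_iff_sub_mem]
  rintro v ⟨hv, -⟩
  rw [map_sub, aeval_formPoly, hv i, map_one, sub_self]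

variable [Fintype ι]

theorem mem_pointsOver_of_algHom (ψ : chartRing l F →ₐ[k] K) {x : ι → PSpace K N}
    (hx : IsRep (fun t => ψ (chartCoord l F t)) x) : x ∈ pointsOver K F := by
  intro p hp h
  rw [vanishesAt_iff hp hx, ← algHom_chartRing_mk, (Ideal.Quotient.eq_zero_iff_mem).2, map_zero]
  rintro v ⟨-, y, hy, hvy⟩
  exact (vanishesAt_iff hp hvy).1 (h y hy)

theorem isGenericPoint_of_algHom (hF : IsIrreducibleClosed F) (hne : (formChart l F).Nonempty) (ψ : chartRing l F →ₐ[k] K)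
    (hψ : Function.Injective ψ) {x : ι → PSpace K N}
    (hx : IsRep (fun t => ψ (chartCoord l F t)) x) : IsGenericPoint F x := by
  refine ⟨mem_pointsOver_of_algHom ψ hx, fun p hp h => vanishes_of_mem_vanishingIdeal hF hne hp ?_⟩
  rw [vanishesAt_iff hp hx, ← algHom_chartRing_mk, map_eq_zero_iff ψ hψ] at h
  exact Ideal.Quotient.eq_zero_iff_mem.1 h

/-- Evaluation at a point of the chart. -/
def chartEval {x : ι → PSpace K N} (hx : x ∈ pointsOver K F) {v : ι × Fin (N + 1) → K} (hv : IsRep v x)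
    (hl : Normalised l v) : chartRing l F →ₐ[k] K :=
  Ideal.Quotient.liftₐ _ (MvPolynomial.aeval v) fun _ hq => aeval_eq_zero_of_mem_vanishingIdeal hq hx hv hl

theorem chartEval_chartCoord {x : ι → PSpace K N} (hx : x ∈ pointsOver K F) {v : ι × Fin (N + 1) → K} (hv : IsRep v x)
    (hl : Normalised l v) (t : ι × Fin (N + 1)) : chartEval hx hv hl (chartCoord l F t) = v t :=
  MvPolynomial.aeval_X _ _

theorem chartEval_injective {x : ι → PSpace K N} (hx : IsGenericPoint F x) {v : ι × Fin (N + 1) → K} (hv : IsRep v x)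
    (hl : Normalised l v) : Function.Injective (chartEval hx.1 hv hl) := by
  refine (injective_iff_map_eq_zero _).2 fun z hz => ?_
  obtain ⟨p, rfl⟩ := Ideal.Quotient.mk_surjective z
  exact Ideal.Quotient.eq_zero_iff_mem.2 (mem_vanishingIdeal_of_isGenericPoint hx hv hl hz)

end Chart

/-! ### Infinitesimal neighbourhoods and existence of generic points in them -/

section Infinitesimal

theorem adjoin_eq_top_of_tower {R A B : Type*} [CommRing R] [CommRing A] [CommRing B] [Algebra R A] [Algebra A B] [Algebra R B]
    [IsScalarTower R A B] {s : Set B} (h : Algebra.adjoin R s = ⊤) : Algebra.adjoin A s = ⊤ := by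
  rw [eq_top_iff] at h ⊢
  have h' : Algebra.adjoin R s ≤ (Algebra.adjoin A s).restrictScalars R := Algebra.adjoin_le Algebra.subset_adjoin
  exact fun z _ => h' (h Algebra.mem_top)

theorem IsPlace.algHom_mvPolynomial {k K Ω : Type*} [Field k] [Field K] [Field Ω] [Algebra k K] [Algebra k Ω] {S : Ω → K → Prop}
    (hS : IsPlace S) (h : ∀ c : k, S (algebraMap k Ω c) (algebraMap k K c)) {τ : Type*} (φ : MvPolynomial τ k →ₐ[k] Ω)
    (ρ : MvPolynomial τ k →ₐ[k] K) (hX : ∀ i, S (φ (MvPolynomial.X i)) (ρ (MvPolynomial.X i))) (u : MvPolynomial τ k) :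
    S (φ u) (ρ u) := by
  rw [MvPolynomial.aeval_unique φ, MvPolynomial.aeval_unique ρ]
  exact hS.mvEval₂ h hX u

variable {L : Type u} [Field L] [IsAlgClosed L] {ι : Type} {N : ℕ}

theorem mem_infNhd_of_isRep {x : ι → PSpace (Komega L) N} {a : ι → PSpace L N} {v : ι × Fin (N + 1) → Komega L}
    {α : ι × Fin (N + 1) → L} (hv : IsRep v x) (hα : IsRep α a) (h : ∀ t, omegaPlace L (v t) (α t)) : x ∈ infNhd a := by
  intro i
  obtain ⟨h1, e1⟩ := hv i
  obtain ⟨h2, e2⟩ := hα i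
  exact (specialises_iff _ _).2 ⟨_, h1, _, h2, e1.symm, e2.symm, fun j => h (i, j)⟩

/-- The forms take nonzero values at `a`, so their values at a specialising representative of `x`
have nonzero residues, and dividing by them preserves specialisation. -/
theorem exists_isRep_of_mem_infNhd {x : ι → PSpace (Komega L) N} {a : ι → PSpace L N} (hx : x ∈ infNhd a)
    {l : ι → Fin (N + 1) → L} {α : ι × Fin (N + 1) → L} (hα : IsRep α a) (hl : Normalised l α) :
    ∃ v, IsRep v x ∧ Normalised l v ∧ ∀ t, omegaPlace L (v t) (α t) := by
  have hS := isPlace_omega L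
  have h := fun i => (specialises_iff _ _).1 (hx i)
  choose f hf g hg e1 e2 h using h
  have hg' : IsRep (fun q : ι × Fin (N + 1) => g q.1 q.2) a := fun i => ⟨hg i, (e2 i).symm⟩
  have hf' : IsRep (fun q : ι × Fin (N + 1) => f q.1 q.2) x := fun i => ⟨hf i, (e1 i).symm⟩
  obtain ⟨c, hc, hcα⟩ := hg'.exists_smul hα
  have hlg : ∀ i, formVal l (fun q : ι × Fin (N + 1) => g q.1 q.2) i ≠ 0 := fun i => by
    rw [show (fun q : ι × Fin (N + 1) => g q.1 q.2) = fun q => c q.1 * α q from funext hcα, formVal_smul, hl i, mul_one]; exact hc i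
  have hfg : ∀ i, omegaPlace L (formVal l (fun q : ι × Fin (N + 1) => f q.1 q.2) i)
      (formVal l (fun q : ι × Fin (N + 1) => g q.1 q.2) i) := fun i =>
    hS.sum fun j _ => hS.mul (omegaPlace_algebraMap L _) (h i j)
  have hlf : ∀ i, formVal l (fun q : ι × Fin (N + 1) => f q.1 q.2) i ≠ 0 := fun i h0 =>
    hlg i (hS.unique (hfg i) (h0 ▸ hS.zero))
  obtain ⟨r1, n1⟩ := hf'.exists_normalised hlf
  obtain ⟨r2, n2⟩ := hg'.exists_normalised hlg
  refine ⟨_, r1, n1, fun t => ?_⟩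
  rw [hl.eq_of_isRep n2 hα r2]
  exact hS.mul (hS.inv (hfg t.1) (hlg t.1)) (h t.1 t.2)

/-- By Noether normalisation `B` is integral over a polynomial ring. Algebraically independent
infinitesimals, translated to the image of `σ`, give an injective homomorphism of that ring, which
extends to `B` with residue `σ`. -/
theorem exists_injective_specialisingHom {B : Type*} [CommRing B] [IsDomain B] [Algebra L B] {τ : Type*} [Finite τ] {y : τ → B}
    (hy : Algebra.adjoin L (Set.range y) = ⊤) (σ : B →ₐ[L] L) :
    ∃ ψ : B →ₐ[L] Komega L, Function.Injective ψ ∧ ∀ b, omegaPlace L (ψ b) (σ b) := by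
  have hS := isPlace_omega L
  have : Algebra.FiniteType L B := ⟨Subalgebra.fg_def.2 ⟨_, Set.finite_range y, hy⟩⟩
  obtain ⟨s, g, hg, hgi⟩ := exists_integral_inj_algHom_of_fg L B
  obtain ⟨φ₀, hφ₀, hφ₀X⟩ := exists_injective_omega L s
  let O := MvPolynomial (Fin s) L
  let c : Fin s → L := fun i => σ (g (MvPolynomial.X i))
  obtain ⟨φ, hφ, hφX⟩ : ∃ φ : O →ₐ[L] Komega L, Function.Injective φ ∧ ∀ i, omegaPlace L (φ (MvPolynomial.X i)) (c i) := by
    let tr : O →ₐ[L] O := MvPolynomial.aeval fun i => MvPolynomial.X i + algebraMap L O (c i)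
    let tr' : O →ₐ[L] O := MvPolynomial.aeval fun i => MvPolynomial.X i - algebraMap L O (c i)
    have htr : Function.Injective tr := by
      have : tr'.comp tr = AlgHom.id L O := MvPolynomial.algHom_ext fun i => by
        rw [AlgHom.comp_apply, MvPolynomial.aeval_X, map_add, MvPolynomial.aeval_X, AlgHom.commutes, sub_add_cancel]
        rfl
      exact Function.LeftInverse.injective (g := tr') fun z => DFunLike.congr_fun this z
    refine ⟨φ₀.comp tr, hφ₀.comp htr, fun i => ?_⟩
    have h := hS.add (hφ₀X i) (omegaPlace_algebraMap L (c i))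
    rw [zero_add] at h
    rwa [AlgHom.comp_apply, MvPolynomial.aeval_X, map_add, AlgHom.commutes]
  let : Algebra O B := g.toRingHom.toAlgebra
  have : IsScalarTower L O B := IsScalarTower.of_algebraMap_eq fun r => (g.commutes r).symm
  have : Algebra.IsIntegral O B := ⟨hgi⟩
  have : FaithfulSMul O B := (faithfulSMul_iff_algebraMap_injective O B).2 hg
  have hy' : Algebra.adjoin O (Set.range y) = ⊤ := adjoin_eq_top_of_tower hy
  have hφS : ∀ u, omegaPlace L (φ u) (σ (algebraMap O B u)) :=
    hS.algHom_mvPolynomial (omegaPlace_algebraMap L) φ (σ.comp g) hφX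
  -- Both homomorphisms are taken to be `φ`, since only the nonemptiness of the set of extensions is
  -- needed.
  obtain ⟨-, ⟨ψ, hψ, hψS⟩, -⟩ := ncard_specialisingHoms hS hy' (σ : B →+* L) (φ₁ := (φ : O →+* Komega L)) hφ hφ hφS hφS
  have hψinj : Function.Injective ψ := by
    rw [RingHom.injective_iff_ker_eq_bot]
    refine Ideal.eq_bot_of_comap_eq_bot (R := O) ?_
    rw [RingHom.comap_ker, hψ, ← RingHom.injective_iff_ker_eq_bot]
    exact hφ
  refine ⟨{ ψ with commutes' := fun r => ?_ }, hψinj, hψS⟩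
  change ψ (algebraMap L B r) = _
  rw [IsScalarTower.algebraMap_apply L O B, ← RingHom.comp_apply, hψ]
  exact φ.commutes r

theorem exists_isGenericPoint_mem_infNhd [Fintype ι] {F : Set (ι → PSpace L N)} (hF : IsIrreducibleClosed F)
    {a : ι → PSpace L N} (ha : a ∈ F) : ∃ x ∈ infNhd a, IsGenericPoint F x := by
  obtain ⟨c, α, hα, hl⟩ := exists_normalised_single (k := L) a
  have hne : (formChart (fun i => Pi.single (c i) 1) F).Nonempty := ⟨α, hl, a, ha, hα⟩
  have := isPrime_vanishingIdeal hF hne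
  have haF : a ∈ pointsOver L F := by rwa [pointsOver_self hF.1]
  obtain ⟨ψ, hψ, hψS⟩ := exists_injective_specialisingHom adjoin_range_chartCoord (chartEval haF hα hl)
  obtain ⟨x, hx⟩ := (normalised_of_algHom ψ).exists_isRep
  refine ⟨x, mem_infNhd_of_isRep hx hα fun t => ?_, isGenericPoint_of_algHom hF hne ψ hψ hx⟩
  have := hψS (chartCoord _ F t)
  rwa [chartEval_chartCoord] at this

end Infinitesimal

/-! ### Finite covers -/

section Rename

variable {k : Type u} [Field k] {K : Type u} [Field K] [Algebra k K] {ι ι' : Type} {N : ℕ}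

theorem IsMultihomogeneous.rename [Fintype ι] {p : MvPolynomial (ι × Fin (N + 1)) k} (hp : IsMultihomogeneous p) {g : ι → ι'}
    (hg : Function.Injective g) : IsMultihomogeneous (MvPolynomial.rename (Prod.map g id) p) := by
  classical
  obtain ⟨d, hd⟩ := hp
  have hinj : Function.Injective (Prod.map g (id : Fin (N + 1) → Fin (N + 1))) := hg.prodMap Function.injective_id
  -- Blocks outside the image of `g` do not occur in the renamed polynomial and get degree `0`.
  refine ⟨fun i => if h : ∃ i₀, g i₀ = i then d h.choose else 0, fun e he i => ?_⟩
  rw [MvPolynomial.support_rename_of_injective hinj] at he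
  obtain ⟨e, he', rfl⟩ := Finset.mem_image.1 he
  dsimp only
  split_ifs with h
  · rw [← hd e he']
    refine Finset.sum_congr rfl fun j _ => ?_
    have : (i, j) = Prod.map g id (h.choose, j) := Prod.ext h.choose_spec.symm rfl
    rw [this, Finsupp.mapDomain_apply hinj]
  · refine Finset.sum_eq_zero fun j _ => Finsupp.mapDomain_of_notMem_range _ _ ?_
    rintro ⟨q, hq⟩
    exact h ⟨q.1, congrArg Prod.fst hq⟩

theorem vanishesAt_rename (p : MvPolynomial (ι × Fin (N + 1)) k) (g : ι → ι') (x : ι' → PSpace K N) :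
    VanishesAt (MvPolynomial.rename (Prod.map g id) p) x ↔ VanishesAt p (fun i => x (g i)) := by
  rw [VanishesAt, MvPolynomial.aeval_rename]; rfl

theorem mem_pointsOver_image [Fintype ι] {g : ι → ι'} (hg : Function.Injective g) {F : Set (ι' → PSpace k N)}
    {x : ι' → PSpace K N} (hx : x ∈ pointsOver K F) : (fun i => x (g i)) ∈ pointsOver K ((fun y i => y (g i)) '' F) := by
  intro p hp h
  rw [← vanishesAt_rename]
  exact hx _ (hp.rename hg) fun y hy => (vanishesAt_rename _ _ _).2 (h _ ⟨y, hy, rfl⟩)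

theorem IsRep.unique {v : ι × Fin (N + 1) → K} {x y : ι → PSpace K N} (hx : IsRep v x) (hy : IsRep v y) : x = y :=
  funext fun i => by
    obtain ⟨_, h⟩ := hx i
    obtain ⟨_, h'⟩ := hy i
    exact h.symm.trans h'

end Rename

/-- Taking coefficients `1, c, c², …` turns the value at `v` into a nonzero polynomial in `c`, and
finitely many such polynomials avoid vanishing at a common `c`. -/
theorem exists_form_ne_zero {L : Type*} [Field L] [Infinite L] {n : ℕ} {T : Set (Fin n → L)} (hT : T.Finite)
    (h0 : ∀ v ∈ T, v ≠ 0) : ∃ c : Fin n → L, ∀ v ∈ T, ∑ j, c j * v j ≠ 0 := by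
  let P : (Fin n → L) → L[X] := fun v => ∑ j, C (v j) * X ^ (j : ℕ)
  have hP : ∀ v ∈ T, P v ≠ 0 := fun v hv h => h0 v hv <| funext fun j => by
    have := congrArg (fun p => coeff p j) h
    simpa [P, finsetSum_coeff, coeff_C_mul, coeff_X_pow, Fin.val_inj] using this
  have hprod : ∏ v ∈ hT.toFinset, P v ≠ 0 := Finset.prod_ne_zero_iff.2 fun v hv => hP v (hT.mem_toFinset.1 hv)
  obtain ⟨c, hc⟩ : ∃ c, eval c (∏ v ∈ hT.toFinset, P v) ≠ 0 := by
    by_contra! h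
    exact hprod (Polynomial.funext fun c => by rw [h c, eval_zero])
  rw [eval_prod, Finset.prod_ne_zero_iff] at hc
  refine ⟨fun j => c ^ (j : ℕ), fun v hv => ?_⟩
  have := hc v (hT.mem_toFinset.2 hv)
  rw [eval_finsetSum] at this
  refine fun h => this ?_
  rw [← h]
  exact Finset.sum_congr rfl fun j _ => by rw [eval_mul, eval_C, eval_pow, eval_X, mul_comm]

section Cover

variable {L : Type u} [Field L] [IsAlgClosed L] {ι κ : Type} [Fintype ι] [Fintype κ] {N : ℕ}

/-- The coordinates of a family over a base satisfy polynomial relations with leading coefficient nonzero at a point `a`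
of the base, if the fibre over `a` is finite and the normalising linear forms do not vanish on it. -/
theorem exists_relation_of_finite_fibre {F : Set (ι ⊕ κ → PSpace L N)} (hF : IsClosedSet F) {a : ι → PSpace L N}
    (hfin : {b : κ → PSpace L N | Sum.elim a b ∈ F}.Finite) {α : ι × Fin (N + 1) → L} (hα : IsRep α a)
    {h : κ → Fin (N + 1) → L} (hh : ∀ b w, Sum.elim a b ∈ F → IsRep w b → ∀ i, formVal h w i ≠ 0)
    {A B : Type u} [CommRing A] [CommRing B] [IsDomain B] [Algebra A B] [Algebra L A] [Algebra L B] [IsScalarTower L A B]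
    {x : ι × Fin (N + 1) → A} {y : (ι ⊕ κ) × Fin (N + 1) → B} (hxy : ∀ i j, y (Sum.inl i, j) = algebraMap A B (x (i, j)))
    (hyF : ∀ p : MvPolynomial ((ι ⊕ κ) × Fin (N + 1)) L, IsMultihomogeneous p → (∀ z ∈ F, VanishesAt p z) →
      MvPolynomial.aeval y p = 0)
    (hy : ∀ i, ∑ j, algebraMap L B (h i j) * y (Sum.inr i, j) = 1) (σ : A →ₐ[L] L) (hσ : ∀ q, σ (x q) = α q)
    (t : (ι ⊕ κ) × Fin (N + 1)) : ∃ P : A[X], σ P.leadingCoeff ≠ 0 ∧ aeval (y t) P = 0 := by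
  by_contra! hcon
  let m := RingHom.ker σ
  have hm : m ≠ ⊤ := RingHom.ker_ne_top _
  let Ω := FractionRing B
  have hinj : Function.Injective (algebraMap B Ω) := IsFractionRing.injective B Ω
  -- Without such a relation there is a place of `Frac B`, centred at `a` on the base, at which the
  -- coordinate `y t` has a pole. Finiteness of the fibre will exclude it.
  obtain ⟨k, _, S, ρ, hS, hSρ, hρ, hpole⟩ := exists_place_of_not_integral m hm (Ω := Ω) (x := algebraMap B Ω (y t)) (by
    intro P hP
    rw [aeval_algebraMap_apply]
    refine (map_ne_zero_iff _ hinj).2 (hcon P ?_)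
    have h1 : σ (P.leadingCoeff - 1) = 0 := hP
    rw [map_sub, map_one, sub_eq_zero] at h1
    rw [h1]; exact one_ne_zero)
  let : Algebra L k := (ρ.comp (algebraMap L A)).toAlgebra
  have hρσ : ∀ u, ρ u = algebraMap L k (σ u) := fun u => by
    rw [← sub_eq_zero]
    have h1 : u - algebraMap L A (σ u) ∈ m := by
      change σ _ = 0
      rw [map_sub, AlgHom.commutes]; exact sub_self _
    have h2 := hρ _ h1
    rwa [map_sub] at h2
  have hSL : ∀ c : L, S (algebraMap L Ω c) (algebraMap L k c) := fun c => by
    rw [IsScalarTower.algebraMap_apply L A Ω]; exact hSρ _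
  let Y : (ι ⊕ κ) × Fin (N + 1) → Ω := fun q => algebraMap B Ω (y q)
  have hYl : ∀ i j, S (Y (Sum.inl i, j)) (algebraMap L k (α (i, j))) := fun i j => by
    have h1 := hSρ (x (i, j))
    rwa [hρσ, hσ, IsScalarTower.algebraMap_apply A B Ω, ← hxy] at h1
  have hY1 : ∀ i, ∑ j, algebraMap L Ω (h i j) * Y (Sum.inr i, j) = 1 := fun i => by
    have h1 := congrArg (algebraMap B Ω) (hy i)
    rw [map_sum, map_one] at h1
    rw [← h1]
    exact Finset.sum_congr rfl fun j _ => by rw [map_mul, ← IsScalarTower.algebraMap_apply L B Ω]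
  have hY0 : ∀ i, (fun j => Y (Sum.inr i, j)) ≠ 0 := fun i h0 => by
    have h1 := hY1 i
    rw [Finset.sum_eq_zero fun j _ => by rw [show Y (Sum.inr i, j) = 0 from congrFun h0 j, mul_zero]] at h1
    exact zero_ne_one h1
  have h1 := fun i => hS.exists_ratios (hY0 i)
  choose j hj hSj using h1
  choose w hw using hSj
  let c : κ → Ω := fun i => (Y (Sum.inr i, j i))⁻¹
  have hc0 : ∀ i, c i ≠ 0 := fun i => inv_ne_zero (hj i)
  -- Each fibre block is rescaled by a coordinate of least valuation. Its residues `w` satisfy the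
  -- equations of the fibre over `a`, so they are the coordinates of a point `b` rational over `L`.
  obtain ⟨w₀, hw₀, b, hb, hbF⟩ := exists_rational_of_finite_fibre hF hfin hα (K := k) (w := fun q => w q.1 q.2)
    (fun i => ⟨j i, hS.unique (hw i (j i)) (by rw [inv_mul_cancel₀ (hj i)]; exact hS.one)⟩) (by
      intro p hp hv
      have h1 : MvPolynomial.aeval Y p = 0 := by
        have := MvPolynomial.comp_aeval_apply y (IsScalarTower.toAlgHom L B Ω) p
        rw [hyF p hp hv, map_zero] at this
        exact this.symm
      obtain ⟨d, hd⟩ := hp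
      have h2 := aeval_smul_blocks hd (Sum.elim (fun _ : ι => (1 : Ω)) c) Y
      rw [h1, mul_zero] at h2
      refine hS.unique (x := 0) ?_ hS.zero
      rw [← h2]
      refine hS.mvEval₂ hSL ?_ p
      rintro ⟨i | i, j'⟩
      · have := hYl i j'
        rw [← one_mul (Y (Sum.inl i, j'))] at this
        exact this
      · exact hw i j')
  -- The form `h i` is `1` on the original block, hence `c i` on the rescaled one. So `c i` has
  -- residue the value of the form at `b`, which is nonzero; undoing the rescaling shows that all
  -- coordinates are finite.
  have hform : ∀ i, S (c i) (algebraMap L k (formVal h w₀ i)) := fun i => by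
    have h2 : S (∑ j', algebraMap L Ω (h i j') * (c i * Y (Sum.inr i, j'))) (∑ j', algebraMap L k (h i j') * w i j') :=
      hS.sum fun j' _ => hS.mul (hSL _) (hw i j')
    have h3 : ∑ j', algebraMap L Ω (h i j') * (c i * Y (Sum.inr i, j')) = c i := by
      have h4 : c i * ∑ j', algebraMap L Ω (h i j') * Y (Sum.inr i, j') = c i := by rw [hY1 i, mul_one]
      rw [Finset.mul_sum] at h4
      rw [← h4]
      exact Finset.sum_congr rfl fun j' _ => by rw [h4, mul_left_comm]
    have h4 : ∑ j', algebraMap L k (h i j') * w i j' = algebraMap L k (formVal h w₀ i) := by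
      rw [formVal, map_sum]
      refine Finset.sum_congr rfl fun j' _ => ?_
      rw [map_mul, show w i j' = algebraMap L k (w₀ (i, j')) from congrFun hw₀ (i, j')]
      rfl
    rwa [h3, h4] at h2
  apply hpole
  obtain ⟨i | i, j'⟩ := t
  · exact ⟨_, hYl i j'⟩
  · have h2 := hS.mul (hS.inv (hform i) ((_root_.map_ne_zero _).2 (hh b w₀ hbF hb i))) (hw i j')
    have h3 : (c i)⁻¹ * ((Y (Sum.inr i, j i))⁻¹ * Y (Sum.inr i, j')) = Y (Sum.inr i, j') :=
      inv_mul_cancel_left₀ (hc0 i) _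
    rw [h3] at h2
    exact ⟨_, h2⟩

theorem exists_forms_ne_zero_of_finite {T : Set (κ → PSpace L N)} (hT : T.Finite) :
    ∃ h : κ → Fin (N + 1) → L, ∀ b ∈ T, ∀ w : κ × Fin (N + 1) → L, IsRep w b → ∀ i, formVal h w i ≠ 0 := by
  have hfin : ((fun z : (κ → PSpace L N) × κ => (z.1 z.2).rep) '' (T ×ˢ Set.univ)).Finite := (hT.prod Set.finite_univ).image _
  have := IsAlgClosed.instInfinite (K := L)
  obtain ⟨c, hc⟩ := exists_form_ne_zero hfin (by rintro _ ⟨z, -, rfl⟩; exact (z.1 z.2).rep_nonzero)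
  refine ⟨fun _ => c, fun b hb w hw i => ?_⟩
  obtain ⟨e, he, hew⟩ := hw.exists_smul (isRep_rep b)
  rw [show w = _ from funext hew, formVal_smul]
  exact mul_ne_zero (he i) (hc _ ⟨(b, i), ⟨hb, trivial⟩, rfl⟩)

end Cover

/-! ### Maps between coordinate rings of charts -/

section ChartHom

variable {L : Type u} [Field L] {ι κ : Type} [Fintype ι] [Fintype κ] {N : ℕ}

/-- The homomorphism of coordinate rings of charts induced by a surjective projection. -/
theorem exists_chartRing_hom {D : Set (ι → PSpace L N)} {F : Set (ι ⊕ κ → PSpace L N)} (hF : IsIrreducibleClosed F)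
    (hD : (fun x i => x (Sum.inl i)) '' F = D) (l : ι → Fin (N + 1) → L) (h : κ → Fin (N + 1) → L)
    (hne : (formChart (Sum.elim l h) F).Nonempty) : ∃ f : chartRing l D →ₐ[L] chartRing (Sum.elim l h) F,
      Function.Injective f ∧ ∀ i j, f (chartCoord l D (i, j)) = chartCoord (Sum.elim l h) F (Sum.inl i, j) := by
  have hr : ∀ (v : (ι ⊕ κ) × Fin (N + 1) → L) (p : MvPolynomial (ι × Fin (N + 1)) L),
      MvPolynomial.aeval v (MvPolynomial.rename (Prod.map Sum.inl id) p) =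
        MvPolynomial.aeval (fun q : ι × Fin (N + 1) => v (Sum.inl q.1, q.2)) p := fun v p => by
    rw [MvPolynomial.aeval_rename]; rfl
  have hker : ∀ p ∈ MvPolynomial.vanishingIdeal L (formChart l D), MvPolynomial.rename (Prod.map Sum.inl id) p ∈
      MvPolynomial.vanishingIdeal L (formChart (Sum.elim l h) F) := by
    rintro p hp v ⟨hv, z, hz, hvz⟩
    rw [hr]
    exact hp _ ⟨fun i => hv (Sum.inl i), _, hD ▸ ⟨z, hz, rfl⟩, fun i => hvz (Sum.inl i)⟩
  let f : chartRing l D →ₐ[L] chartRing (Sum.elim l h) F := Ideal.Quotient.liftₐ _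
    ((Ideal.Quotient.mkₐ L _).comp (MvPolynomial.rename (Prod.map Sum.inl id)))
    fun p hp => Ideal.Quotient.eq_zero_iff_mem.2 (hker p hp)
  have hf : ∀ p, f (Ideal.Quotient.mk _ p) = Ideal.Quotient.mk _ (MvPolynomial.rename (Prod.map Sum.inl id) p) := fun p => rfl
  refine ⟨f, (injective_iff_map_eq_zero _).2 fun z hz => ?_, fun i j => ?_⟩
  · obtain ⟨p, rfl⟩ := Ideal.Quotient.mk_surjective z
    rw [hf, Ideal.Quotient.eq_zero_iff_mem] at hz
    -- For injectivity: a homogenisation of `p` pulls back to zero on a nonempty chart of `F`, hence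
    -- on `F` by irreducibility, hence on `D` by surjectivity of the projection.
    obtain ⟨q, hq, h1, -⟩ := exists_homogenisation l p
    have h2 := vanishes_of_mem_vanishingIdeal hF hne (hq.rename Sum.inl_injective) (by
      rintro v ⟨hv, hv'⟩
      have hl : Normalised l fun q : ι × Fin (N + 1) => v (Sum.inl q.1, q.2) := fun i => hv (Sum.inl i)
      rw [hr, h1 L _ hl, ← hr]
      exact hz v ⟨hv, hv'⟩)
    refine Ideal.Quotient.eq_zero_iff_mem.2 ?_
    rintro v ⟨hv, x, hx, hvx⟩
    rw [← h1 L v hv, ← vanishesAt_iff hq hvx]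
    rw [← hD] at hx
    obtain ⟨z, hz, rfl⟩ := hx
    exact (vanishesAt_rename _ _ _).1 (h2 z hz)
  · rw [chartCoord, hf, MvPolynomial.rename_X]; rfl

end ChartHom

section ChartRelations

variable {k : Type u} [Field k] {ι : Type} {N : ℕ} {l : ι → Fin (N + 1) → k} {F : Set (ι → PSpace k N)}

theorem aeval_chartCoord (p : MvPolynomial (ι × Fin (N + 1)) k) :
    MvPolynomial.aeval (chartCoord l F) p = Ideal.Quotient.mk _ p :=
  (DFunLike.congr_fun (MvPolynomial.aeval_unique (Ideal.Quotient.mkₐ k (MvPolynomial.vanishingIdeal k (formChart l F)))) p).symm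

theorem aeval_chartCoord_eq_zero [Fintype ι] {p : MvPolynomial (ι × Fin (N + 1)) k} (hp : IsMultihomogeneous p)
    (h : ∀ x ∈ F, VanishesAt p x) : MvPolynomial.aeval (chartCoord l F) p = 0 := by
  rw [aeval_chartCoord, Ideal.Quotient.eq_zero_iff_mem]
  rintro v ⟨-, x, hx, hv⟩
  exact (vanishesAt_iff hp hv).1 (h x hx)

theorem sum_mul_chartCoord (i : ι) : ∑ j, algebraMap k (chartRing l F) (l i j) * chartCoord l F (i, j) = 1 := by
  have h : MvPolynomial.aeval (chartCoord l F) (formPoly l i) = 1 := by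
    rw [aeval_chartCoord, ← map_one (Ideal.Quotient.mk _), Ideal.Quotient.mk_eq_mk_iff_sub_mem]
    rintro v ⟨hv, -⟩
    rw [map_sub, aeval_formPoly, hv i, map_one, sub_self]
  rw [← h, formPoly, map_sum]
  exact Finset.sum_congr rfl fun j _ => by
    rw [map_mul, MvPolynomial.aeval_X, ← MvPolynomial.algebraMap_eq, AlgHom.commutes]

end ChartRelations

/-! ### Independence of the multiplicity from the generic point -/

section Multiplicity

variable {L : Type u} [Field L] [IsAlgClosed L] {ι κ : Type} [Fintype ι] [Fintype κ] {N : ℕ}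

/-- The number of infinitesimal points of a finite cover of a smooth variety over a generic point infinitesimally close to
a given point does not depend on the generic point, and the points so obtained are generic. -/
theorem exists_encard_infNhd {D : Set (ι → PSpace L N)} {F : Set (ι ⊕ κ → PSpace L N)} (hD : IsIrreducibleClosed D)
    (hDs : IsSmoothVariety D) (hF : IsIrreducibleClosed F) (hFD : IsFiniteCover F D) {a : ι → PSpace L N}
    {b : κ → PSpace L N} (hab : Sum.elim a b ∈ F) :
    ∃ n : ℕ, ∀ a' ∈ infNhd a, IsGenericPoint D a' →
      {b' : κ → PSpace (Komega L) N | Sum.elim a' b' ∈ pointsOver (Komega L) F ∧ b' ∈ infNhd b}.encard = n ∧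
      ∀ b' ∈ infNhd b, Sum.elim a' b' ∈ pointsOver (Komega L) F → IsGenericPoint F (Sum.elim a' b') := by
  have hS := isPlace_omega L
  have haD : a ∈ D := by rw [← hFD.2.1]; exact ⟨_, hab, rfl⟩
  obtain ⟨c, α, hα, hl⟩ := exists_normalised_single (k := L) a
  have hsmooth := hDs c
  rw [← formChart_single] at hsmooth
  set l : ι → Fin (N + 1) → L := fun i => Pi.single (c i) 1
  -- A coordinate chart may miss some points of the fibre over `a`, and integrality near `a` would
  -- then fail. General linear forms give a chart containing the whole finite fibre; on the base, a
  -- coordinate chart is kept because smoothness is stated there.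
  obtain ⟨h, hh⟩ := exists_forms_ne_zero_of_finite (hFD.2.2 a haD)
  obtain ⟨β, hβ, hhβ⟩ : ∃ β, IsRep β b ∧ Normalised h β :=
    ⟨_, (isRep_rep b).exists_normalised (hh b hab _ (isRep_rep b))⟩
  have hαβ : IsRep (blockElim α β) (Sum.elim a b) := isRep_blockElim.2 ⟨hα, hβ⟩
  have hlh : Normalised (Sum.elim l h) (blockElim α β) := normalised_blockElim.2 ⟨hl, hhβ⟩
  have hneF : (formChart (Sum.elim l h) F).Nonempty := ⟨_, hlh, _, hab, hαβ⟩
  have hneD : (formChart l D).Nonempty := ⟨_, hl, _, haD, hα⟩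
  have hpF := isPrime_vanishingIdeal hF hneF
  have hpD := isPrime_vanishingIdeal hD hneD
  obtain ⟨f, hf, hfX⟩ := exists_chartRing_hom hF hFD.2.1 l h hneF
  have habF : Sum.elim a b ∈ pointsOver L F := by rwa [pointsOver_self hF.1]
  let σ := chartEval habF hαβ hlh
  let : Algebra (chartRing l D) (chartRing (Sum.elim l h) F) := f.toRingHom.toAlgebra
  have htow := IsScalarTower.of_algebraMap_eq (R := L) (S := chartRing l D) (A := chartRing (Sum.elim l h) F)
    fun r => (f.commutes r).symm
  have : FaithfulSMul (chartRing l D) (chartRing (Sum.elim l h) F) := (faithfulSMul_iff_algebraMap_injective _ _).2 hf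
  have hfX' : ∀ i j, chartCoord (Sum.elim l h) F (Sum.inl i, j) = algebraMap _ _ (chartCoord l D (i, j)) :=
    fun i j => (hfX i j).symm
  have hadj : Algebra.adjoin (chartRing l D) (Set.range (chartCoord (Sum.elim l h) F)) = ⊤ :=
    adjoin_eq_top_of_tower adjoin_range_chartCoord
  have hσf : ∀ q, (σ.comp f) (chartCoord l D q) = α q := fun q => by
    rw [AlgHom.comp_apply, hfX]
    exact chartEval_chartCoord habF hαβ hlh _
  have hrel := exists_relation_of_finite_fibre hF.1 (hFD.2.2 a haD) hα (fun b w hb => hh b hb w)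
    (x := chartCoord l D) (y := chartCoord (Sum.elim l h) F) hfX' (fun p hp hv => aeval_chartCoord_eq_zero hp hv)
    (fun i => sum_mul_chartCoord (l := Sum.elim l h) (Sum.inr i)) (σ.comp f) hσf
  obtain ⟨n, hn⟩ := exists_ncard_specialisingHoms hS hadj (σ : chartRing (Sum.elim l h) F →+* L)
    (fun p _ => isIntegrallyClosed_localization_of_smooth L _ p) hrel
  refine ⟨n, fun a' ha' hga' => ?_⟩
  obtain ⟨v, hv, hlv, hSv⟩ := exists_isRep_of_mem_infNhd ha' hα hl
  let φ := chartEval hga'.1 hv hlv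
  have hφ : Function.Injective φ := chartEval_injective hga' hv hlv
  have hφS : ∀ u, omegaPlace L (φ u) (σ (algebraMap _ _ u)) := fun u => by
    obtain ⟨p, rfl⟩ := Ideal.Quotient.mk_surjective u
    refine hS.algHom_mvPolynomial (omegaPlace_algebraMap L) (φ.comp (Ideal.Quotient.mkₐ L _))
      ((σ.comp f).comp (Ideal.Quotient.mkₐ L _)) (fun q => ?_) p
    have h1 := hSv q
    rw [← hσf q, ← chartEval_chartCoord hga'.1 hv hlv q] at h1
    exact h1
  obtain ⟨hcard, hinj⟩ := hn (φ : chartRing l D →+* Komega L) hφ hφS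
  -- An extension `ψ` gives the coordinates of a point `(a', b')`; it is generic in `F` because `ψ`
  -- is injective. The converse direction is `hhom`, so extensions and points `b'` correspond.
  have hpt : ∀ ψ ∈ specialisingHoms (omegaPlace L) (φ : chartRing l D →+* Komega L)
      (σ : chartRing (Sum.elim l h) F →+* L), ∃ b' ∈ infNhd b, IsGenericPoint F (Sum.elim a' b') ∧
        Normalised (Sum.elim l h) (fun q => ψ (chartCoord (Sum.elim l h) F q)) ∧
        IsRep (fun q => ψ (chartCoord (Sum.elim l h) F q)) (Sum.elim a' b') := by
    rintro ψ ⟨hψ, hψS⟩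
    let ψ' : chartRing (Sum.elim l h) F →ₐ[L] Komega L := { ψ with
      commutes' := fun r => by
        have h1 := DFunLike.congr_fun hψ (algebraMap L _ r)
        rw [RingHom.comp_apply, ← IsScalarTower.algebraMap_apply] at h1
        exact h1.trans (φ.commutes r) }
    obtain ⟨z, hz⟩ := (normalised_of_algHom ψ').exists_isRep
    have hza : (fun i => z (Sum.inl i)) = a' := by
      refine IsRep.unique (v := v) (fun i => ?_) hv
      have h1 : ∀ j, v (i, j) = ψ' (chartCoord (Sum.elim l h) F (Sum.inl i, j)) := fun j => by
        rw [hfX', ← chartEval_chartCoord hga'.1 hv hlv (i, j)]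
        exact (DFunLike.congr_fun hψ _).symm
      simp only [h1]
      exact hz (Sum.inl i)
    have hzab : z = Sum.elim a' fun i => z (Sum.inr i) := by
      rw [← hza]; exact (Sum.elim_comp_inl_inr z).symm
    refine ⟨fun i => z (Sum.inr i), mem_infNhd_of_isRep
      (v := fun q => ψ (chartCoord (Sum.elim l h) F (Sum.inr q.1, q.2))) (fun i => hz (Sum.inr i)) hβ fun t => ?_, ?_, normalised_of_algHom ψ', ?_⟩
    · have h1 := hψS (chartCoord (Sum.elim l h) F (Sum.inr t.1, t.2))
      rwa [show (σ : chartRing (Sum.elim l h) F →+* L) (chartCoord (Sum.elim l h) F (Sum.inr t.1, t.2)) = β t from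
        chartEval_chartCoord habF hαβ hlh _] at h1
    · rw [← hzab]
      exact isGenericPoint_of_algHom hF hneF ψ' (hinj ψ hψ) hz
    · rw [← hzab]; exact hz
  have hhom : ∀ b' ∈ infNhd b, Sum.elim a' b' ∈ pointsOver (Komega L) F →
      ∃ ψ ∈ specialisingHoms (omegaPlace L) (φ : chartRing l D →+* Komega L) (σ : chartRing (Sum.elim l h) F →+* L),
        IsRep (fun q => ψ (chartCoord (Sum.elim l h) F q)) (Sum.elim a' b') := by
    intro b' hb' hF'
    obtain ⟨w, hw, hhw, hSw⟩ := exists_isRep_of_mem_infNhd hb' hβ hhβ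
    have hvw : IsRep (blockElim v w) (Sum.elim a' b') := isRep_blockElim.2 ⟨hv, hw⟩
    let ψ := chartEval hF' hvw (normalised_blockElim.2 ⟨hlv, hhw⟩)
    have hψ : ∀ q, ψ (chartCoord (Sum.elim l h) F q) = blockElim v w q := chartEval_chartCoord hF' hvw _
    refine ⟨(ψ : chartRing (Sum.elim l h) F →+* Komega L), ⟨?_, fun z => ?_⟩, ?_⟩
    · have h1 : ψ.comp f = φ := by
        refine Ideal.Quotient.algHom_ext _ (MvPolynomial.algHom_ext fun q => ?_)
        have h2 := (hψ (Sum.inl q.1, q.2)).trans (chartEval_chartCoord hga'.1 hv hlv q).symm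
        rw [← hfX] at h2
        exact h2
      exact congrArg (fun g : chartRing l D →ₐ[L] Komega L => (g : chartRing l D →+* Komega L)) h1
    · obtain ⟨p, rfl⟩ := Ideal.Quotient.mk_surjective z
      refine hS.algHom_mvPolynomial (omegaPlace_algebraMap L) (ψ.comp (Ideal.Quotient.mkₐ L _))
        (σ.comp (Ideal.Quotient.mkₐ L _)) (fun q => ?_) p
      have h1 : omegaPlace L (blockElim v w q) (blockElim α β q) := by
        obtain ⟨i | i, j⟩ := q
        · exact hSv (i, j)
        · exact hSw (i, j)
      rw [← hψ q, ← chartEval_chartCoord habF hαβ hlh q] at h1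
      exact h1
    · exact (funext hψ : (fun q => ψ (chartCoord (Sum.elim l h) F q)) = _) ▸ hvw
  refine ⟨?_, fun b' hb' hF' => ?_⟩
  · rw [← hcard]
    choose! G hG1 hG2 hG4 hG3 using hpt
    have himg : {b' : κ → PSpace (Komega L) N | Sum.elim a' b' ∈ pointsOver (Komega L) F ∧ b' ∈ infNhd b} =
        G '' specialisingHoms (omegaPlace L) (φ : chartRing l D →+* Komega L) (σ : chartRing (Sum.elim l h) F →+* L) := by
      ext b'
      constructor
      · rintro ⟨h1, h2⟩
        obtain ⟨ψ, hψ, hr⟩ := hhom b' h2 h1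
        exact ⟨ψ, hψ, funext fun i => congrFun ((hG3 ψ hψ).unique hr) (Sum.inr i)⟩
      · rintro ⟨ψ, hψ, rfl⟩
        exact ⟨(hG2 ψ hψ).1, hG1 ψ hψ⟩
    rw [himg]
    refine Set.InjOn.encard_image fun ψ₁ h₁ ψ₂ h₂ hG => ?_
    have hr := hG3 ψ₁ h₁
    rw [hG] at hr
    have heq := (hG4 ψ₁ h₁).eq_of_isRep (hG4 ψ₂ h₂) hr (hG3 ψ₂ h₂)
    exact ringHom_ext_of_adjoin hadj (h₁.1.trans h₂.1.symm) fun t => congrFun heq t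
  · obtain ⟨ψ, hψ, hr⟩ := hhom b' hb' hF'
    obtain ⟨b'', -, hg, -, hr'⟩ := hpt ψ hψ
    rwa [hr.unique hr']

end Multiplicity

/-! ### The product formula -/

theorem encard_setOf_fst_mem_and_snd_mem {X Y : Type*} {s : Set X} (hs : s.Finite) {t : X → Set Y} {q : ℕ∞}
    (ht : ∀ x ∈ s, (t x).encard = q) : {z : X × Y | z.1 ∈ s ∧ z.2 ∈ t z.1}.encard = s.encard * q := by
  induction s, hs using Set.Finite.induction_on with
  | empty => simp
  | @insert x s hx hs ih =>
    have h : {z : X × Y | z.1 ∈ insert x s ∧ z.2 ∈ t z.1} = Prod.mk x '' t x ∪ {z : X × Y | z.1 ∈ s ∧ z.2 ∈ t z.1} := by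
      ext ⟨x', y⟩
      simp only [Set.mem_insert_iff, Set.mem_union, Set.mem_image, Prod.mk.injEq, Set.mem_ofPred_eq]
      aesop
    rw [h, Set.encard_union_eq, ih fun x' hx' => ht x' (Set.mem_insert_of_mem _ hx'), Set.encard_insert_of_notMem hx,
      (Prod.mk_right_injective x).encard_image, ht x (Set.mem_insert _ _), add_mul, one_mul, add_comm]
    rw [Set.disjoint_left]
    rintro _ ⟨y, -, rfl⟩ ⟨h', -⟩
    exact hx h'

theorem mem_pointsOver_reassoc {k : Type u} [Field k] {K : Type u} [Field K] [Algebra k K] {ι κ μ : Type} [Fintype ι]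
    [Fintype κ] [Fintype μ] {N : ℕ} {F : Set ((ι ⊕ κ) ⊕ μ → PSpace k N)} {x : ι → PSpace K N} {y : κ → PSpace K N}
    {z : μ → PSpace K N} :
    Sum.elim x (Sum.elim y z) ∈ pointsOver K (reassoc F) ↔ Sum.elim (Sum.elim x y) z ∈ pointsOver K F := by
  have h1 : (fun s => Sum.elim x (Sum.elim y z) (Equiv.sumAssoc ι κ μ s)) = Sum.elim (Sum.elim x y) z := by
    funext s; rcases s with (_ | _) | _ <;> rfl
  have h2 : (fun s => Sum.elim (Sum.elim x y) z ((Equiv.sumAssoc ι κ μ).symm s)) = Sum.elim x (Sum.elim y z) := by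
    rw [← h1]; simp
  constructor
  · intro h
    have h3 := mem_pointsOver_image (Equiv.sumAssoc ι κ μ).injective h
    rw [h1] at h3
    convert h3
    refine Set.Subset.antisymm (fun w hw => ⟨fun s => w ((Equiv.sumAssoc ι κ μ).symm s), ?_, by simp⟩) ?_
    · change (fun s => w ((Equiv.sumAssoc ι κ μ).symm (Equiv.sumAssoc ι κ μ s))) ∈ F
      simpa using hw
    · rintro _ ⟨w, hw, rfl⟩; exact hw
  · intro h
    have h3 := mem_pointsOver_image (Equiv.sumAssoc ι κ μ).symm.injective h
    rw [h2] at h3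
    convert h3
    refine Set.Subset.antisymm (fun w hw => ⟨_, hw, by simp⟩) ?_
    rintro _ ⟨w, hw, rfl⟩
    change (fun s => w ((Equiv.sumAssoc ι κ μ).symm (Equiv.sumAssoc ι κ μ s))) ∈ F
    simpa using hw

theorem sumElim_mem_infNhd {L : Type u} [Field L] {ι κ : Type v} {N : ℕ} {a : ι → PSpace L N} {b : κ → PSpace L N}
    {x : ι → PSpace (Komega L) N} {y : κ → PSpace (Komega L) N} :
    Sum.elim x y ∈ infNhd (Sum.elim a b) ↔ x ∈ infNhd a ∧ y ∈ infNhd b :=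
  Sum.forall

theorem exists_hasZariskiMult_mul {L : Type u} [Field L] [IsAlgClosed L] {ι κ μ : Type} [Fintype ι] [Fintype κ] [Fintype μ]
    {N : ℕ} {F₁ : Set (ι → PSpace L N)} {F₂ : Set (ι ⊕ κ → PSpace L N)} {F₃ : Set ((ι ⊕ κ) ⊕ μ → PSpace L N)}
    (hF₁ : IsIrreducibleClosed F₁) (hF₁s : IsSmoothVariety F₁) (hF₂ : IsIrreducibleClosed F₂) (hF₂s : IsSmoothVariety F₂)
    (hF₃ : IsIrreducibleClosed F₃) (h₂₁ : IsFiniteCover F₂ F₁) (h₃₂ : IsFiniteCover F₃ F₂)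
    {a : ι → PSpace L N} {b : κ → PSpace L N} {c : μ → PSpace L N} (habc : Sum.elim (Sum.elim a b) c ∈ F₃) :
    ∃ p q : ℕ, HasZariskiMult F₂ F₁ a b p ∧ HasZariskiMult F₃ F₂ (Sum.elim a b) c q ∧
      HasZariskiMult (reassoc F₃) F₁ a (Sum.elim b c) (p * q) := by
  have hab : Sum.elim a b ∈ F₂ := by rw [← h₃₂.2.1]; exact ⟨_, habc, rfl⟩
  have ha : a ∈ F₁ := by rw [← h₂₁.2.1]; exact ⟨_, hab, rfl⟩
  obtain ⟨p, hp⟩ := exists_encard_infNhd hF₁ hF₁s hF₂ h₂₁ hab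
  obtain ⟨q, hq⟩ := exists_encard_infNhd hF₂ hF₂s hF₃ h₃₂ habc
  have hex := exists_isGenericPoint_mem_infNhd hF₁ ha
  refine ⟨p, q, ⟨hex, fun a' ha' hg => (hp a' ha' hg).1⟩,
    ⟨exists_isGenericPoint_mem_infNhd hF₂ hab, fun z hz hg => (hq z hz hg).1⟩, hex, fun a' ha' hg => ?_⟩
  obtain ⟨hcard, hgen⟩ := hp a' ha' hg
  have hproj : ∀ {z : ι ⊕ κ → PSpace (Komega L) N} {w : μ → PSpace (Komega L) N},
      Sum.elim z w ∈ pointsOver (Komega L) F₃ → z ∈ pointsOver (Komega L) F₂ := fun h => by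
    have := mem_pointsOver_image Sum.inl_injective h
    rwa [h₃₂.2.1] at this
  have hfin : {b' : κ → PSpace (Komega L) N | Sum.elim a' b' ∈ pointsOver (Komega L) F₂ ∧ b' ∈ infNhd b}.Finite :=
    Set.finite_of_encard_eq_coe hcard
  -- Each `(a', b')` is itself generic in `F₂` and near `(a, b)`, so it is a legitimate base point
  -- for the second cover and has exactly `q` points over it.
  have hprod := encard_setOf_fst_mem_and_snd_mem hfin
    (t := fun b' => {c' : μ → PSpace (Komega L) N | Sum.elim (Sum.elim a' b') c' ∈ pointsOver (Komega L) F₃ ∧ c' ∈ infNhd c})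
    fun b' hb' => (hq _ (sumElim_mem_infNhd.2 ⟨ha', hb'.2⟩) (hgen b' hb'.2 hb'.1)).1
  rw [hcard] at hprod
  rw [Nat.cast_mul, ← hprod, ← (Equiv.sumArrowEquivProdArrow κ μ (PSpace (Komega L) N)).symm.injective.encard_image]
  congr 1
  ext z
  rw [Equiv.image_symm_eq_preimage]
  have hz : z = Sum.elim (fun i => z (Sum.inl i)) fun i => z (Sum.inr i) := (Sum.elim_comp_inl_inr z).symm
  change Sum.elim a' z ∈ _ ∧ z ∈ _ ↔ (_ ∧ _) ∧ (_ ∧ _)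
  nth_rewrite 1 2 [hz]
  rw [mem_pointsOver_reassoc, sumElim_mem_infNhd]
  exact ⟨fun h => ⟨⟨hproj h.1, h.2.1⟩, h.1, h.2.2⟩, fun h => ⟨h.2.1, h.1.2, h.2.2⟩⟩

end ZariskiGeometry

end

theorem lemma4p5 {L : Type*} [Field L] [IsAlgClosed L] {N : ℕ}
    (V : Set (ZariskiGeometry.PSpace L N))
    (hV : ZariskiGeometry.IsIrreducibleClosed (ZariskiGeometry.powerSet V (Fin 1)))
    (hVs : ZariskiGeometry.IsSmoothVariety (ZariskiGeometry.powerSet V (Fin 1)))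
    {m k l : ℕ}
    (F₁ : Set (Fin m → ZariskiGeometry.PSpace L N))
    (F₂ : Set (Fin m ⊕ Fin k → ZariskiGeometry.PSpace L N))
    (F₃ : Set ((Fin m ⊕ Fin k) ⊕ Fin l → ZariskiGeometry.PSpace L N))
    (hF₁V : F₁ ⊆ ZariskiGeometry.powerSet V _)
    (hF₂V : F₂ ⊆ ZariskiGeometry.powerSet V _)
    (hF₃V : F₃ ⊆ ZariskiGeometry.powerSet V _)
    (hF₁ : ZariskiGeometry.IsIrreducibleClosed F₁) (hF₁s : ZariskiGeometry.IsSmoothVariety F₁)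
    (hF₂ : ZariskiGeometry.IsIrreducibleClosed F₂) (hF₂s : ZariskiGeometry.IsSmoothVariety F₂)
    (hF₃ : ZariskiGeometry.IsIrreducibleClosed F₃) (hF₃s : ZariskiGeometry.IsSmoothVariety F₃)
    (h₂₁ : ZariskiGeometry.IsFiniteCover F₂ F₁) (h₃₂ : ZariskiGeometry.IsFiniteCover F₃ F₂)
    (a : Fin m → ZariskiGeometry.PSpace L N) (b : Fin k → ZariskiGeometry.PSpace L N)
    (c : Fin l → ZariskiGeometry.PSpace L N)
    (habc : Sum.elim (Sum.elim a b) c ∈ F₃) :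
    ∃ p q : ℕ,
      ZariskiGeometry.HasZariskiMult F₂ F₁ a b p ∧
      ZariskiGeometry.HasZariskiMult F₃ F₂ (Sum.elim a b) c q ∧
      ZariskiGeometry.HasZariskiMult (ZariskiGeometry.reassoc F₃) F₁ a (Sum.elim b c) (p * q) :=
  ZariskiGeometry.exists_hasZariskiMult_mul hF₁ hF₁s hF₂ hF₂s hF₃ h₂₁ h₃₂ habc
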